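/- **Conventions.** Let $B\le A$ be Boolean algebras. $B\le_{\rm rc}A$ means that $\{a\in B:a\le b\}$ is a principal ideal of $B$ for every $b\in A$. $B\le_{\rm free}A$ means that $A=\langle B\cup X\rangle$ for some $X\subseteq A$ independent over $B$. $A$ is *openly generated* if the set of rc-subalgebras of $A$ includes a club of $[A]^{\le\aleph_0}$. For an infinite cardinal $\kappa$, a *$\kappa$-filtration* of $A$ is an increasing continuous sequence $(A_\alpha)_{\alpha<\kappa}$ of subalgebras with union $A$ and $|A_\alpha|<\kappa$ for all $\alpha<\kappa$. An algebra $A$ of size $\kappa$ is *almost free* if it has a $\kappa$-filtration consisting of free Boolean algebras. For $X\subseteq\kappa$ let $\tilde X$ be the set of all $Y\subseteq\kappa$ that agree with $X$ on a club of $\kappa$. Let $\Gamma(A)=\tilde E$, where $E=\{\alpha<\kappa:\{\beta\in(\alpha,\kappa):A_\alpha\not\le_{\rm free}A_\beta\}\text{ is stationary in }\kappa\}$ for a $\kappa$-filtration $(A_\alpha)_{\alpha<\kappa}$ of $A$; that this class is the same for all $\kappa$-filtrations of the algebra below is part of the claim. **$\lambda$-systems.** A *$\lambda$-system* $\Lambda=(S,\lambda_\eta,B_\eta)_{\eta\in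 S}$ consists of a subtree $S$ of $\lambda^{<\omega}$ (closed under initial segments, $\emptyset\in S$), with set of final (i.e. maximal) nodes $S_f$, regular cardinals $\lambda_\eta$ and sets $B_\eta$ such that $\lambda_\emptyset=\lambda$, $B_\emptyset=\emptyset$, for all $\eta\in S$: $\eta\in S_f$ iff $\lambda_\eta=\aleph_0$, and for all $\eta\in S\setminus S_f$: * if $\eta^\frown(\beta)\in S$ then $\beta<\lambda_\eta$ and $\lambda_{\eta^\frown(\beta)}<\lambda_\eta$; the set $E_\eta=\{\beta<\lambda_\eta:\eta^\frown(\beta)\in S\}$ is stationary in $\lambda_\eta$; * $\lambda_{\eta^\frown(\beta)}\le|B_{\eta^\frown(\beta)}|<\lambda_\eta$ for all $\beta\in E_\eta$; * $(B_{\eta^\frown(\beta)})_{\beta\in E_\eta}$ is increasing, and $B_{\eta^\frown(\sigma)}=\bigcup\{B_{\eta^\frown(\beta)}:\beta\in E_\eta\cap\sigma\}$ whenever $\sigma\in E_\eta$ is a limit point of $E_\eta$. $\Lambda$ has *height* $n$ if all final nodes have length $n$. A family $\mathcal S=(s_\eta)_{\eta\in S_f}$ of countably infinite sets is *based on* $\Lambda$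 if $s_\eta\subseteq\bigcup_{m\le{\rm dom}(\eta)}B_{\eta\restriction m}$ for all $\eta\in S_f$. Suppose that $\Lambda$ has height $n$ and that each $s_\eta$ is given as a disjoint union of infinite sets $s_\eta^1,\dots,s_\eta^n$. Then $(\mathcal S,\Lambda)$ has the *strong reshuffling property* if 1. for every $I\subseteq S_f$ with $|I|<\lambda$ and every $\eta_0\in I$ there is a wellordering $<_I$ of $I$ with first element $\eta_0$ such that for all $\eta\in I$ there is $k\in\{1,\dots,n\}$ with $s_\eta^k\cap\bigcup_{\nu<_I\eta}s_\nu$ finite; 2. for all $\mu\in S\setminus S_f$, all $\alpha<\lambda_\mu$ and all $I\subseteq\{\eta\in S_f:\mu\subseteq\eta\}$ with $|I|<\lambda_\mu$ there is a wellordering $<_{\bar I}$ of $\bar I=\{\eta\in S_f:\eta<_{\rm lex}\mu\vee\eta\in I\}$ such that for all $\eta\in\bar I$: (a) $s_\eta^k\cap\bigcup_{\nu<_{\bar I}\eta}s_\nu$ is finite for some $k\in\{1,\dots,n\}$, and (b) if $\mu\subsetneqq\eta$, $\nu\in\bar I$ and either $\nu<_{\rm lex}\mu$, or $\mu\subsetneqq\nu$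 and $\nu({\rm dom}(\mu))\le\alpha<\eta({\rm dom}(\mu))$, then $\nu<_{\bar I}\eta$. **The algebra $A(\mathcal S)$.** Let $H\le K\le L$ be countably generated free Boolean algebras, $(h_m)_{m\in\omega}$ free generators of $H$, and $\omega=s^1\,\dot\cup\cdots\dot\cup\,s^n$ a partition into infinite blocks, satisfying the strong construction principle (CP+): $\langle\{h_m:m\in J\}\rangle\le_{\rm free}L$ for every $J\subseteq\omega$ such that $J\cap s^k$ is finite for some $k$; $L=K\oplus{\rm Fr}(\omega)$; and $H\not\le_{\rm free}L$. For each $\eta\in S_f$ let $(x_{\eta,m})_{m\in\omega}$ be a one-to-one enumeration of $s_\eta$ with $s_\eta^k=\{x_{\eta,m}:m\in s^k\}$ for all $k$. Let $L_\eta$, $\eta\in S_f$, be copies of $L$, with $h_{\eta,m}\in L_\eta$ the copy of $h_m$. Let $A(\mathcal S)=\bigl(\bigoplus_{\eta\in S_f}L_\eta\bigr)/\Theta$, where $\bigoplus$ is the coproduct of Boolean algebras and $\Theta$ is the smallest congruence identifying $h_{\eta,m}$ and $h_{\nu,l}$ whenever $x_{\eta,m}=x_{\nu,l}$. **Lemma.**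 Let $\mathcal S$ be a family of countable sets based on a $\lambda$-system $\Lambda=(S,\lambda_\eta,B_\eta)_{\eta\in S}$ of height $n>1$ such that $(\mathcal S,\Lambda)$ has the strong reshuffling property. Then, for every choice of the data in the construction of $A(\mathcal S)$, the Boolean algebra $A(\mathcal S)$ has size $\lambda$, is almost free and openly generated, and $\Gamma(A(\mathcal S))=\tilde E_\emptyset$. -/

import Mathlib

open Cardinal Set

universe u v w

namespace OpenGen

section BooleanAlgebras

variable {A : Type w} [BooleanAlgebra A]

/-- `B ≤_rc A`: for every `b ∈ A` the ideal `{a ∈ B : a ≤ b}` of `B` is principal. -/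
def IsRelComplete (B : BooleanSubalgebra A) : Prop :=
  ∀ b : A, ∃ a : A, IsGreatest {c : A | c ∈ B ∧ c ≤ b} a

/-- A set `X` is independent over `B` if every nonzero element of `B` meets every elementary
product of elements of `X`. -/
def IndependentOver (B : BooleanSubalgebra A) (X : Set A) : Prop :=
  ∀ b ∈ B, b ≠ ⊥ → ∀ P N : Finset A, (P : Set A) ⊆ X → (N : Set A) ⊆ X → Disjoint P N →
    b ⊓ P.inf id ⊓ N.inf compl ≠ ⊥

/-- A set `X` is independent if all its elementary products are nonzero. The empty product is
`⊤`, so a Boolean algebra with an independent subset is nontrivial. -/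
def Independent (X : Set A) : Prop :=
  ∀ P N : Finset A, (P : Set A) ⊆ X → (N : Set A) ⊆ X → Disjoint P N →
    P.inf id ⊓ N.inf compl ≠ ⊥

/-- `B ≤_free C` for subalgebras `B`, `C` of an ambient algebra: `B ⊆ C` and `C` is generated by
`B` together with a set that is independent over `B`. -/
def FreeOver (B C : BooleanSubalgebra A) : Prop :=
  B ≤ C ∧ ∃ X : Set A, IndependentOver B X ∧ BooleanSubalgebra.closure ((B : Set A) ∪ X) = C

variable (A) in
/-- `A` is a free Boolean algebra: it is generated by an independent set. -/
def IsFree : Prop :=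
  ∃ X : Set A, Independent X ∧ BooleanSubalgebra.closure X = ⊤

variable (A) in
/-- `A` is a free Boolean algebra that is countably generated. -/
def IsCountablyGeneratedFree : Prop :=
  ∃ X : Set A, X.Countable ∧ Independent X ∧ BooleanSubalgebra.closure X = ⊤

/-- A club of `[A]^{≤ℵ₀}`: a set of countable subsets of `A` which is cofinal with respect to
inclusion and closed under unions of increasing `ω`-sequences. -/
structure IsClubOfCountable (𝒞 : Set (Set A)) : Prop where
  countable : ∀ c ∈ 𝒞, c.Countable
  cofinal : ∀ a : Set A, a.Countable → ∃ c ∈ 𝒞, a ⊆ c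
  closed : ∀ c : ℕ → Set A, Monotone c → (∀ i, c i ∈ 𝒞) → (⋃ i, c i) ∈ 𝒞

variable (A) in
/-- `A` is openly generated: the set of rc-subalgebras of `A` includes a club of
`[A]^{≤ℵ₀}`. -/
def OpenlyGenerated : Prop :=
  ∃ 𝒞 : Set (Set A), IsClubOfCountable 𝒞 ∧
    ∀ c ∈ 𝒞, ∃ B : BooleanSubalgebra A, (B : Set A) = c ∧ IsRelComplete B

/-- A `κ`-filtration of `A`: an increasing continuous sequence `(A_α)_{α<κ}` of subalgebras of
size `< κ` with union `A`. -/
structure IsKappaFiltration (κ : Cardinal.{u})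
    (F : Set.Iio κ.ord → BooleanSubalgebra A) : Prop where
  union : ∀ a : A, ∃ α, a ∈ F α
  mono : Monotone F
  continuous : ∀ β, Order.IsSuccLimit β → ∀ a ∈ F β, ∃ α < β, a ∈ F α
  card_lt : ∀ α, Cardinal.lift.{u} #(F α) < Cardinal.lift.{w} κ

variable (A) in
/-- `A` is an almost free Boolean algebra of size `κ`. -/
def AlmostFree (κ : Cardinal.{u}) : Prop :=
  Cardinal.lift.{u} #A = Cardinal.lift.{w} κ ∧
    ∃ F : Set.Iio κ.ord → BooleanSubalgebra A, IsKappaFiltration κ F ∧ ∀ α, IsFree (F α)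

/-- For a filtration `(A_α)_{α<κ}`, the set
`{α < κ : {β ∈ (α, κ) : A_α ≰_free A_β} is stationary in κ}`. -/
def nonFreeSet {κ : Cardinal.{u}} (F : Set.Iio κ.ord → BooleanSubalgebra A) :
    Set (Set.Iio κ.ord) :=
  {α | IsStationary {β | α < β ∧ ¬ FreeOver (F α) (F β)}}

end BooleanAlgebras

/-- The class `X̃` of `X` modulo clubs: all `Y` which agree with `X` on some club. -/
def clubClass {κ : Cardinal.{u}} (X : Set (Set.Iio κ.ord)) : Set (Set (Set.Iio κ.ord)) :=
  {Y | ∃ C : Set (Set.Iio κ.ord), IsClub C ∧ Y ∩ C = X ∩ C}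

/-- The invariant `Γ(A)` of an algebra `A` of size `κ`: the class modulo clubs of
`nonFreeSet F`, where `F` is a `κ`-filtration of `A`. To avoid a choice, the union over all `F` is
taken. As classes are disjoint or equal, an equation `Γ(A) = X̃` says precisely that `A` has a
`κ`-filtration and that every `κ`-filtration `F` of `A` satisfies `clubClass (nonFreeSet F) = X̃`. -/
def Gamma (A : Type w) [BooleanAlgebra A] (κ : Cardinal.{u}) : Set (Set (Set.Iio κ.ord)) :=
  {Y | ∃ F : Set.Iio κ.ord → BooleanSubalgebra A,
    IsKappaFiltration κ F ∧ Y ∈ clubClass (nonFreeSet F)}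

section Constructions

/-- A Boolean algebra structure from the usual identities. -/
@[reducible]
def booleanAlgebraOfIdentities (α : Type*) [Max α] [Min α] [Compl α] [Top α] [Bot α]
    (sup_comm : ∀ a b : α, a ⊔ b = b ⊔ a)
    (sup_assoc : ∀ a b c : α, a ⊔ b ⊔ c = a ⊔ (b ⊔ c))
    (inf_comm : ∀ a b : α, a ⊓ b = b ⊓ a)
    (inf_assoc : ∀ a b c : α, a ⊓ b ⊓ c = a ⊓ (b ⊓ c))
    (sup_inf_self : ∀ a b : α, a ⊔ a ⊓ b = a)
    (inf_sup_self : ∀ a b : α, a ⊓ (a ⊔ b) = a)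
    (inf_sup_left : ∀ a b c : α, a ⊓ (b ⊔ c) = a ⊓ b ⊔ a ⊓ c)
    (inf_compl : ∀ a : α, a ⊓ aᶜ = ⊥)
    (sup_compl : ∀ a : α, a ⊔ aᶜ = ⊤) : BooleanAlgebra α :=
  let l : Lattice α := Lattice.mk' sup_comm sup_assoc inf_comm inf_assoc sup_inf_self inf_sup_self
  let d : DistribLattice α := DistribLattice.ofInfSupLe (fun a b c => (inf_sup_left a b c).le)
  { d with
    compl := compl
    top := ⊤
    bot := ⊥
    inf_compl_le_bot := fun a => (inf_compl a).le
    top_le_sup_compl := fun a => (sup_compl a).ge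
    le_top := fun a => by
      have h : a ⊔ ⊤ = ⊤ := by
        rw [← sup_compl a, ← sup_assoc]
        congr 1
        exact _root_.sup_idem a
      exact (sup_eq_right (a := a)).1 h
    bot_le := fun a => by
      have h : ⊥ ⊔ a = a := by
        rw [← inf_compl a, sup_comm, sup_inf_self]
      exact (sup_eq_right (b := a)).1 h }

/-- The smallest congruence of the Boolean algebra `G` which contains the relation `R`. -/
inductive BoolCongr {G : Type w} [BooleanAlgebra G] (R : G → G → Prop) : G → G → Prop
  | of {a b} : R a b → BoolCongr R a b
  | refl (a) : BoolCongr R a a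
  | symm {a b} : BoolCongr R a b → BoolCongr R b a
  | trans {a b c} : BoolCongr R a b → BoolCongr R b c → BoolCongr R a c
  | sup {a b c d} : BoolCongr R a b → BoolCongr R c d → BoolCongr R (a ⊔ c) (b ⊔ d)
  | inf {a b c d} : BoolCongr R a b → BoolCongr R c d → BoolCongr R (a ⊓ c) (b ⊓ d)
  | compl {a b} : BoolCongr R a b → BoolCongr R aᶜ bᶜ

/-- The smallest congruence containing `R`, as a setoid. -/
def boolCongrSetoid {G : Type w} [BooleanAlgebra G] (R : G → G → Prop) : Setoid G where
  r := BoolCongr R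
  iseqv := ⟨BoolCongr.refl, BoolCongr.symm, BoolCongr.trans⟩

/-- The quotient of `G` by the smallest congruence containing `R`. -/
def BoolQuot {G : Type w} [BooleanAlgebra G] (R : G → G → Prop) : Type w :=
  Quotient (boolCongrSetoid R)

namespace BoolQuot

variable {G : Type w} [BooleanAlgebra G] {R : G → G → Prop}

instance : Max (BoolQuot R) :=
  ⟨Quotient.map₂ (· ⊔ ·) fun _ _ h _ _ h' => BoolCongr.sup h h'⟩
instance : Min (BoolQuot R) :=
  ⟨Quotient.map₂ (· ⊓ ·) fun _ _ h _ _ h' => BoolCongr.inf h h'⟩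
instance : Compl (BoolQuot R) := ⟨Quotient.map compl fun _ _ h => BoolCongr.compl h⟩
instance : Top (BoolQuot R) := ⟨Quotient.mk _ ⊤⟩
instance : Bot (BoolQuot R) := ⟨Quotient.mk _ ⊥⟩

instance : BooleanAlgebra (BoolQuot R) :=
  booleanAlgebraOfIdentities (BoolQuot R)
    (by rintro ⟨a⟩ ⟨b⟩; exact congrArg (Quotient.mk _) (sup_comm a b))
    (by rintro ⟨a⟩ ⟨b⟩ ⟨c⟩; exact congrArg (Quotient.mk _) (sup_assoc a b c))
    (by rintro ⟨a⟩ ⟨b⟩; exact congrArg (Quotient.mk _) (inf_comm a b))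
    (by rintro ⟨a⟩ ⟨b⟩ ⟨c⟩; exact congrArg (Quotient.mk _) (inf_assoc a b c))
    (by rintro ⟨a⟩ ⟨b⟩; exact congrArg (Quotient.mk _) sup_inf_self)
    (by rintro ⟨a⟩ ⟨b⟩; exact congrArg (Quotient.mk _) inf_sup_self)
    (by rintro ⟨a⟩ ⟨b⟩ ⟨c⟩; exact congrArg (Quotient.mk _) (inf_sup_left a b c))
    (by rintro ⟨a⟩; exact congrArg (Quotient.mk _) (inf_compl_self a))
    (by rintro ⟨a⟩; exact congrArg (Quotient.mk _) sup_compl_eq_top)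

end BoolQuot

/-- Boolean terms in the elements of the Boolean algebras `L i`, `i ∈ I`. -/
inductive BoolTerm {I : Type v} (L : I → Type w) : Type (max v w)
  | of (i : I) (a : L i) : BoolTerm L
  | bot : BoolTerm L
  | top : BoolTerm L
  | sup : BoolTerm L → BoolTerm L → BoolTerm L
  | inf : BoolTerm L → BoolTerm L → BoolTerm L
  | compl : BoolTerm L → BoolTerm L

/-- The smallest congruence on Boolean terms for which the quotient is a Boolean algebra and all
the maps `L i → BoolTerm L` become homomorphisms. -/
inductive CoprodRel {I : Type v} {L : I → Type w} [∀ i, BooleanAlgebra (L i)] :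
    BoolTerm L → BoolTerm L → Prop
  | refl (a : BoolTerm L) : CoprodRel a a
  | symm {a b : BoolTerm L} : CoprodRel a b → CoprodRel b a
  | trans {a b c : BoolTerm L} : CoprodRel a b → CoprodRel b c → CoprodRel a c
  | sup {a b c d : BoolTerm L} : CoprodRel a b → CoprodRel c d → CoprodRel (a.sup c) (b.sup d)
  | inf {a b c d : BoolTerm L} : CoprodRel a b → CoprodRel c d → CoprodRel (a.inf c) (b.inf d)
  | compl {a b : BoolTerm L} : CoprodRel a b → CoprodRel a.compl b.compl
  | sup_comm (a b : BoolTerm L) : CoprodRel (a.sup b) (b.sup a)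
  | sup_assoc (a b c : BoolTerm L) : CoprodRel ((a.sup b).sup c) (a.sup (b.sup c))
  | inf_comm (a b : BoolTerm L) : CoprodRel (a.inf b) (b.inf a)
  | inf_assoc (a b c : BoolTerm L) : CoprodRel ((a.inf b).inf c) (a.inf (b.inf c))
  | sup_inf_self (a b : BoolTerm L) : CoprodRel (a.sup (a.inf b)) a
  | inf_sup_self (a b : BoolTerm L) : CoprodRel (a.inf (a.sup b)) a
  | inf_sup_left (a b c : BoolTerm L) : CoprodRel (a.inf (b.sup c)) ((a.inf b).sup (a.inf c))
  | inf_compl (a : BoolTerm L) : CoprodRel (a.inf a.compl) .bot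
  | sup_compl (a : BoolTerm L) : CoprodRel (a.sup a.compl) .top
  | of_bot (i) : CoprodRel (.of i ⊥) .bot
  | of_top (i) : CoprodRel (.of i ⊤) .top
  | of_sup (i) (a b : L i) : CoprodRel (.of i (a ⊔ b)) ((BoolTerm.of i a).sup (.of i b))
  | of_inf (i) (a b : L i) : CoprodRel (.of i (a ⊓ b)) ((BoolTerm.of i a).inf (.of i b))
  | of_compl (i) (a : L i) : CoprodRel (.of i aᶜ) (BoolTerm.of i a).compl

/-- The congruence of the coproduct, as a setoid. -/
def coprodSetoid {I : Type v} (L : I → Type w) [∀ i, BooleanAlgebra (L i)] :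
    Setoid (BoolTerm L) where
  r := CoprodRel
  iseqv := ⟨CoprodRel.refl, CoprodRel.symm, CoprodRel.trans⟩

/-- The coproduct (free product) `⨁_{i ∈ I} L i` of Boolean algebras. -/
def BoolCoprod {I : Type v} (L : I → Type w) [∀ i, BooleanAlgebra (L i)] : Type (max v w) :=
  Quotient (coprodSetoid L)

namespace BoolCoprod

variable {I : Type v} {L : I → Type w} [∀ i, BooleanAlgebra (L i)]

/-- The canonical map `L i → ⨁_{i ∈ I} L i`. -/
def incl (i : I) (a : L i) : BoolCoprod L := Quotient.mk _ (.of i a)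

instance : Max (BoolCoprod L) :=
  ⟨Quotient.map₂ .sup fun _ _ h _ _ h' => CoprodRel.sup h h'⟩
instance : Min (BoolCoprod L) :=
  ⟨Quotient.map₂ .inf fun _ _ h _ _ h' => CoprodRel.inf h h'⟩
instance : Compl (BoolCoprod L) := ⟨Quotient.map .compl fun _ _ h => CoprodRel.compl h⟩
instance : Top (BoolCoprod L) := ⟨Quotient.mk _ .top⟩
instance : Bot (BoolCoprod L) := ⟨Quotient.mk _ .bot⟩

instance : BooleanAlgebra (BoolCoprod L) :=
  booleanAlgebraOfIdentities (BoolCoprod L)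
    (by rintro ⟨a⟩ ⟨b⟩; exact Quotient.sound (CoprodRel.sup_comm a b))
    (by rintro ⟨a⟩ ⟨b⟩ ⟨c⟩; exact Quotient.sound (CoprodRel.sup_assoc a b c))
    (by rintro ⟨a⟩ ⟨b⟩; exact Quotient.sound (CoprodRel.inf_comm a b))
    (by rintro ⟨a⟩ ⟨b⟩ ⟨c⟩; exact Quotient.sound (CoprodRel.inf_assoc a b c))
    (by rintro ⟨a⟩ ⟨b⟩; exact Quotient.sound (CoprodRel.sup_inf_self a b))
    (by rintro ⟨a⟩ ⟨b⟩; exact Quotient.sound (CoprodRel.inf_sup_self a b))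
    (by rintro ⟨a⟩ ⟨b⟩ ⟨c⟩; exact Quotient.sound (CoprodRel.inf_sup_left a b c))
    (by rintro ⟨a⟩; exact Quotient.sound (CoprodRel.inf_compl a))
    (by rintro ⟨a⟩; exact Quotient.sound (CoprodRel.sup_compl a))

end BoolCoprod

end Constructions

/-- The objects provided by the strong construction principle (CP+) for Boolean algebras and the
number `n`: countably generated free Boolean algebras `H ≤ K ≤ L`, free generators `(h_m)` of `H`,
and a partition of `ω` into `n` infinite blocks, with the properties (i) and (ii) of (CP+). -/
structure CPPlus (n : ℕ) (L : Type w) [BooleanAlgebra L] where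
  H : BooleanSubalgebra L
  K : BooleanSubalgebra L
  h : ℕ → L
  block : Fin n → Set ℕ
  H_le_K : H ≤ K
  K_free : IsCountablyGeneratedFree K
  L_free : IsCountablyGeneratedFree L
  h_injective : Function.Injective h
  h_independent : Independent (Set.range h)
  h_generates : BooleanSubalgebra.closure (Set.range h) = H
  block_infinite : ∀ k, (block k).Infinite
  block_disjoint : Pairwise fun k l => Disjoint (block k) (block l)
  block_cover : ⋃ k, block k = Set.univ
  /-- Property (i). -/
  closure_freeOver : ∀ J : Set ℕ, (∃ k, (J ∩ block k).Finite) →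
    FreeOver (BooleanSubalgebra.closure (h '' J)) ⊤
  /-- Property (ii), first part: `L = K ⊕ Fr(ω)`. -/
  L_eq_coprod : ∃ x : ℕ → L, Function.Injective x ∧ IndependentOver K (Set.range x) ∧
    BooleanSubalgebra.closure ((K : Set L) ∪ Set.range x) = ⊤
  /-- Property (ii), second part. -/
  not_freeOver : ¬ FreeOver H ⊤

/-- The relation on `⨁_{i ∈ I} L_i`, all `L_i` being copies of `L`, which identifies the copy of
`h_m` in `L_i` with the copy of `h_l` in `L_j` whenever `x_{i,m} = x_{j,l}`. -/
inductive GlueRel {I : Type v} {X : Type u} {L : Type w} [BooleanAlgebra L]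
    (h : ℕ → L) (x : I → ℕ → X) :
    BoolCoprod (fun _ : I => L) → BoolCoprod (fun _ : I => L) → Prop
  | glue (i j : I) (m l : ℕ) : x i m = x j l →
      GlueRel h x (BoolCoprod.incl i (h m)) (BoolCoprod.incl j (h l))

/-- The Boolean algebra `A(𝒮)` associated with the enumerations `(x_{i,m})_m` of the members
`s_i` of the family `𝒮`. -/
abbrev AlgebraOf {I : Type v} {X : Type u} {L : Type w} [BooleanAlgebra L]
    (h : ℕ → L) (x : I → ℕ → X) : Type (max v w) :=
  BoolQuot (GlueRel h x)

/-- For a set `S` of finite sequences of ordinals and `η`, this says that `η` is a final node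
of `S`: it is in `S` and has no proper extension in `S`. -/
def IsFinalNode (S : Set (List Ordinal.{u})) (η : List Ordinal.{u}) : Prop :=
  η ∈ S ∧ ∀ ν ∈ S, η <+: ν → ν = η

/-- `σ` is a limit point of the set `E` of ordinals. -/
def IsLimitPoint (E : Set Ordinal.{u}) (σ : Ordinal.{u}) : Prop :=
  σ ≠ 0 ∧ ∀ γ < σ, ∃ β ∈ E, γ < β ∧ β < σ

/-- A `κ`-system `(S, λ_η, B_η)_{η ∈ S}`, with the sets `B_η` taken inside a set `X`. Nodes are
finite sequences of ordinals, so `η ++ [β]` is the extension of `η` by `β`, and `<+:` is the tree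
order. As usual, stationary sets are considered in regular uncountable cardinals only: the
cardinals `λ_η` are regular (for final nodes this says nothing, as `λ_η = ℵ₀`). The values of
`lam` and `B` outside `S` are irrelevant. -/
structure LambdaSystem (κ : Cardinal.{u}) (X : Type u) where
  S : Set (List Ordinal.{u})
  lam : List Ordinal.{u} → Cardinal.{u}
  B : List Ordinal.{u} → Set X
  root_mem : [] ∈ S
  prefix_mem : ∀ η ∈ S, ∀ μ, μ <+: η → μ ∈ S
  lam_root : lam [] = κ
  lam_regular : ∀ η ∈ S, (lam η).IsRegular
  final_iff : ∀ η ∈ S, IsFinalNode S η ↔ lam η = ℵ₀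
  child_lt : ∀ η ∈ S, ∀ β, η ++ [β] ∈ S → β < (lam η).ord ∧ lam (η ++ [β]) < lam η
  stationary : ∀ η ∈ S, ¬ IsFinalNode S η →
    IsStationary {β : Set.Iio (lam η).ord | η ++ [β.1] ∈ S}
  B_root : B [] = ∅
  B_card : ∀ η ∈ S, ∀ β, η ++ [β] ∈ S →
    lam (η ++ [β]) ≤ #(B (η ++ [β])) ∧ #(B (η ++ [β])) < lam η
  B_mono : ∀ η ∈ S, ∀ β γ, η ++ [β] ∈ S → η ++ [γ] ∈ S → β ≤ γ → B (η ++ [β]) ⊆ B (η ++ [γ])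
  B_continuous : ∀ η ∈ S, ∀ σ, η ++ [σ] ∈ S → IsLimitPoint {β | η ++ [β] ∈ S} σ →
    B (η ++ [σ]) = ⋃ β ∈ {β | η ++ [β] ∈ S ∧ β < σ}, B (η ++ [β])

namespace LambdaSystem

variable {κ : Cardinal.{u}} {X : Type u} (Λ : LambdaSystem κ X)

/-- The set `S_f` of final nodes, as a type. -/
abbrev FinalNode : Type (u + 1) := {η : List Ordinal.{u} // IsFinalNode Λ.S η}

/-- The set `E_∅ ⊆ κ` of all `β` with `(β) ∈ S`. -/
def rootSet : Set (Set.Iio κ.ord) := {β | [β.1] ∈ Λ.S}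

/-- `Λ` has height `n`: all final nodes have length `n`. -/
def HasHeight (n : ℕ) : Prop := ∀ η, IsFinalNode Λ.S η → η.length = n

/-- The union of the sets `B_{η ↾ m}`, `m ≤ dom(η)`. -/
def Bbar (η : List Ordinal.{u}) : Set X := ⋃ μ ∈ {μ | μ <+: η}, Λ.B μ

/-- A family `(s_η)_{η ∈ S_f}` of countably infinite sets is based on `Λ`. -/
def IsBasedOn (s : Λ.FinalNode → Set X) : Prop :=
  ∀ η, (s η).Countable ∧ (s η).Infinite ∧ s η ⊆ Λ.Bbar η.1

/-- The set of all final nodes `η` such that `η <_lex μ` or `η ∈ I`. -/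
def lexBelow (μ : List Ordinal.{u}) (I : Set Λ.FinalNode) : Set Λ.FinalNode :=
  {η | List.Lex (· < ·) η.1 μ ∨ η ∈ I}

/-- The strong reshuffling property of `(𝒮, Λ)`, where `𝒮 = (s_η)_{η ∈ S_f}` and `s_η` is
divided into the parts `s_η^k = p η k`. Since `μ ⊊ η` in (2), the entry `η(dom μ)` is
`η.getD μ.length 0`. -/
structure StrongReshuffling {n : ℕ} (s : Λ.FinalNode → Set X)
    (p : Λ.FinalNode → Fin n → Set X) : Prop where
  /-- Requirement (1). -/
  one : ∀ (I : Set Λ.FinalNode) (η₀ : I), #I < Cardinal.lift.{u + 1} κ →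
    ∃ r : I → I → Prop, IsWellOrder I r ∧ (∀ ν : I, ν ≠ η₀ → r η₀ ν) ∧
      ∀ η : I, ∃ k, (p η k ∩ ⋃ ν ∈ {ν : I | r ν η}, s ν).Finite
  /-- Requirement (2). -/
  two : ∀ μ ∈ Λ.S, ¬ IsFinalNode Λ.S μ → ∀ α < (Λ.lam μ).ord,
    ∀ I : Set Λ.FinalNode, (∀ η ∈ I, μ <+: η.1) → #I < Cardinal.lift.{u + 1} (Λ.lam μ) →
    ∃ r : Λ.lexBelow μ I → Λ.lexBelow μ I → Prop, IsWellOrder (Λ.lexBelow μ I) r ∧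
      ∀ η : Λ.lexBelow μ I,
        (∃ k, (p η k ∩ ⋃ ν ∈ {ν : Λ.lexBelow μ I | r ν η}, s ν).Finite) ∧
        (μ <+: η.1.1 → μ ≠ η.1.1 → ∀ ν : Λ.lexBelow μ I,
          (List.Lex (· < ·) ν.1.1 μ ∨
            (μ <+: ν.1.1 ∧ μ ≠ ν.1.1 ∧ ν.1.1.getD μ.length 0 ≤ α ∧
              α < η.1.1.getD μ.length 0)) →
          r ν η)

end LambdaSystem

end OpenGen

open OpenGen

/-! Independence and amalgamation are read in the Stone space. A set is independent over `B` when
every point can be changed arbitrarily on the set while being kept on `B`; `G` and `P` are freely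
amalgamated over `C` when points agreeing on `C` have a common extension. By `amalgam_sub`, the
algebras `sub e J` generated by the copies indexed by `J` amalgamate freely over what they share,
and amalgamation transports free extensions and yields interpolants.

Freeness: well-order a set of final nodes so that some block of each s_η meets the earlier sets in a
finite set. The first half of (CP+) makes each copy of L free over the generators it shares with its
predecessors, and the independent sets obtained add up (`freeOver_sub`). Strong reshuffling supplies
such orders with prescribed initial segments (`freeOver_lexLT`, `freeOver_region`). For the
canonical filtration, indexed by the first entry of final nodes, all stages are free, and every
stage is free over stage α+1 of a smaller α. If α is not in E_∅, stages α and α+1 coincide.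

Non-freeness: if H were relatively complete in L, the spare generators in L = K ⊕ Fr(ω) would make L
free over H; hence H is not relatively complete. This obstruction lives at the final nodes, and
`not_freeOver` carries it down the tree. If both G and its extension by the copies above μ had N as
a free extension, comparing the two bases on a club and choosing a stationary index β there would
give the same situation at μ⌢(β). The statement is therefore made for arbitrary G and N. Starting
from (α) with α in E_∅, it refutes freeness of later stages over stage α. Any two filtrations agree
on a club, which gives Γ.

Open generation: for a countable nonempty set I of final nodes closed under suitable
countable-valued functions, elements are projected first to a stage δ, where δ is the least strict
bound of the first entries of I, and from there to `sub e I`. Both projections come from free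
extensions. The first uses that nodes of length one are not final, which is where n > 1 enters. -/

namespace OpenGen

open BooleanSubalgebra

/-! ### Points of Boolean algebras and separation -/

/-- A point of the Stone space of a Boolean algebra, i.e. a homomorphism to the two-element
algebra `Prop`. -/
structure BoolPoint (A : Type*) [BooleanAlgebra A] where
  holds : A → Prop
  inf_iff : ∀ a b, holds (a ⊓ b) ↔ holds a ∧ holds b
  compl_iff : ∀ a, holds aᶜ ↔ ¬ holds a

namespace BoolPoint

attribute [simp] inf_iff compl_iff

variable {A : Type*} [BooleanAlgebra A] (φ ψ : BoolPoint A)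

@[simp] theorem bot_iff : φ.holds ⊥ ↔ False := by
  have := φ.inf_iff ⊥ ⊥ᶜ
  simp only [inf_compl_self, compl_iff] at this
  tauto

@[simp] theorem top_iff : φ.holds ⊤ ↔ True := by
  rw [← compl_bot, compl_iff, bot_iff]; simp

@[simp] theorem sup_iff (a b : A) : φ.holds (a ⊔ b) ↔ φ.holds a ∨ φ.holds b := by
  have h : a ⊔ b = (aᶜ ⊓ bᶜ)ᶜ := by simp
  rw [h, compl_iff, inf_iff, compl_iff, compl_iff]; tauto

theorem mono {a b : A} (h : a ≤ b) (ha : φ.holds a) : φ.holds b := by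
  rw [← inf_eq_left.2 h, inf_iff] at ha
  exact ha.2

@[simp] theorem finset_inf_iff {ι : Type*} (s : Finset ι) (f : ι → A) :
    φ.holds (s.inf f) ↔ ∀ i ∈ s, φ.holds (f i) := by
  classical
  induction s using Finset.induction_on with
  | empty => simp
  | insert a s _ ih => simp [ih]

/-- The subalgebra on which two points agree. -/
def eqLocus : BooleanSubalgebra A where
  carrier := {a | φ.holds a ↔ ψ.holds a}
  supClosed' := fun a ha b hb => by simp only [mem_ofPred_eq, sup_iff] at *; tauto
  infClosed' := fun a ha b hb => by simp only [mem_ofPred_eq, inf_iff] at *; tauto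
  compl_mem' := fun {a} ha => by simp only [mem_ofPred_eq, compl_iff] at *; tauto
  bot_mem' := by simp

variable {φ ψ} in
theorem mem_eqLocus {a : A} : a ∈ eqLocus φ ψ ↔ (φ.holds a ↔ ψ.holds a) := Iff.rfl

/-- The point `φ ∘ f`. -/
def comp {B : Type*} [BooleanAlgebra B] (f : BoundedLatticeHom B A) : BoolPoint B where
  holds b := φ.holds (f b)
  inf_iff := by simp
  compl_iff := by simp

/-- The upward closure of S is a proper filter; the complement of a prime ideal disjoint from it is
the point. -/
theorem exists_of_infClosed {S : Set A} (hne : S.Nonempty) (hS : InfClosed S) (hbot : ⊥ ∉ S) :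
    ∃ φ : BoolPoint A, ∀ s ∈ S, φ.holds s := by
  have hF : Order.IsPFilter {a | ∃ s ∈ S, s ≤ a} := by
    refine Order.IsPFilter.of_def ?_ ?_ ?_
    · obtain ⟨s, hs⟩ := hne
      exact ⟨s, s, hs, le_rfl⟩
    · rintro a ⟨s, hs, hsa⟩ b ⟨t, ht, htb⟩
      exact ⟨s ⊓ t, ⟨s ⊓ t, hS hs ht, le_rfl⟩, inf_le_left.trans hsa, inf_le_right.trans htb⟩
    · rintro a b hab ⟨s, hs, hsa⟩
      exact ⟨s, hs, hsa.trans hab⟩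
  have hmem : ∀ a, a ∈ hF.toPFilter ↔ ∃ s ∈ S, s ≤ a := fun a => Iff.rfl
  have hdisj : Disjoint (hF.toPFilter : Set A) (Order.Ideal.principal (⊥ : A) : Set A) := by
    rw [Set.disjoint_left]
    rintro a ⟨s, hs, hsa⟩ ha
    have : a ≤ ⊥ := ha
    exact hbot (by rwa [le_bot_iff.1 (hsa.trans this)] at hs)
  obtain ⟨J, hJ, -, hFJ⟩ := DistribLattice.prime_ideal_of_disjoint_filter_ideal hdisj
  refine ⟨⟨fun a => a ∉ J, fun a b => ?_, fun a => ?_⟩, fun s hs hsJ => ?_⟩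
  · constructor
    · intro h
      exact ⟨fun ha => h (J.lower inf_le_left ha), fun hb => h (J.lower inf_le_right hb)⟩
    · rintro ⟨ha, hb⟩ h
      exact (hJ.mem_or_mem h).elim ha hb
  · constructor
    · intro h ha
      exact h (hJ.mem_or_compl_mem.resolve_left ha)
    · intro h ha
      rw [not_not] at h
      refine hJ.top_notMem ?_
      rw [← sup_compl_eq_top (x := a)]
      exact Order.Ideal.sup_mem h ha
  · exact Set.disjoint_left.1 hFJ ((hmem s).2 ⟨s, hs, le_rfl⟩) hsJ

theorem exists_holds {a : A} (ha : a ≠ ⊥) : ∃ φ : BoolPoint A, φ.holds a := by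
  obtain ⟨φ, h⟩ := exists_of_infClosed (S := {a}) (by simp) (by simp) (by simpa using ha.symm)
  exact ⟨φ, h a rfl⟩

theorem le_of_forall {a b : A} (h : ∀ φ : BoolPoint A, φ.holds a → φ.holds b) : a ≤ b := by
  rw [← sdiff_eq_bot_iff, _root_.sdiff_eq]
  by_contra hne
  obtain ⟨φ, hφ⟩ := exists_holds hne
  rw [inf_iff, compl_iff] at hφ
  exact hφ.2 (h φ hφ.1)

theorem eq_of_forall {a b : A} (h : ∀ φ : BoolPoint A, φ.holds a ↔ φ.holds b) : a = b :=
  le_antisymm (le_of_forall fun φ => (h φ).1) (le_of_forall fun φ => (h φ).2)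

theorem eq_bot_of_forall {a : A} (h : ∀ φ : BoolPoint A, ¬ φ.holds a) : a = ⊥ :=
  eq_of_forall fun φ => by simp [h φ]

/-- Without an interpolant, the differences of elements of C above a and elements of C below b form
a meet-closed set without ⊥. A point θ on that set is consistent on C both with a and with the
complement of b, so its restriction to C extends in two ways. -/
theorem exists_pair_of_no_interpolant (C : BooleanSubalgebra A) {a b : A}
    (h : ∀ c ∈ C, a ≤ c → ¬ c ≤ b) :
    ∃ φ ψ : BoolPoint A, C ≤ eqLocus φ ψ ∧ φ.holds a ∧ ¬ ψ.holds b := by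
  obtain ⟨θ, hθ⟩ := exists_of_infClosed
    (S := {s | ∃ c ∈ C, ∃ d ∈ C, a ≤ c ∧ d ≤ b ∧ s = c ⊓ dᶜ})
    ⟨⊤, ⊤, by simp, ⊥, by simp, by simp, by simp, by simp⟩
    (by
      rintro _ ⟨c, hc, d, hd, hac, hdb, rfl⟩ _ ⟨c', hc', d', hd', hac', hdb', rfl⟩
      refine ⟨c ⊓ c', inf_mem hc hc', d ⊔ d', sup_mem hd hd', le_inf hac hac', sup_le hdb hdb', ?_⟩
      rw [compl_sup]; ac_rfl)
    (by
      rintro ⟨c, hc, d, hd, hac, hdb, h0⟩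
      refine h c hc hac (le_trans ?_ hdb)
      rw [← sdiff_eq_bot_iff, _root_.sdiff_eq]; exact h0.symm)
  have extend : ∀ e : A, (∀ c ∈ C, e ≤ c → θ.holds c) →
      ∃ φ : BoolPoint A, C ≤ eqLocus φ θ ∧ φ.holds e := by
    intro e he
    obtain ⟨φ, hφ⟩ := exists_of_infClosed (S := {s | ∃ c ∈ C, θ.holds c ∧ s = e ⊓ c})
      ⟨e, ⊤, by simp, by simp, by simp⟩
      (by
        rintro _ ⟨c, hc, hθc, rfl⟩ _ ⟨d, hd, hθd, rfl⟩
        exact ⟨c ⊓ d, inf_mem hc hd, by simp [*], by rw [inf_inf_inf_comm, inf_idem]⟩)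
      (by
        rintro ⟨c, hc, hθc, h0⟩
        have := he cᶜ (compl_mem hc) (by rw [le_compl_iff_disjoint_right, disjoint_iff, h0])
        simp [hθc] at this)
    have hC : ∀ c ∈ C, θ.holds c → φ.holds c := fun c hc hθc =>
      φ.mono inf_le_right (hφ (e ⊓ c) ⟨c, hc, hθc, rfl⟩)
    refine ⟨φ, fun c hc => ⟨fun h1 => ?_, hC c hc⟩, ?_⟩
    · by_contra h2
      have := hC cᶜ (compl_mem hc) (by simpa using h2)
      simp [h1] at this
    · simpa using hφ e ⟨⊤, by simp, by simp, by simp⟩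
  obtain ⟨φ, hφ, hφa⟩ := extend a fun c hc hac => by
    simpa using hθ (c ⊓ ⊥ᶜ) ⟨c, hc, ⊥, by simp, hac, by simp, rfl⟩
  obtain ⟨ψ, hψ, hψb⟩ := extend bᶜ fun c hc hbc => by
    simpa using hθ (⊤ ⊓ cᶜᶜ) ⟨⊤, by simp, cᶜ, compl_mem hc, by simp, compl_le_of_compl_le hbc, rfl⟩
  refine ⟨φ, ψ, fun c hc => ?_, hφa, by simpa using hψb⟩
  have h1 := hφ hc
  have h2 := hψ hc
  rw [mem_eqLocus] at *
  tauto

end BoolPoint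

open BoolPoint

/-! ### Independence, free extensions and free amalgamation -/

section Independence

variable {A : Type*} [BooleanAlgebra A] {B C G P Q N : BooleanSubalgebra A} {X Y : Set A}

/-- The elementary products prescribed by v, cut down by elements of B true at φ, are nonzero by
independence and closed under meets. With the converse below, this is the form in which independence
is used. -/
theorem IndependentOver.exists_point (h : IndependentOver B X) (φ : BoolPoint A) (v : A → Prop) :
    ∃ χ : BoolPoint A, B ≤ eqLocus χ φ ∧ ∀ x ∈ X, χ.holds x ↔ v x := by
  classical
  obtain ⟨χ, hχ⟩ := exists_of_infClosed
    (S := {s | ∃ b ∈ B, φ.holds b ∧ ∃ P N : Finset A, (P : Set A) ⊆ X ∩ {a | v a} ∧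
      (N : Set A) ⊆ X ∩ {a | ¬ v a} ∧ s = b ⊓ P.inf id ⊓ N.inf compl})
    ⟨⊤, ⊤, by simp, by simp, ∅, ∅, by simp, by simp, by simp⟩
    (by
      rintro _ ⟨b, hb, hφb, P, N, hP, hN, rfl⟩ _ ⟨b', hb', hφb', P', N', hP', hN', rfl⟩
      refine ⟨b ⊓ b', inf_mem hb hb', by simp [*], P ∪ P', N ∪ N', by
        rw [Finset.coe_union]; exact Set.union_subset hP hP', by
        rw [Finset.coe_union]; exact Set.union_subset hN hN', ?_⟩
      rw [Finset.inf_union, Finset.inf_union]; ac_rfl)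
    (by
      rintro ⟨b, hb, hφb, P, N, hP, hN, h0⟩
      refine h b hb (by rintro rfl; simp at hφb) P N (fun x hx => (hP hx).1)
        (fun x hx => (hN hx).1) ?_ h0.symm
      rw [Finset.disjoint_left]
      exact fun x hx hx' => (hN hx').2 (hP hx).2)
  have hB : ∀ b ∈ B, φ.holds b → χ.holds b := fun b hb hφ => by
    simpa using hχ b ⟨b, hb, hφ, ∅, ∅, by simp, by simp, by simp⟩
  refine ⟨χ, fun b hb => ⟨fun h1 => ?_, hB b hb⟩, fun x hx => ⟨fun h1 => ?_, fun h1 => ?_⟩⟩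
  · by_contra h2
    have := hB bᶜ (compl_mem hb) (by simpa using h2)
    simp [h1] at this
  · by_contra h2
    have := hχ xᶜ ⟨⊤, by simp, by simp, ∅, {x}, by simp, by simp [hx, h2], by simp⟩
    simp [h1] at this
  · exact hχ x ⟨⊤, by simp, by simp, {x}, ∅, by simp [hx, h1], by simp, by simp⟩

theorem independentOver_of_points
    (h : ∀ (φ : BoolPoint A) (v : A → Prop),
      ∃ χ : BoolPoint A, B ≤ eqLocus χ φ ∧ ∀ x ∈ X, χ.holds x ↔ v x) :
    IndependentOver B X := by
  intro b hb hb0 P N hP hN hPN h0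
  obtain ⟨φ, hφ⟩ := exists_holds hb0
  obtain ⟨χ, hχ, hv⟩ := h φ (· ∈ P)
  have hχ0 : χ.holds (b ⊓ P.inf id ⊓ N.inf compl) := by
    simp only [inf_iff, finset_inf_iff, id, compl_iff]
    exact ⟨⟨(hχ hb).2 hφ, fun x hx => (hv x (hP hx)).2 hx⟩,
      fun x hx hx' => Finset.disjoint_left.1 hPN ((hv x (hN hx)).1 hx') hx⟩
  simp [h0] at hχ0

theorem IndependentOver.mono (h : IndependentOver B X) (hY : Y ⊆ X) : IndependentOver B Y :=
  fun b hb hb0 P N hP hN => h b hb hb0 P N (hP.trans hY) (hN.trans hY)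

theorem IndependentOver.mono_left (h : IndependentOver C X) (hB : B ≤ C) : IndependentOver B X :=
  fun b hb => h b (hB hb)

theorem IndependentOver.union (hX : IndependentOver B X) (hBC : B ≤ C) (hXC : X ⊆ C)
    (hY : IndependentOver C Y) : IndependentOver B (X ∪ Y) := by
  refine independentOver_of_points fun φ v => ?_
  obtain ⟨χ₁, h1, h1'⟩ := hX.exists_point φ v
  obtain ⟨χ₂, h2, h2'⟩ := hY.exists_point χ₁ v
  refine ⟨χ₂, fun b hb => (h2 (hBC hb)).trans (h1 hb), ?_⟩
  rintro x (hx | hx)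
  · exact (h2 (hXC hx)).trans (h1' x hx)
  · exact h2' x hx

/-- The elements of `X` outside `Y ⊆ X` are independent over the algebra generated by `B ∪ Y`. -/
theorem IndependentOver.diff (h : IndependentOver B X) (hY : Y ⊆ X) :
    IndependentOver (B ⊔ closure Y) (X \ Y) := by
  classical
  refine independentOver_of_points fun φ v => ?_
  obtain ⟨χ, hχ, hv⟩ := h.exists_point φ (fun x => if x ∈ Y then φ.holds x else v x)
  refine ⟨χ, sup_le hχ (closure_le.2 fun y hy => ?_), fun x hx => ?_⟩
  · simpa [hy, mem_eqLocus] using hv y (hY hy)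
  · simpa [hx.2] using hv x hx.1

/-- Independence concerns finitely many elements at a time, so finitely many indices suffice; adding
these in increasing order reduces it to `IndependentOver.union`. -/
theorem independentOver_iUnion {ι : Type*} [LinearOrder ι] {C : ι → BooleanSubalgebra A}
    {Y : ι → Set A} (hB : ∀ i, B ≤ C i) (hC : ∀ i j, j < i → Y j ⊆ C i)
    (hY : ∀ i, IndependentOver (C i) (Y i)) : IndependentOver B (⋃ i, Y i) := by
  classical
  have key : ∀ s : Finset ι, IndependentOver B (⋃ i ∈ s, Y i) := by
    intro s
    induction s using Finset.induction_on_max with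
    | empty =>
      intro b hb hb0 P N hP hN _
      obtain rfl : P = ∅ := by simpa using hP
      obtain rfl : N = ∅ := by simpa using hN
      simpa using hb0
    | insert a s ha ih =>
      rw [Finset.set_biUnion_insert, Set.union_comm]
      refine ih.union (hB a) ?_ (hY a)
      exact Set.iUnion₂_subset fun i hi => hC a i (ha i hi)
  intro b hb hb0 P N hP hN hPN
  have : ∀ F : Finset A, (F : Set A) ⊆ ⋃ i, Y i → ∃ s : Finset ι, (F : Set A) ⊆ ⋃ i ∈ s, Y i := by
    intro F hF
    have hF' : ∀ x : F, ∃ i, (x : A) ∈ Y i := fun x => by simpa using hF x.2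
    choose f hf using hF'
    refine ⟨F.attach.image f, fun x hx => ?_⟩
    simp only [Finset.mem_image, Finset.mem_attach, true_and, Set.mem_iUnion]
    exact ⟨f ⟨x, hx⟩, ⟨⟨x, hx⟩, rfl⟩, hf ⟨x, hx⟩⟩
  obtain ⟨s, hs⟩ := this P hP
  obtain ⟨t, ht⟩ := this N hN
  refine key (s ∪ t) b hb hb0 P N (hs.trans ?_) (ht.trans ?_) hPN
  · exact Set.biUnion_subset_biUnion_left fun i hi => by simp at hi ⊢; exact Or.inl hi
  · exact Set.biUnion_subset_biUnion_left fun i hi => by simp at hi ⊢; exact Or.inr hi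

/-- `G` and `P` are freely amalgamated over `C`: points of `G` and `P` which agree on `C` have a
common extension. -/
def Amalgam (C G P : BooleanSubalgebra A) : Prop :=
  ∀ φ ψ : BoolPoint A, C ≤ eqLocus φ ψ →
    ∃ χ : BoolPoint A, G ≤ eqLocus χ φ ∧ P ≤ eqLocus χ ψ

/-- Failing interpolation would give two points that agree on C, one making a true and the other
making b false; their amalgam contradicts a ≤ b. -/
theorem Amalgam.interpolant (h : Amalgam C G P) {a b : A} (ha : a ∈ G) (hb : b ∈ P)
    (hab : a ≤ b) : ∃ c ∈ C, a ≤ c ∧ c ≤ b := by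
  by_contra! hno
  obtain ⟨φ, ψ, hC, hφ, hψ⟩ := exists_pair_of_no_interpolant C hno
  obtain ⟨χ, h1, h2⟩ := h φ ψ hC
  exact hψ ((h2 hb).1 (χ.mono hab ((h1 ha).2 hφ)))

theorem Amalgam.mono_right (h : Amalgam C G P) (hQ : Q ≤ P) : Amalgam C G Q :=
  fun φ ψ hC => (h φ ψ hC).imp fun _ h' => ⟨h'.1, hQ.trans h'.2⟩

theorem amalgam_self (P : BooleanSubalgebra A) : Amalgam C C P :=
  fun _ ψ hC => ⟨ψ, fun _ hc => (hC hc).symm, fun _ _ => Iff.rfl⟩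

/-- Enlarging the base inside the right factor. -/
theorem Amalgam.sup_base (h : Amalgam C G P) (hCQ : C ≤ Q) (hQ : Q ≤ P) :
    Amalgam Q (G ⊔ Q) P := by
  intro φ ψ hφ
  obtain ⟨χ, h1, h2⟩ := h φ ψ (hCQ.trans hφ)
  exact ⟨χ, sup_le h1 fun q hq => (h2 (hQ hq)).trans (hφ hq).symm, h2⟩

/-- Adjoining independent elements to the left factor. -/
theorem Amalgam.sup_closure (h : Amalgam C G P) (hY : IndependentOver (G ⊔ P) Y) :
    Amalgam C (G ⊔ closure Y) P := by
  intro φ ψ hφ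
  obtain ⟨χ, h1, h2⟩ := h φ ψ hφ
  obtain ⟨χ', h1', h2'⟩ := hY.exists_point χ φ.holds
  refine ⟨χ', sup_le ?_ (closure_le.2 h2'), ?_⟩
  · exact fun g hg => (h1' (le_sup_left (b := P) hg)).trans (h1 hg)
  · exact fun p hp => (h1' (le_sup_right (a := G) hp)).trans (h2 hp)

theorem Amalgam.independentOver (h : Amalgam C G P) (hX : IndependentOver C X) (hXP : X ⊆ P) :
    IndependentOver G X := by
  refine independentOver_of_points fun φ v => ?_
  obtain ⟨ψ, h1, h2⟩ := hX.exists_point φ v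
  obtain ⟨χ, h3, h4⟩ := h φ ψ fun c hc => (h1 hc).symm
  exact ⟨χ, h3, fun x hx => (h4 (hXP hx)).trans (h2 x hx)⟩

theorem closure_union_coe : closure ((B : Set A) ∪ X) = B ⊔ closure X := by
  apply le_antisymm
  · rw [closure_le]
    exact Set.union_subset (fun b hb => le_sup_left (b := closure X) hb)
      fun x hx => le_sup_right (a := B) (subset_closure hx)
  · exact sup_le (fun b hb => subset_closure (Or.inl hb)) (closure_mono subset_union_right)

theorem freeOver_iff : FreeOver B C ↔ ∃ X, IndependentOver B X ∧ B ⊔ closure X = C := by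
  constructor
  · rintro ⟨-, X, h1, h2⟩
    exact ⟨X, h1, by rw [← h2, closure_union_coe]⟩
  · rintro ⟨X, h1, h2⟩
    exact ⟨h2 ▸ le_sup_left, X, h1, by rw [closure_union_coe, h2]⟩

theorem FreeOver.trans (h : FreeOver B C) (h' : FreeOver C Q) : FreeOver B Q := by
  obtain ⟨X, hX, rfl⟩ := freeOver_iff.1 h
  obtain ⟨Y, hY, rfl⟩ := freeOver_iff.1 h'
  refine freeOver_iff.2 ⟨X ∪ Y, hX.union le_sup_left
    (fun x hx => le_sup_right (a := B) (subset_closure hx)) hY, ?_⟩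
  have : closure (X ∪ Y) = closure X ⊔ closure Y := by
    apply le_antisymm
    · rw [closure_le]
      exact Set.union_subset (fun b hb => le_sup_left (b := closure Y) (subset_closure hb))
        fun x hx => le_sup_right (a := closure X) (subset_closure hx)
    · exact sup_le (closure_mono subset_union_left) (closure_mono subset_union_right)
  rw [this, sup_assoc]

/-- Free extensions are preserved by free amalgamation. -/
theorem FreeOver.amalgam (h : FreeOver C P) (hG : Amalgam C G P) (hCG : C ≤ G) :
    FreeOver G (G ⊔ P) := by
  obtain ⟨X, hX, rfl⟩ := freeOver_iff.1 h
  refine freeOver_iff.2 ⟨X, hG.independentOver hX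
    fun x hx => le_sup_right (a := C) (subset_closure hx), ?_⟩
  rw [← sup_assoc, sup_eq_left.2 hCG]

theorem FreeOver.sup_closure_subset (hX : IndependentOver B X) (hY : Y ⊆ X) :
    FreeOver (B ⊔ closure Y) (B ⊔ closure X) := by
  refine freeOver_iff.2 ⟨X \ Y, hX.diff hY, ?_⟩
  apply le_antisymm
  · exact sup_le (sup_le_sup_left (closure_mono hY) _)
      ((BooleanSubalgebra.closure_mono sdiff_subset).trans le_sup_right)
  · refine sup_le (le_sup_left.trans le_sup_left) (closure_le.2 fun x hx => ?_)
    by_cases h : x ∈ Y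
    · exact (le_sup_right.trans le_sup_left : closure Y ≤ _) (subset_closure h)
    · exact (le_sup_right : closure (X \ Y) ≤ _) (subset_closure ⟨hx, h⟩)

/-- If `Y` is independent over `Q ≥ C ≥ B` and `B ≤_free C`, then adjoining a part of `Y` to `B`
and a larger part to `C` gives a free extension. -/
theorem FreeOver.sup_closure (h : FreeOver B C) (hCQ : C ≤ Q) {Y₁ Y₂ : Set A}
    (hY : IndependentOver Q Y₂) (hY₁ : Y₁ ⊆ Y₂) :
    FreeOver (B ⊔ closure Y₁) (C ⊔ closure Y₂) := by
  have hBC := h.1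
  have h1 : Amalgam B (B ⊔ closure Y₁) C :=
    (amalgam_self C).sup_closure ((hY.mono hY₁).mono_left (sup_le (hBC.trans hCQ) hCQ))
  have h2 := h.amalgam h1 le_sup_left
  have h3 : B ⊔ closure Y₁ ⊔ C = C ⊔ closure Y₁ := by
    rw [sup_right_comm, sup_eq_right.2 hBC]
  rw [h3] at h2
  exact h2.trans (FreeOver.sup_closure_subset (hY.mono_left hCQ) hY₁)

end Independence

end OpenGen

namespace OpenGen

open BooleanSubalgebra BoolPoint

/-! ### Relative completeness and countable free extensions -/

section RelComplete

variable {A : Type*} [BooleanAlgebra A] {B C G P Q N : BooleanSubalgebra A} {X Y : Set A}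

theorem mem_sup_closure_singleton {u c : A} (hc : c ∈ B ⊔ closure {u}) :
    ∃ b₁ ∈ B, ∃ b₂ ∈ B, c = (b₁ ⊓ u) ⊔ (b₂ ⊓ uᶜ) := by
  rw [← closure_union_coe] at hc
  induction hc using closure_bot_sup_induction with
  | mem x hx =>
    rcases hx with hx | rfl
    · exact ⟨x, hx, x, hx, by rw [← inf_sup_left]; simp⟩
    · exact ⟨⊤, by simp, ⊥, by simp, by simp⟩
  | bot => exact ⟨⊥, by simp, ⊥, by simp, by simp⟩
  | sup x hx y hy ihx ihy =>
    obtain ⟨b, hb, b', hb', rfl⟩ := ihx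
    obtain ⟨d, hd, d', hd', rfl⟩ := ihy
    exact ⟨b ⊔ d, sup_mem hb hd, b' ⊔ d', sup_mem hb' hd', eq_of_forall fun φ => by simp; tauto⟩
  | compl x hx ih =>
    obtain ⟨b, hb, b', hb', rfl⟩ := ih
    exact ⟨bᶜ, compl_mem hb, b'ᶜ, compl_mem hb', eq_of_forall fun φ => by simp; tauto⟩

theorem exists_finset_mem_closure {c : A} (hc : c ∈ B ⊔ closure X) :
    ∃ F : Finset A, (F : Set A) ⊆ X ∧ c ∈ B ⊔ closure (F : Set A) := by
  classical
  rw [← closure_union_coe] at hc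
  induction hc using closure_bot_sup_induction with
  | mem x hx =>
    rcases hx with hx | hx
    · exact ⟨∅, by simp, le_sup_left (a := B) hx⟩
    · exact ⟨{x}, by simpa using hx, le_sup_right (a := B) (subset_closure (by simp))⟩
  | bot => exact ⟨∅, by simp, by simp⟩
  | sup x hx y hy ihx ihy =>
    obtain ⟨F, hF, h1⟩ := ihx
    obtain ⟨F', hF', h2⟩ := ihy
    refine ⟨F ∪ F', by rw [Finset.coe_union]; exact Set.union_subset hF hF', sup_mem ?_ ?_⟩
    · exact sup_le_sup_left (BooleanSubalgebra.closure_mono (by simp)) B h1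
    · exact sup_le_sup_left (BooleanSubalgebra.closure_mono (by simp)) B h2
  | compl x hx ih =>
    obtain ⟨F, hF, h1⟩ := ih
    exact ⟨F, hF, compl_mem h1⟩

theorem sup_closure_insert (u : A) (X : Set A) :
    B ⊔ closure (insert u X) = B ⊔ closure X ⊔ closure {u} := by
  apply le_antisymm
  · refine sup_le (le_sup_left.trans le_sup_left) (closure_le.2 ?_)
    rintro x (rfl | hx)
    · exact le_sup_right (a := B ⊔ closure X) (subset_closure rfl)
    · exact (le_sup_right.trans le_sup_left : closure X ≤ _) (subset_closure hx)
  · exact sup_le (sup_le_sup_left (BooleanSubalgebra.closure_mono (Set.subset_insert _ _)) _)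
      ((BooleanSubalgebra.closure_mono (by simp)).trans le_sup_right)

/-- Free extensions are relatively complete. -/
theorem FreeOver.exists_isGreatest (h : FreeOver B C) {c : A} (hc : c ∈ C) :
    ∃ a, IsGreatest {b | b ∈ B ∧ b ≤ c} a := by
  classical
  obtain ⟨X, hX, rfl⟩ := freeOver_iff.1 h
  obtain ⟨F, hF, hcF⟩ := exists_finset_mem_closure hc
  clear hc
  induction F using Finset.induction_on generalizing c with
  | empty =>
    have hB : B ⊔ closure ((∅ : Finset A) : Set A) = B := by
      rw [sup_eq_left, closure_le]; simp
    rw [hB] at hcF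
    exact ⟨c, ⟨hcF, le_rfl⟩, fun b hb => hb.2⟩
  | insert x F hx ih =>
    have hF' : (F : Set A) ⊆ X := fun y hy => hF (by simpa using Or.inr hy)
    rw [Finset.coe_insert, sup_closure_insert] at hcF
    obtain ⟨b₁, h1, b₂, h2, rfl⟩ := mem_sup_closure_singleton hcF
    obtain ⟨a, ha⟩ := ih hF' (inf_mem h1 h2)
    -- Over the algebra of B and F, the generator x can be made true or false at will, so an element
    -- of B below c must lie below both coefficients. This removes x from c.
    have hle : ∀ b ∈ B, b ≤ (b₁ ⊓ x) ⊔ (b₂ ⊓ xᶜ) ↔ b ≤ b₁ ⊓ b₂ := by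
      intro b hb
      constructor
      · intro hle
        refine le_of_forall fun φ hφ => ?_
        obtain ⟨χ, hχ, hv⟩ := (hX.diff hF').exists_point φ (fun _ => True)
        obtain ⟨χ', hχ', hv'⟩ := (hX.diff hF').exists_point φ (fun _ => False)
        have hxX : x ∈ X \ F := ⟨hF (by simp), by simpa using hx⟩
        have hbF : b ∈ B ⊔ closure (F : Set A) := le_sup_left (a := B) hb
        have e1 := χ.mono hle ((hχ hbF).2 hφ)
        have e2 := χ'.mono hle ((hχ' hbF).2 hφ)
        simp only [sup_iff, inf_iff, compl_iff, hv x hxX, hv' x hxX] at e1 e2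
        have e3 := mem_eqLocus.1 (hχ h1)
        have e4 := mem_eqLocus.1 (hχ' h2)
        rw [inf_iff]
        tauto
      · intro hle
        refine le_of_forall fun φ hφ => ?_
        have := φ.mono hle hφ
        simp at this ⊢
        tauto
    refine ⟨a, ⟨ha.1.1, (hle a ha.1.1).2 ha.1.2⟩, fun b hb => ha.2 ⟨hb.1, (hle b hb.1).1 hb.2⟩⟩

theorem IsRelComplete.sup_closure_singleton (h : IsRelComplete B) (u : A) :
    IsRelComplete (B ⊔ closure {u}) := by
  intro b
  obtain ⟨p, hp⟩ := h (b ⊔ uᶜ)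
  obtain ⟨q, hq⟩ := h (b ⊔ u)
  have hu : u ∈ B ⊔ closure {u} := le_sup_right (a := B) (subset_closure rfl)
  have hB : ∀ c ∈ B, c ∈ B ⊔ closure {u} := fun c hc => le_sup_left (a := B) hc
  refine ⟨(p ⊓ u) ⊔ (q ⊓ uᶜ), ⟨sup_mem (inf_mem (hB p hp.1.1) hu)
    (inf_mem (hB q hq.1.1) (compl_mem hu)), ?_⟩, ?_⟩
  · refine le_of_forall fun φ hφ => ?_
    have h1 := φ.mono hp.1.2
    have h2 := φ.mono hq.1.2
    simp at hφ h1 h2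
    tauto
  · rintro c ⟨hc, hcb⟩
    obtain ⟨b₁, hb₁, b₂, hb₂, rfl⟩ := mem_sup_closure_singleton hc
    have h1 : b₁ ≤ p := hp.2 ⟨hb₁, le_of_forall fun φ hφ => by
      have := φ.mono hcb
      simp at this ⊢
      tauto⟩
    have h2 : b₂ ≤ q := hq.2 ⟨hb₂, le_of_forall fun φ hφ => by
      have := φ.mono hcb
      simp at this ⊢
      tauto⟩
    gcongr

theorem IsRelComplete.sup_closure_finset (h : IsRelComplete B) (F : Finset A) :
    IsRelComplete (B ⊔ closure (F : Set A)) := by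
  classical
  induction F using Finset.induction_on with
  | empty =>
    have hB : B ⊔ closure ((∅ : Finset A) : Set A) = B := by
      rw [sup_eq_left, closure_le]; simp
    rwa [hB]
  | insert x F _ ih =>
    rw [Finset.coe_insert, sup_closure_insert]
    exact ih.sup_closure_singleton x

theorem independentOver_singleton {u : A}
    (h : ∀ b ∈ B, (b ⊓ u = ⊥ → b = ⊥) ∧ (b ⊓ uᶜ = ⊥ → b = ⊥)) : IndependentOver B {u} := by
  intro b hb hb0 P N hP hN hPN
  have h1 : P = ∅ ∨ P = {u} := Finset.subset_singleton_iff.1 (by exact_mod_cast hP)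
  have h2 : N = ∅ ∨ N = {u} := Finset.subset_singleton_iff.1 (by exact_mod_cast hN)
  have := h b hb
  rcases h1 with rfl | rfl <;> rcases h2 with rfl | rfl <;> simp at hPN ⊢ <;> tauto

theorem IndependentOver.eq_bot_of_inf_eq_bot {b x : A} (h : IndependentOver B X) (hb : b ∈ B)
    (hx : x ∈ X) (h0 : b ⊓ x = ⊥) : b = ⊥ := by
  by_contra hne
  refine h b hb hne {x} ∅ (by simpa) (by simp) (by simp) ?_
  simpa using h0

theorem IndependentOver.eq_bot_of_inf_compl_eq_bot {b x : A} (h : IndependentOver B X)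
    (hb : b ∈ B) (hx : x ∈ X) (h0 : b ⊓ xᶜ = ⊥) : b = ⊥ := by
  by_contra hne
  refine h b hb hne ∅ {x} (by simp) (by simpa) (by simp) ?_
  simpa using h0

/-- If `B` is relatively complete and `w` is independent over `B`, every element lies in an
extension of `B` by one element independent over `B`. -/
theorem IsRelComplete.exists_independent (h : IsRelComplete B) {w : A}
    (hw : IndependentOver B {w}) (b : A) :
    ∃ u, IndependentOver B {u} ∧ b ∈ B ⊔ closure {u} := by
  obtain ⟨p, hp⟩ := h b
  obtain ⟨q, hq⟩ := h bᶜ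
  have hpB : p ∈ B := hp.1.1
  have hqB : q ∈ B := hq.1.1
  have hqb : q ≤ bᶜ := hq.1.2
  have hpb : p ≤ b := hp.1.2
  have hd : (p ⊔ q)ᶜ ∈ B := compl_mem (sup_mem hpB hqB)
  -- Here p and q are the largest elements of B below b and below its complement. Outside p ⊔ q, b
  -- already splits every nonzero element of B; inside, where b is decided by B, the given
  -- independent w does so.
  refine ⟨((p ⊔ q)ᶜ ⊓ b) ⊔ ((p ⊔ q) ⊓ w), independentOver_singleton fun c hc => ?_, ?_⟩
  · have hcd : c ⊓ (p ⊔ q)ᶜ ∈ B := inf_mem hc hd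
    have hcd' : c ⊓ (p ⊔ q) ∈ B := inf_mem hc (sup_mem hpB hqB)
    constructor
    · intro h0
      have h1 : c ⊓ (p ⊔ q)ᶜ ≤ q := hq.2 ⟨hcd, le_of_forall fun φ hφ => by
        have := φ.bot_iff
        rw [← h0] at this
        simp at this hφ ⊢
        tauto⟩
      have h2 : c ⊓ (p ⊔ q) = ⊥ := hw.eq_bot_of_inf_eq_bot hcd' rfl (eq_bot_of_forall fun φ hφ => by
        have := φ.bot_iff
        rw [← h0] at this
        simp at this hφ
        tauto)
      refine eq_bot_of_forall fun φ hφ => ?_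
      have h3 := φ.mono h1
      have h4 := φ.bot_iff
      rw [← h2] at h4
      simp at h3 h4
      tauto
    · intro h0
      have h1 : c ⊓ (p ⊔ q)ᶜ ≤ p := hp.2 ⟨hcd, le_of_forall fun φ hφ => by
        have := φ.bot_iff
        rw [← h0] at this
        simp at this hφ ⊢
        tauto⟩
      have h2 : c ⊓ (p ⊔ q) = ⊥ :=
        hw.eq_bot_of_inf_compl_eq_bot hcd' rfl (eq_bot_of_forall fun φ hφ => by
          have := φ.bot_iff
          rw [← h0] at this
          simp at this hφ
          tauto)
      refine eq_bot_of_forall fun φ hφ => ?_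
      have h3 := φ.mono h1
      have h4 := φ.bot_iff
      rw [← h2] at h4
      simp at h3 h4
      tauto
  · have hb : b = p ⊔ ((p ⊔ q)ᶜ ⊓ (((p ⊔ q)ᶜ ⊓ b) ⊔ ((p ⊔ q) ⊓ w))) := eq_of_forall fun φ => by
      have h1 := φ.mono hpb
      have h2 := φ.mono hqb
      simp at h1 h2 ⊢
      tauto
    have hle : B ≤ B ⊔ closure {((p ⊔ q)ᶜ ⊓ b) ⊔ ((p ⊔ q) ⊓ w)} := le_sup_left
    have hu : ((p ⊔ q)ᶜ ⊓ b) ⊔ ((p ⊔ q) ⊓ w) ∈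
        B ⊔ closure {((p ⊔ q)ᶜ ⊓ b) ⊔ ((p ⊔ q) ⊓ w)} :=
      le_sup_right (a := B) (subset_closure (Set.mem_singleton _))
    have := sup_mem (hle hpB) (inf_mem (hle hd) hu)
    rwa [← hb] at this

theorem exists_finset_subset_closure (F : Finset A) (hF : ∀ a ∈ F, a ∈ B ⊔ closure X) :
    ∃ T : Finset A, (T : Set A) ⊆ X ∧ ∀ a ∈ F, a ∈ B ⊔ closure (T : Set A) := by
  classical
  induction F using Finset.induction_on with
  | empty => exact ⟨∅, by simp, by simp⟩
  | insert a F _ ih =>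
    obtain ⟨T, hT, h⟩ := ih fun b hb => hF b (Finset.mem_insert_of_mem hb)
    obtain ⟨T', hT', h'⟩ := exists_finset_mem_closure (hF a (Finset.mem_insert_self _ _))
    refine ⟨T ∪ T', by rw [Finset.coe_union]; exact Set.union_subset hT hT', ?_⟩
    intro b hb
    rcases Finset.mem_insert.1 hb with rfl | hb
    · exact sup_le_sup_left (BooleanSubalgebra.closure_mono (by simp)) B h'
    · exact sup_le_sup_left (BooleanSubalgebra.closure_mono (by simp)) B (h b hb)

theorem freeOver_of_sequence (F : ℕ → Finset A) (u : ℕ → A) (hF0 : F 0 = ∅)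
    (hF : ∀ n, (F (n + 1) : Set A) = insert (u n) (F n : Set A))
    (hu : ∀ n, IndependentOver (B ⊔ closure (F n : Set A)) {u n})
    (hgen : ∀ b, ∃ n, b ∈ B ⊔ closure (F n : Set A)) : FreeOver B ⊤ := by
  have hmono : Monotone fun n => (F n : Set A) := monotone_nat_of_le_succ fun n => by
    rw [hF]; exact Set.subset_insert _ _
  refine freeOver_iff.2 ⟨⋃ n, {u n}, ?_, ?_⟩
  · refine independentOver_iUnion (fun n => le_sup_left) (fun i j hij => ?_) hu
    rw [Set.singleton_subset_iff]
    refine le_sup_right (a := B) (subset_closure (hmono (Nat.succ_le_of_lt hij) ?_))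
    simp [hF]
  · rw [eq_top_iff]
    intro b _
    obtain ⟨n, hn⟩ := hgen b
    have hsub : ∀ n, (F n : Set A) ⊆ ⋃ n, {u n} := by
      intro n
      induction n with
      | zero => simp [hF0]
      | succ k ih =>
        rw [hF, Set.insert_subset_iff]
        exact ⟨Set.mem_iUnion.2 ⟨k, rfl⟩, ih⟩
    exact sup_le_sup_left (BooleanSubalgebra.closure_mono (hsub n)) B hn

/-- A countable algebra `L = K ⊕ Fr(ω)` is free over every relatively complete subalgebra `H`
of `K`. -/
theorem IsRelComplete.freeOver_top [Countable A] {H K : BooleanSubalgebra A}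
    (hrc : IsRelComplete H) (hHK : H ≤ K) {x : ℕ → A} (hx : Function.Injective x)
    (hind : IndependentOver K (range x)) (hgen : closure ((K : Set A) ∪ range x) = ⊤) :
    FreeOver H ⊤ := by
  classical
  -- A finite set involves only finitely many of the free generators over K, so an unused one
  -- remains independent. This keeps the supply going while an enumeration of A is absorbed element
  -- by element.
  have hw : ∀ F : Finset A, ∃ w, IndependentOver (H ⊔ closure (F : Set A)) {w} := by
    intro F
    obtain ⟨T, hT, h⟩ := exists_finset_subset_closure (B := K) (X := range x) F
      (fun a _ => by rw [← closure_union_coe, hgen]; simp)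
    obtain ⟨w, hw, hwT⟩ : ∃ w ∈ range x, w ∉ T := by
      by_contra! hcon
      exact (Set.infinite_range_of_injective hx) (T.finite_toSet.subset hcon)
    refine ⟨w, ((hind.diff hT).mono (Y := {w}) ?_).mono_left ?_⟩
    · rw [Set.singleton_subset_iff]; exact ⟨hw, hwT⟩
    · exact sup_le (hHK.trans le_sup_left) (closure_le.2 h)
  have step : ∀ (F : Finset A) (b : A), ∃ u, IndependentOver (H ⊔ closure (F : Set A)) {u} ∧
      b ∈ H ⊔ closure (F : Set A) ⊔ closure {u} := fun F b =>
    (hw F).elim fun w hw => (hrc.sup_closure_finset F).exists_independent hw b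
  choose f hf1 hf2 using step
  obtain ⟨e, he⟩ := exists_surjective_nat A
  obtain ⟨F, hF0, hF⟩ : ∃ F : ℕ → Finset A, F 0 = ∅ ∧
      ∀ n, F (n + 1) = insert (f (F n) (e n)) (F n) :=
    ⟨fun n => Nat.rec ∅ (fun k s => insert (f s (e k)) s) n, rfl, fun _ => rfl⟩
  refine freeOver_of_sequence F (fun n => f (F n) (e n)) hF0 (fun n => by simp [hF])
    (fun n => hf1 _ _) fun b => ?_
  obtain ⟨n, rfl⟩ := he b
  refine ⟨n + 1, ?_⟩
  rw [hF, Finset.coe_insert, sup_closure_insert]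
  exact hf2 _ _

theorem finite_closure_finset (F : Finset A) : (closure (F : Set A) : Set A).Finite := by
  classical
  have h0 : ∀ X : Set A, (⊥ : BooleanSubalgebra A) ⊔ closure X = closure X := fun X => bot_sup_eq _
  induction F using Finset.induction_on with
  | empty =>
    have : closure ((∅ : Finset A) : Set A) ≤ ⊥ := closure_le.2 (by simp)
    exact Set.Finite.subset (s := {⊥, ⊤}) (by simp) this
  | insert a F _ ih =>
    refine (Set.Finite.image2 (fun b c => (b ⊓ a) ⊔ (c ⊓ aᶜ)) ih ih).subset fun c hc => ?_
    rw [Finset.coe_insert, ← h0, sup_closure_insert, h0] at hc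
    obtain ⟨b, hb, b', hb', rfl⟩ := mem_sup_closure_singleton hc
    exact ⟨b, hb, b', hb', rfl⟩

theorem mk_closure_le (X : Set A) : #(closure X) ≤ max #X ℵ₀ := by
  classical
  let g : Finset X → Set A := fun F => closure (F.map (Function.Embedding.subtype _) : Set A)
  have h1 : (closure X : Set A) ⊆ ⋃ F, g F := by
    intro c hc
    obtain ⟨F, hF, h⟩ := exists_finset_mem_closure (B := ⊥) (X := X) (c := c)
      (by rwa [bot_sup_eq])
    rw [bot_sup_eq] at h
    refine Set.mem_iUnion.2 ⟨F.subtype (· ∈ X), ?_⟩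
    have : (F.subtype (· ∈ X)).map (Function.Embedding.subtype _) = F :=
      Finset.subtype_map_of_mem hF
    simp only [g]
    rwa [this]
  have h2 : #(⋃ F, g F) ≤ max #X ℵ₀ := by
    refine (mk_iUnion_le_sum_mk).trans ((sum_le_mk_mul_iSup _).trans ?_)
    have h3 : #(Finset X) ≤ max #X ℵ₀ := by
      rcases finite_or_infinite X with h | h
      · exact (mk_le_aleph0 (α := Finset X)).trans (le_max_right _ _)
      · rw [mk_finset_of_infinite]; exact le_max_left _ _
    have h4 : (⨆ F, #(g F)) ≤ ℵ₀ := ciSup_le' fun F =>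
      (Set.Finite.countable (finite_closure_finset _)).le_aleph0
    calc _ ≤ max #X ℵ₀ * ℵ₀ := mul_le_mul' h3 h4
      _ ≤ max #X ℵ₀ * max #X ℵ₀ := by gcongr; exact le_max_right _ _
      _ = _ := mul_eq_self (le_max_right _ _)
  exact (mk_le_mk_of_subset h1).trans h2

theorem countable_closure (hX : X.Countable) : (closure X : Set A).Countable := by
  rw [← le_aleph0_iff_set_countable] at hX ⊢
  exact (mk_closure_le X).trans (max_le hX le_rfl)

/-- Nontriviality is needed because independence over ⊥ is vacuous in the one-element algebra, which
is not free. -/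
theorem FreeOver.isFree [Nontrivial A] (h : FreeOver ⊥ C) : IsFree C := by
  classical
  obtain ⟨X, hX, rfl⟩ := freeOver_iff.1 h
  have hXC : X ⊆ (⊥ ⊔ closure X : BooleanSubalgebra A) := fun x hx =>
    le_sup_right (a := (⊥ : BooleanSubalgebra A)) (subset_closure hx)
  refine ⟨Subtype.val ⁻¹' X, ?_, ?_⟩
  · intro P N hP hN hPN h0
    refine hX ⊤ (by simp) (by simp) (P.map (Function.Embedding.subtype _))
      (N.map (Function.Embedding.subtype _)) ?_ ?_ ?_ ?_
    · simpa using hP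
    · simpa using hN
    · rwa [Finset.disjoint_map]
    · have h1 := congrArg (BooleanSubalgebra.subtype _) h0
      rw [InfHomClass.map_inf, map_finset_inf, map_finset_inf, BotHomClass.map_bot] at h1
      rw [Finset.inf_map, Finset.inf_map, top_inf_eq]
      exact h1
  · rw [eq_top_iff]
    rintro ⟨y, hy⟩ -
    have hle : (⊥ ⊔ closure X : BooleanSubalgebra A) ≤
        (BooleanSubalgebra.closure (Subtype.val ⁻¹' X)).map (BooleanSubalgebra.subtype (⊥ ⊔ closure X)) := by
      refine sup_le bot_le (closure_le.2 fun x hx => ?_)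
      exact ⟨⟨x, hXC hx⟩, subset_closure hx, rfl⟩
    obtain ⟨z, hz, hzy⟩ := hle hy
    have : z = ⟨y, hy⟩ := Subtype.ext hzy
    rwa [← this]

end RelComplete

end OpenGen

namespace OpenGen

open BooleanSubalgebra BoolPoint

/-! ### Points of coproducts and quotients -/

section Coproduct

variable {I : Type v} {L : I → Type w} [∀ i, BooleanAlgebra (L i)]

/-- The value of a Boolean term at a family of points. -/
def BoolTerm.eval (χ : ∀ i, BoolPoint (L i)) : BoolTerm L → Prop
  | .of i a => (χ i).holds a
  | .bot => False
  | .top => True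
  | .sup s t => s.eval χ ∨ t.eval χ
  | .inf s t => s.eval χ ∧ t.eval χ
  | .compl s => ¬ s.eval χ

theorem CoprodRel.eval_iff (χ : ∀ i, BoolPoint (L i)) {s t : BoolTerm L} (h : CoprodRel s t) :
    s.eval χ ↔ t.eval χ := by
  induction h with
  | refl => rfl
  | symm _ ih => exact ih.symm
  | trans _ _ ih ih' => exact ih.trans ih'
  | sup _ _ ih ih' => exact or_congr ih ih'
  | inf _ _ ih ih' => exact and_congr ih ih'
  | compl _ ih => exact not_congr ih
  | _ => simp only [BoolTerm.eval, BoolPoint.inf_iff, BoolPoint.sup_iff, BoolPoint.compl_iff,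
      BoolPoint.bot_iff, BoolPoint.top_iff] <;> tauto

/-- The point of the coproduct given by a family of points. -/
def BoolPoint.coprod (χ : ∀ i, BoolPoint (L i)) : BoolPoint (BoolCoprod L) where
  holds := Quotient.lift (BoolTerm.eval χ) fun _ _ h => propext (CoprodRel.eval_iff χ h)
  inf_iff := by rintro ⟨a⟩ ⟨b⟩; exact Iff.rfl
  compl_iff := by rintro ⟨a⟩; exact Iff.rfl

/-- The canonical map into the coproduct, as a homomorphism. -/
def BoolCoprod.inclHom (i : I) : BoundedLatticeHom (L i) (BoolCoprod L) where
  toFun := BoolCoprod.incl i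
  map_sup' a b := by exact Quotient.sound (s := coprodSetoid L) (CoprodRel.of_sup i a b)
  map_inf' a b := by exact Quotient.sound (s := coprodSetoid L) (CoprodRel.of_inf i a b)
  map_top' := by exact Quotient.sound (s := coprodSetoid L) (CoprodRel.of_top i)
  map_bot' := by exact Quotient.sound (s := coprodSetoid L) (CoprodRel.of_bot i)

theorem BoolCoprod.closure_range_incl :
    closure (⋃ i, range (BoolCoprod.incl (L := L) i)) = ⊤ := by
  rw [eq_top_iff]
  intro a _
  obtain ⟨t, rfl⟩ : ∃ t : BoolTerm L, a = (show BoolCoprod L from Quotient.mk (coprodSetoid L) t) :=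
    (Quotient.exists_rep a).imp fun _ h => h.symm
  induction t with
  | of i a => exact subset_closure (Set.mem_iUnion.2 ⟨i, a, rfl⟩)
  | bot => exact bot_mem (α := BoolCoprod L)
  | top => exact top_mem (α := BoolCoprod L)
  | sup s t ihs iht => exact sup_mem (α := BoolCoprod L) (ihs trivial) (iht trivial)
  | inf s t ihs iht => exact inf_mem (α := BoolCoprod L) (ihs trivial) (iht trivial)
  | compl s ih => exact compl_mem (α := BoolCoprod L) (ih trivial)

end Coproduct

section Quotient

variable {G : Type w} [BooleanAlgebra G] {R : G → G → Prop}

/-- The quotient map, as a homomorphism. -/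
def BoolQuot.mkHom (R : G → G → Prop) : BoundedLatticeHom G (BoolQuot R) where
  toFun := Quotient.mk _
  map_sup' _ _ := rfl
  map_inf' _ _ := rfl
  map_top' := rfl
  map_bot' := rfl

theorem BoolQuot.mkHom_surjective : Function.Surjective (BoolQuot.mkHom R) :=
  Quotient.mk_surjective

/-- A point which respects `R` induces a point of the quotient. -/
def BoolPoint.quot (χ : BoolPoint G) (h : ∀ a b, R a b → (χ.holds a ↔ χ.holds b)) :
    BoolPoint (BoolQuot R) where
  holds := Quotient.lift χ.holds fun a b hab => propext (by
    change BoolCongr R a b at hab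
    induction hab with
    | of hab => exact h _ _ hab
    | refl => rfl
    | symm _ ih => exact ih.symm
    | trans _ _ ih ih' => exact ih.trans ih'
    | sup _ _ ih ih' => simp only [BoolPoint.sup_iff, ih, ih']
    | inf _ _ ih ih' => simp only [BoolPoint.inf_iff, ih, ih']
    | compl _ ih => simp only [BoolPoint.compl_iff, ih])
  inf_iff := by rintro ⟨a⟩ ⟨b⟩; exact χ.inf_iff a b
  compl_iff := by rintro ⟨a⟩; exact χ.compl_iff a

end Quotient

/-! ### Glued algebras and their subalgebras -/

section Gluing

variable {I : Type v} {X : Type u} {L : Type w} [BooleanAlgebra L]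

/-- The algebra `A` is obtained from copies of `L` by identifying the copy of `h m` in the `i`-th
copy with the copy of `h l` in the `j`-th copy whenever `x i m = x j l`. The universal property is
stated in terms of points. -/
structure IsGluing (h : ℕ → L) (x : I → ℕ → X) {A : Type*} [BooleanAlgebra A]
    (e : I → BoundedLatticeHom L A) : Prop where
  independent : Independent (range h)
  injective : Function.Injective h
  index_injective : ∀ i, Function.Injective (x i)
  glue : ∀ {i j m l}, x i m = x j l → e i (h m) = e j (h l)
  generates : closure (⋃ i, range (e i)) = ⊤
  exists_point : ∀ χ : I → BoolPoint L,
    (∀ i j m l, x i m = x j l → ((χ i).holds (h m) ↔ (χ j).holds (h l))) →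
    ∃ φ : BoolPoint A, ∀ i a, φ.holds (e i a) ↔ (χ i).holds a

/-- From here on only generation, the identifications and the extension of compatible points are
used, never terms or congruence classes. -/
theorem isGluing_algebraOf {h : ℕ → L} {x : I → ℕ → X} (hind : Independent (range h))
    (hinj : Function.Injective h) (hx : ∀ i, Function.Injective (x i)) :
    IsGluing h x (A := AlgebraOf h x)
      (fun i => (BoolQuot.mkHom (GlueRel h x)).comp
        (BoolCoprod.inclHom (L := fun _ : I => L) i)) where
  independent := hind
  injective := hinj
  index_injective := hx
  glue := fun {i j m l} hml =>
    Quotient.sound (s := boolCongrSetoid (GlueRel h x)) (BoolCongr.of (GlueRel.glue i j m l hml))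
  generates := by
    rw [eq_top_iff]
    intro a _
    obtain ⟨b, rfl⟩ := BoolQuot.mkHom_surjective a
    have hle : (⊤ : BooleanSubalgebra (BoolCoprod fun _ : I => L)) ≤
        (closure (⋃ i, range ((BoolQuot.mkHom (GlueRel h x)).comp
          (BoolCoprod.inclHom (L := fun _ : I => L) i)))).comap
          (BoolQuot.mkHom (GlueRel h x)) := by
      rw [← BoolCoprod.closure_range_incl, closure_le]
      refine Set.iUnion_subset fun i => ?_
      rintro _ ⟨a, rfl⟩
      exact subset_closure (Set.mem_iUnion.2 ⟨i, a, rfl⟩)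
    exact hle (mem_top)
  exists_point := fun χ hχ => by
    refine ⟨(BoolPoint.coprod χ).quot ?_, fun i a => Iff.rfl⟩
    rintro _ _ ⟨i, j, m, l, hml⟩
    exact hχ i j m l hml

variable {A : Type*} [BooleanAlgebra A]

/-- The subalgebra generated by the copies `L_i`, `i ∈ J`. -/
def sub (e : I → BoundedLatticeHom L A) (J : Set I) : BooleanSubalgebra A :=
  closure (⋃ i ∈ J, range (e i))

variable {e : I → BoundedLatticeHom L A}

theorem emb_mem_sub {J : Set I} {i : I} (hi : i ∈ J) (a : L) : e i a ∈ sub e J :=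
  subset_closure (Set.mem_biUnion hi ⟨a, rfl⟩)

theorem emb_mem_sub_self (i : I) (a : L) : e i a ∈ sub e {i} :=
  emb_mem_sub (Set.mem_singleton i) a

theorem sub_le {J : Set I} {B : BooleanSubalgebra (A)}
    (hB : ∀ i ∈ J, ∀ a, e i a ∈ B) : sub e J ≤ B := by
  refine closure_le.2 (Set.iUnion₂_subset fun i hi => ?_)
  rintro _ ⟨a, rfl⟩
  exact hB i hi a

theorem sub_mono {J J' : Set I} (hJ : J ⊆ J') : sub e J ≤ sub e J' :=
  sub_le fun _ hi a => emb_mem_sub (hJ hi) a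

theorem sub_empty : sub e ∅ = ⊥ := by
  rw [eq_bot_iff]; exact sub_le (by simp)

theorem sub_singleton (i : I) : sub e {i} = (⊤ : BooleanSubalgebra L).map (e i) := by
  apply le_antisymm
  · refine sub_le ?_
    rintro _ rfl a
    exact ⟨a, by simp, rfl⟩
  · rintro _ ⟨a, -, rfl⟩
    exact emb_mem_sub_self _ a

/-- Every element lies in the subalgebra generated by finitely many copies of `L`. -/
theorem exists_finset_mem_sub {J : Set I} {a : A} (ha : a ∈ sub e J) :
    ∃ F : Set I, F.Finite ∧ F ⊆ J ∧ a ∈ sub e F := by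
  induction ha using closure_bot_sup_induction with
  | mem a ha =>
    obtain ⟨i, hi, b, rfl⟩ := Set.mem_iUnion₂.1 ha
    exact ⟨{i}, by simp, by simpa using hi, emb_mem_sub_self _ b⟩
  | bot => exact ⟨∅, by simp, by simp, by simp⟩
  | sup a _ b _ iha ihb =>
    obtain ⟨F, hF, hFJ, hFa⟩ := iha
    obtain ⟨F', hF', hFJ', hFb⟩ := ihb
    exact ⟨F ∪ F', hF.union hF', Set.union_subset hFJ hFJ',
      sup_mem (sub_mono subset_union_left hFa) (sub_mono subset_union_right hFb)⟩
  | compl a _ ih =>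
    obtain ⟨F, hF, hFJ, hFa⟩ := ih
    exact ⟨F, hF, hFJ, compl_mem hFa⟩

theorem exists_mem_sub_of_directed {T : Type*} [Nonempty T] [LinearOrder T] {U : T → Set I}
    (hU : Monotone U) {a : A} (ha : a ∈ sub e (⋃ t, U t)) :
    ∃ t, a ∈ sub e (U t) := by
  obtain ⟨F, hF, hFU, hFa⟩ := exists_finset_mem_sub ha
  have : ∃ t, F ⊆ U t := by
    clear hFa
    induction F, hF using Set.Finite.induction_on with
    | empty => exact ⟨Classical.arbitrary T, by simp⟩
    | insert _ _ ih =>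
      obtain ⟨t, ht⟩ := ih ((Set.subset_insert _ _).trans hFU)
      obtain ⟨t', ht'⟩ := Set.mem_iUnion.1 (hFU (Set.mem_insert _ _))
      exact ⟨max t t', Set.insert_subset (hU (le_max_right t t') ht')
        (ht.trans (hU (le_max_left t t')))⟩
  obtain ⟨t, ht⟩ := this
  exact ⟨t, sub_mono ht hFa⟩

theorem Independent.exists_point {h : ℕ → L} (hind : Independent (range h))
    (hinj : Function.Injective h) (v : ℕ → Prop) :
    ∃ χ : BoolPoint L, ∀ m, χ.holds (h m) ↔ v m := by
  have hover : IndependentOver ⊥ (range h) := by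
    intro b hb hb0 P N hP hN hPN
    obtain rfl : b = ⊤ := by rcases mem_bot.1 hb with rfl | rfl <;> simp at hb0 ⊢
    rw [top_inf_eq]
    exact hind P N hP hN hPN
  have htop : (⊤ : L) ≠ ⊥ := by simpa using hind ∅ ∅ (by simp) (by simp) (by simp)
  obtain ⟨φ, -⟩ := exists_holds htop
  obtain ⟨χ, -, hχ⟩ := hover.exists_point φ (fun a => ∃ m, h m = a ∧ v m)
  refine ⟨χ, fun m => (hχ _ ⟨m, rfl⟩).trans ⟨?_, fun hv => ⟨m, rfl, hv⟩⟩⟩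
  rintro ⟨k, hk, hv⟩
  rwa [← hinj hk]

namespace IsGluing

variable {h : ℕ → L} {x : I → ℕ → X} (hA : IsGluing h x e)
include hA

theorem sub_univ : sub e Set.univ = ⊤ := by
  rw [← hA.generates, sub]; simp

/-- Subalgebras generated by copies of `L` are freely amalgamated over everything shared. -/
theorem amalgam_sub {J₁ J₂ : Set I} {C : BooleanSubalgebra (A)}
    (hC : sub e (J₁ ∩ J₂) ≤ C)
    (hC' : ∀ i ∈ J₁, ∀ j ∈ J₂, ∀ m l, x i m = x j l → e i (h m) ∈ C) :
    Amalgam C (sub e J₁) (sub e J₂) := by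
  classical
  intro φ ψ hφψ
  -- One truth value is assigned to each index z, since glued generators depend only on z. Agreement
  -- on C makes this consistent, and copies outside both sets receive any point with these values on
  -- the free generators.
  let val : X → Prop := fun z => (∃ i ∈ J₁, ∃ m, x i m = z ∧ φ.holds (e i (h m))) ∨
    ∃ i ∈ J₂, ∃ m, x i m = z ∧ ψ.holds (e i (h m))
  have key : ∀ i, ∃ χ : BoolPoint L, (∀ m, χ.holds (h m) ↔ val (x i m)) ∧
      (i ∈ J₁ → ∀ a, χ.holds a ↔ φ.holds (e i a)) ∧
      (i ∈ J₂ → ∀ a, χ.holds a ↔ ψ.holds (e i a)) := by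
    intro i
    have hv1 : i ∈ J₁ → ∀ m, φ.holds (e i (h m)) ↔ val (x i m) := by
      intro hi m
      refine ⟨fun hm => Or.inl ⟨i, hi, m, rfl, hm⟩, ?_⟩
      rintro (⟨j, hj, l, hl, hv⟩ | ⟨j, hj, l, hl, hv⟩)
      · rwa [← hA.glue hl]
      · exact (hφψ (hC' i hi j hj m l hl.symm)).2 (by rwa [hA.glue hl.symm])
    have hv2 : i ∈ J₂ → ∀ m, ψ.holds (e i (h m)) ↔ val (x i m) := by
      intro hi m
      refine ⟨fun hm => Or.inr ⟨i, hi, m, rfl, hm⟩, ?_⟩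
      rintro (⟨j, hj, l, hl, hv⟩ | ⟨j, hj, l, hl, hv⟩)
      · rw [← hA.glue hl]
        exact (hφψ (hC' j hj i hi l m hl)).1 hv
      · rwa [← hA.glue hl]
    by_cases h1 : i ∈ J₁
    · refine ⟨φ.comp (e i), fun m => hv1 h1 m, fun _ a => Iff.rfl, fun h2 a => ?_⟩
      exact hφψ (hC (emb_mem_sub (Set.mem_inter h1 h2) a))
    · by_cases h2 : i ∈ J₂
      · exact ⟨ψ.comp (e i), fun m => hv2 h2 m, fun h1' => absurd h1' h1,
          fun _ a => Iff.rfl⟩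
      · obtain ⟨χ, hχ⟩ := hA.independent.exists_point hA.injective fun m => val (x i m)
        exact ⟨χ, hχ, fun h => absurd h h1, fun h => absurd h h2⟩
  choose χ hχ hχ1 hχ2 using key
  obtain ⟨θ, hθ⟩ := hA.exists_point χ fun i j m l hml => by
    rw [hχ, hχ, hml]
  exact ⟨θ, sub_le fun i hi a => (hθ i a).trans (hχ1 i hi a),
    sub_le fun i hi a => (hθ i a).trans (hχ2 i hi a)⟩

/-- Points of a copy of `L` extend to the whole algebra. -/
theorem exists_point_extending (i : I) (χ : BoolPoint L) :
    ∃ φ : BoolPoint A, ∀ a, φ.holds (e i a) ↔ χ.holds a := by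
  classical
  let val : X → Prop := fun z => ∃ m, x i m = z ∧ χ.holds (h m)
  have key : ∀ j, ∃ χ' : BoolPoint L, (∀ m, χ'.holds (h m) ↔ val (x j m)) ∧
      (j = i → χ' = χ) := by
    intro j
    by_cases hj : j = i
    · subst hj
      refine ⟨χ, fun m => ⟨fun hm => ⟨m, rfl, hm⟩, ?_⟩, fun _ => rfl⟩
      rintro ⟨l, hl, hv⟩
      rwa [← hA.index_injective j hl]
    · obtain ⟨χ', hχ'⟩ := hA.independent.exists_point hA.injective fun m => val (x j m)
      exact ⟨χ', hχ', fun h => absurd h hj⟩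
  choose χ' h1 h2 using key
  obtain ⟨φ, hφ⟩ := hA.exists_point χ' fun i j m l hml => by rw [h1, h1, hml]
  exact ⟨φ, fun a => by rw [hφ, h2 i rfl]⟩

theorem emb_le_emb_iff (i : I) {a b : L} : e i a ≤ e i b ↔ a ≤ b := by
  refine ⟨fun hab => le_of_forall fun χ hχ => ?_, fun hab => OrderHomClass.mono (e i) hab⟩
  obtain ⟨φ, hφ⟩ := hA.exists_point_extending i χ
  exact (hφ b).1 (φ.mono hab ((hφ a).2 hχ))

theorem emb_injective (i : I) : Function.Injective (e i) := fun _ _ hab =>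
  le_antisymm ((hA.emb_le_emb_iff i).1 hab.le) ((hA.emb_le_emb_iff i).1 hab.ge)

theorem nontrivial [Nonempty I] : Nontrivial A := by
  have htop : (⊤ : L) ≠ ⊥ := by
    simpa using hA.independent ∅ ∅ (by simp) (by simp) (by simp)
  obtain ⟨i⟩ := ‹Nonempty I›
  exact ⟨e i ⊤, e i ⊥, fun h => htop (hA.emb_injective i h)⟩

theorem freeOver_map (i : I) {B : BooleanSubalgebra L} (hB : FreeOver B ⊤) :
    FreeOver (B.map (e i)) (sub e {i}) := by
  obtain ⟨Y, hY, hgen⟩ := freeOver_iff.1 hB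
  refine freeOver_iff.2 ⟨e i '' Y, independentOver_of_points fun φ v => ?_, ?_⟩
  · obtain ⟨χ, h1, h2⟩ := hY.exists_point (φ.comp (e i)) (fun a => v (e i a))
    obtain ⟨ψ, hψ⟩ := hA.exists_point_extending i χ
    refine ⟨ψ, ?_, ?_⟩
    · rintro _ ⟨b, hb, rfl⟩
      exact (hψ b).trans (h1 hb)
    · rintro _ ⟨y, hy, rfl⟩
      exact (hψ y).trans (h2 y hy)
  · apply le_antisymm
    · refine sup_le ?_ (closure_le.2 ?_)
      · rintro _ ⟨b, -, rfl⟩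
        exact emb_mem_sub_self _ b
      · rintro _ ⟨b, -, rfl⟩
        exact emb_mem_sub_self _ b
    · rw [sub_singleton, ← hgen, BooleanSubalgebra.map_sup]
      refine sup_le_sup_left ?_ _
      rw [map_le_iff_le_comap, closure_le]
      exact fun y hy => subset_closure ⟨y, hy, rfl⟩

/-- The generators shared by `L_i` and the copies `L_j`, `j ∈ J`, form the base of an
amalgamation. -/
theorem amalgam_singleton {J : Set I} {i : I} (hi : i ∉ J) :
    Amalgam ((closure (h '' {m | x i m ∈ ⋃ j ∈ J, range (x j)})).map (e i)) (sub e J)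
      (sub e {i}) := by
  refine hA.amalgam_sub ?_ ?_
  · have : J ∩ {i} = ∅ := by simpa using hi
    rw [this, sub_empty]; exact bot_le
  · rintro j hj _ rfl m l hml
    rw [hA.glue hml]
    refine ⟨h l, subset_closure ⟨l, ?_, rfl⟩, rfl⟩
    exact Set.mem_biUnion hj ⟨m, hml⟩

/-- A transfinite sequence of copies of `L`, each of which meets the previous ones in a set over
which `L` is free, gives a free extension. -/
theorem freeOver_sub {J K : Set I} (hJK : J ⊆ K) (r : K → K → Prop) [IsWellOrder K r]
    (hinit : ∀ a b : K, r a b → b.1 ∈ J → a.1 ∈ J)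
    (hfree : ∀ i : K, FreeOver
      (closure (h '' {m | x i m ∈ ⋃ j ∈ {j : K | r j i}, range (x j)})) ⊤) :
    FreeOver (sub e J) (sub e K) := by
  classical
  let _ : LinearOrder K := linearOrderOfSTO r
  have hlt : ∀ {a b : K}, a < b ↔ r a b := Iff.rfl
  have hwf : WellFounded (α := K) (· < ·) := IsWellFounded.wf (r := r)
  -- A basis of the i-th copy over its shared generators stays independent over all earlier copies,
  -- by amalgamation over exactly these generators.
  have hfree' : ∀ i : {i : K // i.1 ∉ J}, ∃ Y : Set A, Y ⊆ sub e {i.1.1} ∧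
      IndependentOver (sub e (Subtype.val '' {j : K | j < i.1})) Y ∧
      sub e {i.1.1} ≤ sub e (Subtype.val '' {j : K | j < i.1}) ⊔ closure Y := by
    rintro ⟨i, hi⟩
    obtain ⟨Y, hY, hgen⟩ := freeOver_iff.1 (hA.freeOver_map i.1 (hfree i))
    have hYs : Y ⊆ sub e {i.1} := by
      rw [← hgen]; exact fun y hy => le_sup_right (b := closure Y) (subset_closure hy)
    have hnot : i.1 ∉ Subtype.val '' {j : K | j < i} := by
      rintro ⟨j, hj, hji⟩
      rw [Subtype.ext hji] at hj
      exact lt_irrefl i hj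
    have ham := hA.amalgam_singleton hnot
    have heq : {m | x i.1 m ∈ ⋃ j ∈ Subtype.val '' {j : K | j < i}, range (x j)} =
        {m | x i m ∈ ⋃ j ∈ {j : K | r j i}, range (x j)} := by
      ext m; simp [hlt]
    rw [heq] at ham
    refine ⟨Y, hYs, ham.independentOver hY hYs, ?_⟩
    conv_lhs => rw [← hgen]
    refine sup_le_sup_right ?_ _
    rintro _ ⟨a, ha, rfl⟩
    have hle : closure (h '' {m | x i m ∈ ⋃ j ∈ {j : K | r j i}, range (x j)}) ≤
        (sub e (Subtype.val '' {j : K | j < i})).comap (e i) := by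
      refine closure_le.2 ?_
      rintro _ ⟨m, hm, rfl⟩
      obtain ⟨j, hj, l, hl⟩ := Set.mem_iUnion₂.1 hm
      have := hA.glue hl
      change e i (h m) ∈ sub e (Subtype.val '' {j : K | j < i})
      rw [← this]
      exact emb_mem_sub (Set.mem_image_of_mem _ hj) _
    exact hle ha
  choose Y hYs hYi hYg using hfree'
  refine freeOver_iff.2 ⟨⋃ i, Y i, ?_, ?_⟩
  · refine independentOver_iUnion (C := fun i : {i : K // i.1 ∉ J} =>
      sub e (Subtype.val '' {j : K | j < i.1})) ?_ ?_ hYi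
    · refine fun i => sub_mono fun j hj => ?_
      refine ⟨⟨j, hJK hj⟩, ?_, rfl⟩
      rcases lt_trichotomy (⟨j, hJK hj⟩ : K) i.1 with hlt' | heq | hgt
      · exact hlt'
      · exact absurd (by rw [← heq]; exact hj) i.2
      · exact absurd (hinit _ _ hgt hj) i.2
    · intro i j hji
      refine (hYs j).trans (sub_mono ?_)
      rw [Set.singleton_subset_iff]
      exact ⟨j.1, hji, rfl⟩
  · apply le_antisymm
    · refine sup_le (sub_mono hJK) (closure_le.2 (Set.iUnion_subset fun i => ?_))
      exact (hYs i).trans (sub_mono (Set.singleton_subset_iff.2 i.1.2))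
    · refine sub_le fun i hi a => ?_
      have : ∀ i : K, sub e {i.1} ≤ sub e J ⊔ closure (⋃ i, Y i) := by
        intro i
        induction i using hwf.induction with
        | _ i ih =>
          by_cases hi : i.1 ∈ J
          · exact (sub_mono (Set.singleton_subset_iff.2 hi)).trans le_sup_left
          · refine (hYg ⟨i, hi⟩).trans (sup_le (sub_le ?_) ?_)
            · rintro _ ⟨j, hj, rfl⟩ a
              exact ih j hj (emb_mem_sub_self _ a)
            · exact (BooleanSubalgebra.closure_mono (Set.subset_iUnion Y ⟨i, hi⟩)).trans
                le_sup_right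
      exact this ⟨i, hi⟩ (emb_mem_sub_self _ a)

end IsGluing

end Gluing

end OpenGen

namespace OpenGen

/-! ### Clubs and cardinal arithmetic at a regular cardinal -/

section Clubs

variable {θ : Cardinal.{u}}

theorem exists_bound (hθ : θ.IsRegular) {S : Type v}
    (hS : Cardinal.lift.{u} #S < Cardinal.lift.{v} θ) (f : S → Iio θ.ord) :
    ∃ b : Iio θ.ord, ∀ s, f s < b := by
  have hlt : ⨆ s, (f s).1 + 1 < θ.ord := by
    refine Ordinal.lift_iSup_add_one_lt_of_lt_cof ?_ fun s => (f s).2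
    rwa [← Ordinal.lift_cof, hθ.cof_ord]
  have : Small.{u} S := by
    rw [← mk_out θ] at hS
    obtain ⟨g⟩ := Cardinal.lift_mk_le'.1 hS.le
    exact small_of_injective g.injective
  refine ⟨⟨_, hlt⟩, fun s => Subtype.coe_lt_coe.1 ?_⟩
  exact lt_of_lt_of_le (Order.lt_add_one_iff.2 le_rfl) (Ordinal.le_iSup (fun s => (f s).1 + 1) s)

theorem lift_mk_Iio_lt (γ : Ordinal.{u}) (hγ : γ < θ.ord) :
    #(Iio γ) < Cardinal.lift.{u + 1} θ := by
  rw [Cardinal.mk_Iio_ordinal, Cardinal.lift_lt]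
  exact Cardinal.lt_ord.1 hγ

theorem mk_Iic_lt (hθ : θ.IsRegular) (γ : Iio θ.ord) : #(Iic γ) < Cardinal.lift.{u + 1} θ := by
  have hγ : Order.succ γ.1 < θ.ord := (isSuccLimit_ord hθ.aleph0_le).succ_lt γ.2
  refine lt_of_le_of_lt ?_ (lift_mk_Iio_lt _ hγ)
  refine mk_le_of_injective (f := fun β : Iic γ => (⟨β.1.1, Set.mem_Iio.2
    (Order.lt_succ_iff.2 β.2)⟩ : Iio (Order.succ γ.1))) fun a b hab => ?_
  simpa [Subtype.ext_iff] using hab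

theorem cof_Iio_ne_aleph0 (hθ : θ.IsRegular) (hunc : ℵ₀ < θ) : Order.cof (Iio θ.ord) ≠ ℵ₀ := by
  rw [Ordinal.cof_Iio, ← Ordinal.lift_cof, hθ.cof_ord]
  simpa using hunc.ne'

/-- A closure point above α is the supremum of ω iterates of a strictly increasing majorant of g; it
is below θ because θ is regular and uncountable. The first conjunct excludes zero, where closure
would be vacuous. -/
theorem isClub_closedUnder (hθ : θ.IsRegular) (hunc : ℵ₀ < θ) (g : Iio θ.ord → Iio θ.ord) :
    IsClub {β : Iio θ.ord | (∃ γ, γ < β) ∧ ∀ γ < β, g γ < β} := by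
  refine ⟨?_, fun α => ?_⟩
  · intro d hd hne _ β hβ
    refine ⟨?_, fun γ hγ => ?_⟩
    · obtain ⟨c, hc⟩ := hne
      obtain ⟨γ, hγ⟩ := (hd hc).1
      exact ⟨γ, hγ.trans_le (hβ.1 hc)⟩
    · obtain ⟨c, hc, hγc⟩ := (lt_isLUB_iff hβ).1 hγ
      exact ((hd hc).2 γ hγc).trans_le (hβ.1 hc)
  · have hG : ∀ γ : Iio θ.ord, ∃ b, (∀ δ ≤ γ, g δ < b) ∧ γ < b := by
      intro γ
      have hS : Cardinal.lift.{u} #(Iic γ) < Cardinal.lift.{u + 1} θ := by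
        rw [Cardinal.lift_id'.{u, u + 1}]; exact mk_Iic_lt hθ γ
      obtain ⟨b, hb⟩ := exists_bound hθ hS fun δ => max (g δ.1) γ
      exact ⟨b, fun δ hδ => (le_max_left _ _).trans_lt (hb ⟨δ, hδ⟩),
        (le_max_right _ _).trans_lt (hb ⟨γ, Set.mem_Iic.2 le_rfl⟩)⟩
    choose G hG1 hG2 using hG
    let a : ℕ → Iio θ.ord := fun n => G^[n] (G α)
    have ha : ∀ n, a (n + 1) = G (a n) := fun n => Function.iterate_succ_apply' G n _
    obtain ⟨b, hb⟩ := exists_bound hθ (S := ℕ) (by simpa using hunc) a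
    obtain ⟨β, hβ⟩ : ∃ β, IsLUB (range a) β := by
      have hne : (upperBounds (range a)).Nonempty := ⟨b, by rintro _ ⟨n, rfl⟩; exact (hb n).le⟩
      refine ⟨WellFounded.min (wellFounded_lt (α := Iio θ.ord)) _ hne,
        WellFounded.min_mem _ _ hne, fun c hc => ?_⟩
      exact WellFounded.min_le _ hc
    have hαβ : α < β := (hG2 α).trans_le (hβ.1 ⟨0, rfl⟩)
    refine ⟨β, ⟨⟨α, hαβ⟩, fun γ hγ => ?_⟩, hαβ.le⟩
    obtain ⟨_, ⟨n, rfl⟩, hn⟩ := (lt_isLUB_iff hβ).1 hγ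
    exact ((hG1 (a n) γ hn.le).trans_le (ha n).ge).trans_le (hβ.1 ⟨n + 1, rfl⟩)

/-- The set of limit points closed under fewer than `θ` many functions at a time. -/
theorem exists_club_closedUnder (hθ : θ.IsRegular) (hunc : ℵ₀ < θ) {S : Iio θ.ord → Type v}
    (hS : ∀ γ, Cardinal.lift.{u} #(S γ) < Cardinal.lift.{v} θ) (f : ∀ γ, S γ → Iio θ.ord) :
    ∃ C : Set (Iio θ.ord), IsClub C ∧ ∀ β ∈ C, (∃ γ, γ < β) ∧ (∀ γ < β, ∃ δ, γ < δ ∧ δ < β) ∧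
      ∀ γ < β, ∀ s, f γ s < β := by
  have hg : ∀ γ, ∃ b, γ < b ∧ ∀ s, f γ s < b := by
    intro γ
    obtain ⟨b, hb⟩ := exists_bound hθ (hS γ) (f γ)
    obtain ⟨b', hb'⟩ := exists_bound hθ (S := PUnit.{1}) (by simpa using hθ.nat_lt 1) fun _ => max γ b
    exact ⟨b', (le_max_left _ _).trans_lt (hb' ⟨⟩),
      fun s => (hb s).trans ((le_max_right _ _).trans_lt (hb' ⟨⟩))⟩
  choose g hg1 hg2 using hg
  exact ⟨_, isClub_closedUnder hθ hunc g, fun β hβ => ⟨hβ.1, fun γ hγ => ⟨g γ, hg1 γ, hβ.2 γ hγ⟩,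
    fun γ hγ s => (hg2 γ s).trans (hβ.2 γ hγ)⟩⟩

theorem _root_.IsStationary.exists_gt (hθ : θ.IsRegular) (hunc : ℵ₀ < θ) {E : Set (Iio θ.ord)}
    (hE : IsStationary E) (γ : Iio θ.ord) : ∃ β ∈ E, γ < β := by
  obtain ⟨β, hβ, hβ'⟩ := hE (isClub_closedUnder hθ hunc fun _ => γ)
  obtain ⟨δ, hδ⟩ := hβ'.1
  exact ⟨β, hβ, hβ'.2 δ hδ⟩

theorem lift_mk_biUnion_lt (hθ : θ.IsRegular) {S : Type v} {ι : Type w}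
    {J : Set ι} {U : ι → Set S} (hJ : Cardinal.lift.{u} #J < Cardinal.lift.{w} θ)
    (hU : ∀ i ∈ J, Cardinal.lift.{u} #(U i) < Cardinal.lift.{v} θ) :
    Cardinal.lift.{u} #(⋃ i ∈ J, U i) < Cardinal.lift.{v} θ := by
  have hθ' : (Cardinal.lift.{max v w} θ).IsRegular := hθ.lift
  let V : ULift.{max u v} J → Set (ULift.{max u w} S) := fun i => ULift.down ⁻¹' U i.down
  have h1 : #(⋃ i, V i) < Cardinal.lift.{max v w} θ := by
    rw [card_iUnion_lt_iff_forall_of_isRegular hθ']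
    · intro i
      have := hU i.down i.down.2
      rw [← Cardinal.lift_lt.{_, w}] at this
      simp only [Cardinal.lift_lift] at this
      refine lt_of_eq_of_lt ?_ this
      have h2 : #(V i) = Cardinal.lift.{max u w} #(U i.down) := by
        rw [← mk_uLift]
        exact mk_congr ⟨fun s => ⟨⟨s.1.down, s.2⟩⟩, fun s => ⟨⟨s.down.1⟩, s.down.2⟩,
          fun _ => rfl, fun _ => rfl⟩
      rw [h2]
    · rw [mk_uLift, ← Cardinal.lift_lt.{_, v}] at *
      simpa using hJ
  rw [← Cardinal.lift_lt.{_, w}]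
  simp only [Cardinal.lift_lift]
  refine lt_of_eq_of_lt ?_ h1
  rw [← Cardinal.lift_id'.{v, max u v w} #(⋃ i, V i)]
  let E : (⋃ i ∈ J, U i : Set S) ≃ (⋃ i, V i : Set (ULift.{max u w} S)) :=
    { toFun := fun s => ⟨⟨s.1⟩, by
        obtain ⟨i, hi, hs⟩ := Set.mem_iUnion₂.1 s.2
        exact Set.mem_iUnion.2 ⟨⟨⟨i, hi⟩⟩, hs⟩⟩
      invFun := fun s => ⟨s.1.down, by
        obtain ⟨i, hs⟩ := Set.mem_iUnion.1 s.2
        exact Set.mem_iUnion₂.2 ⟨i.down.1, i.down.2, hs⟩⟩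
      left_inv := fun _ => rfl
      right_inv := fun _ => rfl }
  rw [← Cardinal.lift_umax.{v, max u w}]
  exact Cardinal.lift_mk_eq'.2 ⟨E⟩

theorem lift_lt_of_countable (hunc : ℵ₀ < θ) {S : Type v} [Countable S] :
    Cardinal.lift.{u} #S < Cardinal.lift.{v} θ := by
  refine lt_of_le_of_lt (b := ℵ₀) (by simp) (by simpa using hunc)

theorem lift_mk_lt_of_injective {S : Type v} {T : Type w} (f : S → T)
    (hf : Function.Injective f) (hT : Cardinal.lift.{u} #T < Cardinal.lift.{w} θ) :
    Cardinal.lift.{u} #S < Cardinal.lift.{v} θ := by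
  have h1 : Cardinal.lift.{w} #S ≤ Cardinal.lift.{v} #T := Cardinal.lift_mk_le'.2 ⟨⟨f, hf⟩⟩
  have h2 := Cardinal.lift_le.{u}.2 h1
  have h3 := Cardinal.lift_lt.{_, v}.2 hT
  rw [← Cardinal.lift_lt.{_, w}]
  simp only [Cardinal.lift_lift] at *
  exact h2.trans_lt h3

end Clubs

end OpenGen

/-! ### The tree of a λ-system in its lexicographic order -/

namespace OpenGen

theorem lex_append_singleton_iff {α : Type*} [LinearOrder α] (l μ : List α) (β : α) :
    List.Lex (· < ·) l (μ ++ [β]) ↔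
      List.Lex (· < ·) l μ ∨ l = μ ∨ ∃ γ < β, μ ++ [γ] <+: l := by
  induction μ generalizing l with
  | nil =>
    cases l with
    | nil => simp
    | cons a l =>
      rw [List.nil_append, List.cons_lex_cons_iff]
      simp [List.cons_prefix_cons]
  | cons b μ ih =>
    cases l with
    | nil => simp
    | cons a l =>
      simp only [List.cons_append, List.cons_lex_cons_iff, ih, List.cons.injEq,
        List.cons_prefix_cons]
      constructor
      · rintro (h | ⟨rfl, h | rfl | ⟨γ, hγ, h⟩⟩)
        · exact Or.inl (Or.inl h)
        · exact Or.inl (Or.inr ⟨rfl, h⟩)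
        · exact Or.inr (Or.inl ⟨rfl, rfl⟩)
        · exact Or.inr (Or.inr ⟨γ, hγ, rfl, h⟩)
      · rintro ((h | ⟨rfl, h⟩) | ⟨rfl, rfl⟩ | ⟨γ, hγ, rfl, h⟩)
        · exact Or.inl h
        · exact Or.inr ⟨rfl, Or.inl h⟩
        · exact Or.inr ⟨rfl, Or.inr (Or.inl rfl)⟩
        · exact Or.inr ⟨rfl, Or.inr (Or.inr ⟨γ, hγ, h⟩)⟩

theorem prefix_and_getD_lt_iff (μ l : List Ordinal.{u}) (β : Ordinal.{u}) :
    (μ <+: l ∧ μ ≠ l ∧ l.getD μ.length 0 < β) ↔ ∃ γ < β, μ ++ [γ] <+: l := by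
  constructor
  · rintro ⟨⟨t, rfl⟩, hne, hlt⟩
    cases t with
    | nil => simp at hne
    | cons γ t =>
      refine ⟨γ, by simpa using hlt, ⟨t, by simp⟩⟩
  · rintro ⟨γ, hγ, ⟨t, rfl⟩⟩
    exact ⟨⟨γ :: t, by simp⟩, by simp, by simpa using hγ⟩

namespace LambdaSystem

variable {κ : Cardinal.{u}} {X : Type u} (Λ : LambdaSystem κ X)

/-- The final nodes lexicographically below `μ`. -/
def lexLT (μ : List Ordinal.{u}) : Set Λ.FinalNode := {η | List.Lex (· < ·) η.1 μ}

/-- The final nodes extending `μ`. -/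
def above (μ : List Ordinal.{u}) : Set Λ.FinalNode := {η | μ <+: η.1}

/-- The final nodes properly extending `μ` by an ordinal less than `β`. -/
def slice (μ : List Ordinal.{u}) (β : Ordinal.{u}) : Set Λ.FinalNode :=
  {η | ∃ γ < β, μ ++ [γ] <+: η.1}

/-- The final nodes lexicographically below the extension of `μ` by `β`. -/
def region (μ : List Ordinal.{u}) (β : Ordinal.{u}) : Set Λ.FinalNode :=
  Λ.lexLT μ ∪ Λ.slice μ β

variable {Λ} {μ : List Ordinal.{u}} {β γ : Ordinal.{u}}

theorem mem_slice_iff {η : Λ.FinalNode} : η ∈ Λ.slice μ β ↔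
    μ <+: η.1 ∧ μ ≠ η.1 ∧ η.1.getD μ.length 0 < β :=
  (prefix_and_getD_lt_iff _ _ _).symm

theorem slice_mono (h : β ≤ γ) : Λ.slice μ β ⊆ Λ.slice μ γ :=
  fun _ ⟨δ, hδ, hη⟩ => ⟨δ, hδ.trans_le h, hη⟩

theorem region_mono (h : β ≤ γ) : Λ.region μ β ⊆ Λ.region μ γ :=
  Set.union_subset_union_right _ (slice_mono h)

theorem slice_subset_above : Λ.slice μ β ⊆ Λ.above μ := by
  rintro η ⟨γ, -, h⟩
  exact (List.prefix_append _ _).trans h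

theorem mem_of_prefix {η : Λ.FinalNode} (h : μ <+: η.1) : μ ∈ Λ.S := Λ.prefix_mem η.1 η.2.1 μ h

theorem lexLT_append (hμ : ¬ IsFinalNode Λ.S μ) (β : Ordinal.{u}) :
    Λ.lexLT (μ ++ [β]) = Λ.region μ β := by
  ext η
  have hne : η.1 ≠ μ := fun h => hμ (h ▸ η.2)
  simp only [lexLT, region, slice, Set.mem_union, Set.mem_ofPred_eq, lex_append_singleton_iff, hne,
    false_or]

theorem slice_succ : Λ.slice μ (Order.succ β) = Λ.slice μ β ∪ Λ.above (μ ++ [β]) := by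
  ext η
  simp only [slice, above, Set.mem_union, Set.mem_ofPred_eq, Order.lt_succ_iff]
  constructor
  · rintro ⟨γ, hγ, h⟩
    rcases hγ.lt_or_eq with hγ | rfl
    · exact Or.inl ⟨γ, hγ, h⟩
    · exact Or.inr h
  · rintro (⟨γ, hγ, h⟩ | h)
    · exact ⟨γ, hγ.le, h⟩
    · exact ⟨β, le_rfl, h⟩

theorem region_succ : Λ.region μ (Order.succ β) = Λ.region μ β ∪ Λ.above (μ ++ [β]) := by
  rw [region, slice_succ, region, Set.union_assoc]

theorem region_succ_of_notMem (h : μ ++ [β] ∉ Λ.S) :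
    Λ.region μ (Order.succ β) = Λ.region μ β := by
  rw [region_succ, Set.union_eq_left]
  exact fun η hη => absurd (mem_of_prefix hη) h

theorem exists_append_prefix (hμ : ¬ IsFinalNode Λ.S μ) {η : Λ.FinalNode} (hη : η ∈ Λ.above μ) :
    ∃ γ, μ ++ [γ] ∈ Λ.S ∧ γ < (Λ.lam μ).ord ∧ η ∈ Λ.above (μ ++ [γ]) := by
  obtain ⟨t, ht⟩ := id hη
  cases t with
  | nil =>
    rw [List.append_nil] at ht
    exact absurd (ht ▸ η.2) hμ
  | cons γ t =>
    have hpre : μ ++ [γ] <+: η.1 := ⟨t, by simpa using ht⟩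
    have hmem := mem_of_prefix hpre
    exact ⟨γ, hmem, (Λ.child_lt μ (mem_of_prefix hη) γ hmem).1, hpre⟩

theorem union_above_eq (hμS : μ ∈ Λ.S) (hμ : ¬ IsFinalNode Λ.S μ) :
    Λ.lexLT μ ∪ Λ.above μ = ⋃ β : Iio (Λ.lam μ).ord, Λ.region μ β := by
  have hlim := isSuccLimit_ord (Λ.lam_regular μ hμS).aleph0_le
  ext η
  simp only [Set.mem_union, Set.mem_iUnion, region]
  constructor
  · rintro (h | h)
    · exact ⟨⟨0, (Λ.lam_regular μ hμS).ord_pos⟩, Or.inl h⟩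
    · obtain ⟨γ, -, hγ, hη⟩ := exists_append_prefix hμ h
      exact ⟨⟨Order.succ γ, hlim.succ_lt hγ⟩, Or.inr ⟨γ, Order.lt_succ γ, hη⟩⟩
  · rintro ⟨β, h | h⟩
    · exact Or.inl h
    · exact Or.inr (slice_subset_above h)

theorem aleph0_lt_lam (hμS : μ ∈ Λ.S) (hμ : ¬ IsFinalNode Λ.S μ) : ℵ₀ < Λ.lam μ :=
  lt_of_le_of_ne (Λ.lam_regular μ hμS).aleph0_le fun h => hμ ((Λ.final_iff μ hμS).2 h.symm)

/-- Induction along the tree: from all immediate successors to a node. -/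
theorem tree_induction {P : List Ordinal.{u} → Prop}
    (h : ∀ μ ∈ Λ.S, (∀ β, μ ++ [β] ∈ Λ.S → P (μ ++ [β])) → P μ) : ∀ μ ∈ Λ.S, P μ := by
  have key : ∀ θ : Cardinal.{u}, ∀ μ ∈ Λ.S, Λ.lam μ = θ → P μ := by
    intro θ
    -- The cardinals drop strictly along branches, so they serve as ranks for induction from the
    -- final nodes to the root.
    induction θ using WellFoundedLT.induction with
    | _ θ ih =>
      rintro μ hμ rfl
      exact h μ hμ fun β hβ => ih _ (Λ.child_lt μ hμ β hβ).2 _ hβ rfl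
  exact fun μ hμ => key _ μ hμ rfl

theorem above_nonempty : ∀ μ ∈ Λ.S, (Λ.above μ).Nonempty := by
  refine tree_induction fun μ hμS ih => ?_
  by_cases hμ : IsFinalNode Λ.S μ
  · exact ⟨⟨μ, hμ⟩, List.prefix_rfl⟩
  · obtain ⟨β, hβ⟩ := (Λ.stationary μ hμS hμ).nonempty
    obtain ⟨η, hη⟩ := ih β hβ
    exact ⟨η, (List.prefix_append _ _).trans hη⟩

theorem mk_above_le : ∀ μ ∈ Λ.S, #(Λ.above μ) ≤ Cardinal.lift.{u + 1} (Λ.lam μ) := by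
  refine tree_induction fun μ hμS ih => ?_
  have hinf := (Λ.lam_regular μ hμS).aleph0_le
  by_cases hμ : IsFinalNode Λ.S μ
  · have hsub : (Λ.above μ).Subsingleton := fun η hη ν hν =>
      Subtype.ext ((hμ.2 _ η.2.1 hη).trans (hμ.2 _ ν.2.1 hν).symm)
    refine (Cardinal.mk_le_one_iff_set_subsingleton.2 hsub).trans ?_
    exact one_le_aleph0.trans (by simpa using hinf)
  · have hsub : Λ.above μ ⊆ ⋃ γ : Iio (Λ.lam μ).ord,
        {η | μ ++ [γ.1] ∈ Λ.S ∧ η ∈ Λ.above (μ ++ [γ.1])} := fun η hη => by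
      obtain ⟨γ, h1, h2, h3⟩ := exists_append_prefix hμ hη
      exact Set.mem_iUnion.2 ⟨⟨γ, h2⟩, h1, h3⟩
    refine (mk_le_mk_of_subset hsub).trans (mk_iUnion_le_sum_mk.trans
      ((sum_le_mk_mul_iSup _).trans ?_))
    have h1 : #(Iio (Λ.lam μ).ord) = Cardinal.lift.{u + 1} (Λ.lam μ) := by
      rw [Cardinal.mk_Iio_ordinal, Cardinal.card_ord]
    have h2 : (⨆ γ : Iio (Λ.lam μ).ord,
        #{η | μ ++ [γ.1] ∈ Λ.S ∧ η ∈ Λ.above (μ ++ [γ.1])}) ≤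
        Cardinal.lift.{u + 1} (Λ.lam μ) := by
      refine ciSup_le' fun γ => ?_
      by_cases hγ : μ ++ [γ.1] ∈ Λ.S
      · refine le_trans (mk_le_mk_of_subset fun η hη => hη.2) ((ih _ hγ).trans ?_)
        exact Cardinal.lift_le.2 (Λ.child_lt μ hμS _ hγ).2.le
      · have : {η | μ ++ [γ.1] ∈ Λ.S ∧ η ∈ Λ.above (μ ++ [γ.1])} = ∅ := by
          ext; simp [hγ]
        rw [this]; simp
    calc _ ≤ Cardinal.lift.{u + 1} (Λ.lam μ) * Cardinal.lift.{u + 1} (Λ.lam μ) :=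
          mul_le_mul' h1.le h2
      _ = _ := mul_eq_self (by simpa using hinf)

theorem mk_slice_lt (hμS : μ ∈ Λ.S) (hβ : β < (Λ.lam μ).ord) :
    #(Λ.slice μ β) < Cardinal.lift.{u + 1} (Λ.lam μ) := by
  have hsub : Λ.slice μ β ⊆ ⋃ γ ∈ Iio β,
      {η | μ ++ [γ] ∈ Λ.S ∧ η ∈ Λ.above (μ ++ [γ])} := by
    rintro η ⟨γ, hγ, h⟩
    exact Set.mem_biUnion hγ ⟨mem_of_prefix h, h⟩
  refine (mk_le_mk_of_subset hsub).trans_lt ?_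
  rw [card_biUnion_lt_iff_forall_of_isRegular (Λ.lam_regular μ hμS).lift (lift_mk_Iio_lt β hβ)]
  intro γ _
  by_cases hγ : μ ++ [γ] ∈ Λ.S
  · refine lt_of_le_of_lt (mk_le_mk_of_subset fun η hη => hη.2) ((mk_above_le _ hγ).trans_lt ?_)
    exact Cardinal.lift_lt.2 (Λ.child_lt μ hμS _ hγ).2
  · have : {η | μ ++ [γ] ∈ Λ.S ∧ η ∈ Λ.above (μ ++ [γ])} = ∅ := by
      ext; simp [hγ]
    rw [this]
    simpa using (Λ.lam_regular μ hμS).pos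

theorem lexLT_nil : Λ.lexLT [] = ∅ := by
  ext η; simp [lexLT, List.not_lex_nil]

end LambdaSystem

open BooleanSubalgebra LambdaSystem

/-! ### Free extensions obtained from strong reshuffling -/

section Free

variable {κ : Cardinal.{u}} {X : Type u} {Λ : LambdaSystem κ X} {n : ℕ} {L : Type w}
  [BooleanAlgebra L] {D : CPPlus n L} {x : Λ.FinalNode → ℕ → X} {A : Type v} [BooleanAlgebra A]
  {e : Λ.FinalNode → BoundedLatticeHom L A} {s : Λ.FinalNode → Set X}
  {p : Λ.FinalNode → Fin n → Set X} {μ : List Ordinal.{u}} {β γ : Ordinal.{u}}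

theorem CPPlus.freeOver_of_finite (D : CPPlus n L) {y : ℕ → X} (hy : Function.Injective y)
    {T : Set X} (hfin : ∃ k, (y '' D.block k ∩ T).Finite) :
    FreeOver (closure (D.h '' {m | y m ∈ T})) ⊤ := by
  obtain ⟨k, hk⟩ := hfin
  refine D.closure_freeOver _ ⟨k, Set.Finite.of_finite_image (hk.subset ?_) hy.injOn⟩
  rintro _ ⟨m, ⟨hm, hm'⟩, rfl⟩
  exact ⟨⟨m, hm', rfl⟩, hm⟩

theorem IsGluing.freeOver_of_wellOrder (hA : IsGluing D.h x e) (hs : ∀ η, range (x η) = s η)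
    (hp : ∀ η k, x η '' D.block k = p η k) {J K : Set Λ.FinalNode} (hJK : J ⊆ K)
    (r : K → K → Prop) [IsWellOrder K r] (hinit : ∀ a b : K, r a b → b.1 ∈ J → a.1 ∈ J)
    (hfin : ∀ η : K, ∃ k, (p η k ∩ ⋃ ν ∈ {ν : K | r ν η}, s ν).Finite) :
    FreeOver (sub e J) (sub e K) := by
  refine hA.freeOver_sub hJK r hinit fun η => D.freeOver_of_finite (hA.index_injective η) ?_
  obtain ⟨k, hk⟩ := hfin η
  refine ⟨k, ?_⟩
  simpa only [hs, hp] using hk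

/-- Copies of `L` belonging to few final nodes above `μ` form a free extension of the algebra
generated by the copies below `μ`. -/
theorem IsGluing.freeOver_lexLT (hA : IsGluing D.h x e) (hs : ∀ η, range (x η) = s η)
    (hp : ∀ η k, x η '' D.block k = p η k) (hr : Λ.StrongReshuffling s p) (hμS : μ ∈ Λ.S)
    (hμ : ¬ IsFinalNode Λ.S μ) {I : Set Λ.FinalNode} (hI : I ⊆ Λ.above μ)
    (hcard : #I < Cardinal.lift.{u + 1} (Λ.lam μ)) :
    FreeOver (sub e (Λ.lexLT μ)) (sub e (Λ.lexLT μ ∪ I)) := by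
  -- The value 0 is arbitrary: only the alternative of (b) about nodes lexicographically below μ is
  -- used, and it makes `lexLT μ` an initial segment.
  obtain ⟨r, hwo, h⟩ := hr.two μ hμS hμ 0 (Λ.lam_regular μ hμS).ord_pos I hI hcard
  refine hA.freeOver_of_wellOrder hs hp (K := Λ.lexBelow μ I) (fun η hη => Or.inl hη) r ?_
    fun η => (h η).1
  intro a b hab hb
  by_contra ha
  have haI : a.1 ∈ I := a.2.resolve_left ha
  have hne : μ ≠ a.1.1 := fun h => hμ (h ▸ a.1.2)
  exact asymm hab ((h a).2 (hI haI) hne b (Or.inl hb))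

/-- Clause (b) with α = β puts the region up to and including β before everything else. The
successor is essential: the part above μ⌢(β) itself is the one that may destroy freeness. -/
theorem IsGluing.freeOver_region (hA : IsGluing D.h x e) (hs : ∀ η, range (x η) = s η)
    (hp : ∀ η k, x η '' D.block k = p η k) (hr : Λ.StrongReshuffling s p) (hμS : μ ∈ Λ.S)
    (hμ : ¬ IsFinalNode Λ.S μ) (hβγ : β < γ) (hγ : γ < (Λ.lam μ).ord) :
    FreeOver (sub e (Λ.region μ (Order.succ β))) (sub e (Λ.region μ γ)) := by
  obtain ⟨r, hwo, h⟩ := hr.two μ hμS hμ β (hβγ.trans hγ) (Λ.slice μ γ)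
    slice_subset_above (mk_slice_lt hμS hγ)
  refine hA.freeOver_of_wellOrder hs hp (K := Λ.lexBelow μ (Λ.slice μ γ))
    (region_mono (Order.succ_le_of_lt hβγ)) r ?_ fun η => (h η).1
  intro a b hab hb
  by_contra ha
  have haI : a.1 ∈ Λ.slice μ γ := a.2.resolve_left fun h' => ha (Or.inl h')
  obtain ⟨h1, h2, h3⟩ := mem_slice_iff.1 haI
  refine asymm hab ((h a).2 h1 h2 b ?_)
  rcases hb with hb | hb
  · exact Or.inl hb
  · obtain ⟨h4, h5, h6⟩ := mem_slice_iff.1 hb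
    refine Or.inr ⟨h4, h5, Order.lt_succ_iff.1 h6, ?_⟩
    by_contra h7
    exact ha (Or.inr (mem_slice_iff.2 ⟨h1, h2, Order.lt_succ_iff.2 (not_lt.1 h7)⟩))

end Free

end OpenGen

/-! ### Non-freeness carried along the tree -/

namespace OpenGen

open BooleanSubalgebra LambdaSystem

theorem mem_of_mem_iSup {A T : Type*} [BooleanAlgebra A] [LinearOrder T] [Nonempty T]
    {V : T → BooleanSubalgebra A} (hV : Monotone V) {a : A} (ha : a ∈ ⨆ t, V t) :
    ∃ t, a ∈ V t := by
  let U : BooleanSubalgebra A :=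
    { carrier := {a | ∃ t, a ∈ V t}
      supClosed' := by
        rintro a ⟨t, ht⟩ b ⟨t', ht'⟩
        exact ⟨max t t', sup_mem (hV (le_max_left _ _) ht) (hV (le_max_right _ _) ht')⟩
      infClosed' := by
        rintro a ⟨t, ht⟩ b ⟨t', ht'⟩
        exact ⟨max t t', inf_mem (hV (le_max_left _ _) ht) (hV (le_max_right _ _) ht')⟩
      compl_mem' := by
        rintro a ⟨t, ht⟩
        exact ⟨t, compl_mem ht⟩
      bot_mem' := ⟨Classical.arbitrary T, bot_mem⟩ }
  exact (iSup_le fun t b hb => ⟨t, hb⟩ : ⨆ t, V t ≤ U) ha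

/-- The elements reachable from `b` along a finitely branching relation. -/
def reach {A : Type*} (f : A → Finset A) (b : A) : Set A :=
  {c | Relation.ReflTransGen (fun a c => c ∈ f a) b c}

theorem countable_reach {A : Type*} (f : A → Finset A) (b : A) : (reach f b).Countable := by
  let S : ℕ → Set A := fun n => Nat.rec {b} (fun _ T => ⋃ a ∈ T, (f a : Set A)) n
  have hS : ∀ n, (S n).Countable := by
    intro n
    induction n with
    | zero => exact Set.countable_singleton b
    | succ n ih => exact ih.biUnion fun a _ => (f a).countable_toSet
  refine (Set.countable_iUnion hS).mono fun c hc => ?_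
  induction hc with
  | refl => exact Set.mem_iUnion.2 ⟨0, rfl⟩
  | tail _ hac ih =>
    obtain ⟨n, hn⟩ := Set.mem_iUnion.1 ih
    exact Set.mem_iUnion.2 ⟨n + 1, Set.mem_biUnion hn hac⟩

theorem lift_mk_union_lt {θ : Cardinal.{u}} (hθ : ℵ₀ ≤ θ) {S : Type v} {U V : Set S}
    (hU : Cardinal.lift.{u} #U < Cardinal.lift.{v} θ)
    (hV : Cardinal.lift.{u} #V < Cardinal.lift.{v} θ) :
    Cardinal.lift.{u} #(U ∪ V : Set S) < Cardinal.lift.{v} θ := by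
  refine (Cardinal.lift_le.2 (mk_union_le U V)).trans_lt ?_
  rw [Cardinal.lift_add]
  exact add_lt_of_lt (by simpa using hθ) hU hV

section NonFree

variable {κ : Cardinal.{u}} {X : Type u} {Λ : LambdaSystem κ X} {n : ℕ} {L : Type w}
  [BooleanAlgebra L] {D : CPPlus n L} {x : Λ.FinalNode → ℕ → X} {A : Type v} [BooleanAlgebra A]
  {e : Λ.FinalNode → BoundedLatticeHom L A} {s : Λ.FinalNode → Set X}
  {p : Λ.FinalNode → Fin n → Set X} {μ : List Ordinal.{u}} {β γ : Ordinal.{u}}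

theorem CPPlus.countable (D : CPPlus n L) : Countable L := by
  obtain ⟨Y, hY, -, hgen⟩ := D.L_free
  have := countable_closure hY
  rw [hgen] at this
  exact Set.countable_univ_iff.1 (by simpa using this)

/-- The second half of (CP+) is turned into the form that contradicts freeness: free extensions are
relatively complete, and the converse holds here because L is countable with infinitely many spare
generators over K. -/
theorem CPPlus.not_isRelComplete (D : CPPlus n L) : ¬ IsRelComplete (closure (range D.h)) := by
  intro hrc
  rw [D.h_generates] at hrc
  obtain ⟨y, hy, hind, hgen⟩ := D.L_eq_coprod
  have := D.countable
  exact D.not_freeOver (hrc.freeOver_top D.H_le_K hy hind hgen)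

/-- G contains the whole copy of H at η. If N were free over G, each element of the copy of L would
have a largest lower bound in G, and two interpolations push this bound down into the copy of H,
making H relatively complete in L. -/
theorem IsGluing.not_freeOver_of_final (hA : IsGluing D.h x e) (hs : ∀ η, range (x η) ⊆ Λ.Bbar η.1)
    (η : Λ.FinalNode) {G N : BooleanSubalgebra A}
    (hN : sub e (Λ.lexLT η.1 ∪ Λ.above η.1) ≤ N)
    (ham : Amalgam (sub e (Λ.lexLT η.1)) G (sub e (Λ.lexLT η.1 ∪ Λ.above η.1)))
    (hB : ∀ m, x η m ∈ Λ.Bbar η.1 → e η (D.h m) ∈ G) : ¬ FreeOver G N := by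
  intro hfree
  refine D.not_isRelComplete fun b => ?_
  have hηP : η ∈ Λ.lexLT η.1 ∪ Λ.above η.1 := Or.inr List.prefix_rfl
  have hη : η ∉ Λ.lexLT η.1 := fun h => List.lex_irrefl (fun a => lt_irrefl a) η.1 h
  have hHG : closure (range D.h) ≤ G.comap (e η) := by
    refine closure_le.2 ?_
    rintro _ ⟨m, rfl⟩
    exact hB m (hs η ⟨m, rfl⟩)
  obtain ⟨a, ⟨haG, hab⟩, ha⟩ := hfree.exists_isGreatest (hN (emb_mem_sub hηP b))
  obtain ⟨r, hr, har, hrb⟩ := ham.interpolant haG (emb_mem_sub hηP b) hab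
  obtain ⟨_, ⟨c, hc, rfl⟩, hrc, hcb⟩ :=
    (hA.amalgam_singleton hη).interpolant hr (emb_mem_sub_self η b) hrb
  have hc' : c ∈ closure (range D.h) :=
    BooleanSubalgebra.closure_mono (Set.image_subset_range _ _) hc
  refine ⟨c, ⟨hc', (hA.emb_le_emb_iff η).1 hcb⟩, fun d hd => ?_⟩
  refine (hA.emb_le_emb_iff η).1 ?_
  exact ((ha ⟨hHG hd.1, (hA.emb_le_emb_iff η).2 hd.2⟩).trans har).trans hrc

/-- The generators which have to be considered at the successor of `μ` by `γ`. -/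
def stageBase (Λ : LambdaSystem κ X) (h : ℕ → L) (x : Λ.FinalNode → ℕ → X)
    (e : Λ.FinalNode → BoundedLatticeHom L A) (μ : List Ordinal.{u}) (γ : Ordinal.{u}) : Set A :=
  (⋃ η ∈ Λ.above (μ ++ [γ]), range (e η)) ∪
    ⋃ z ∈ {z | μ ++ [γ] ∈ Λ.S ∧ z ∈ Λ.B (μ ++ [γ])},
      {a | ∃ η ∈ Λ.above μ, ∃ m, x η m = z ∧ a = e η (h m)}

theorem IsGluing.lift_mk_stageBase_lt (hA : IsGluing D.h x e) (hμS : μ ∈ Λ.S)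
    (hμ : ¬ IsFinalNode Λ.S μ) :
    Cardinal.lift.{u} #(stageBase Λ D.h x e μ γ) < Cardinal.lift.{v} (Λ.lam μ) := by
  have hreg := Λ.lam_regular μ hμS
  have hunc := aleph0_lt_lam hμS hμ
  have := D.countable
  refine lift_mk_union_lt hreg.aleph0_le ?_ ?_
  · refine lift_mk_biUnion_lt hreg ?_ fun η _ => ?_
    · rw [Cardinal.lift_id'.{u, u + 1}]
      by_cases h : μ ++ [γ] ∈ Λ.S
      · exact (mk_above_le _ h).trans_lt (Cardinal.lift_lt.2 (Λ.child_lt μ hμS γ h).2)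
      · have : Λ.above (μ ++ [γ]) = ∅ := Set.eq_empty_of_forall_notMem fun η hη =>
          h (mem_of_prefix hη)
        rw [this]; simpa using hreg.pos
    · have : Countable (range (e η)) := (Set.countable_range _).to_subtype
      exact lift_lt_of_countable hunc
  · refine lift_mk_biUnion_lt hreg ?_ fun z _ => ?_
    · simp only [Cardinal.lift_id]
      by_cases h : μ ++ [γ] ∈ Λ.S
      · exact (mk_le_mk_of_subset fun z hz => hz.2).trans_lt (Λ.B_card μ hμS γ h).2
      · simpa [h] using hreg.pos
    -- All generators with the same index z are identified, so each z contributes at most one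
    -- element and the bound on the size of B applies.
    · have hsub : {a | ∃ η ∈ Λ.above μ, ∃ m, x η m = z ∧ a = e η (D.h m)}.Subsingleton := by
        rintro _ ⟨η, -, m, hm, rfl⟩ _ ⟨ν, -, l, hl, rfl⟩
        exact hA.glue (hm.trans hl.symm)
      have := hsub.countable.to_subtype
      exact lift_lt_of_countable hunc

theorem stageBase_subset (h : ℕ → L) :
    stageBase Λ h x e μ γ ⊆ sub e (Λ.lexLT μ ∪ Λ.above μ) := by
  have habove : ∀ η ∈ Λ.above μ, η ∈ Λ.lexLT μ ∪ Λ.above μ := fun η hη => Or.inr hη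
  rintro a (ha | ha)
  · obtain ⟨η, hη, b, rfl⟩ := Set.mem_iUnion₂.1 ha
    have hη' : η ∈ Λ.above μ := (List.prefix_append _ _).trans hη
    exact emb_mem_sub (habove η hη') b
  · obtain ⟨z, -, η, hη, m, -, rfl⟩ := Set.mem_iUnion₂.1 ha
    exact emb_mem_sub (habove η hη) _

/-- On a club of `β`, an algebra with two generating sets over `G` and over `G ⊔ P`, where `P` is
generated by the copies of `L` above `μ`, is generated at stage `β` by corresponding parts. -/
theorem IsGluing.exists_club_stages (hA : IsGluing D.h x e) (hμS : μ ∈ Λ.S)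
    (hμ : ¬ IsFinalNode Λ.S μ) {G N : BooleanSubalgebra A} (hG : sub e (Λ.lexLT μ) ≤ G)
    {Xs Ys : Set A} (hXs : G ⊔ closure Xs = N)
    (hYs : G ⊔ sub e (Λ.lexLT μ ∪ Λ.above μ) ⊔ closure Ys = N) :
    ∃ C : Set (Iio (Λ.lam μ).ord), IsClub C ∧ ∃ T : Iio (Λ.lam μ).ord → Set A, Monotone T ∧
      ∀ β ∈ C, G ⊔ closure (Xs ∩ T β) = G ⊔ sub e (Λ.region μ β) ⊔ closure (Ys ∩ T β) ∧
        ∀ γ < β, stageBase Λ D.h x e μ γ ⊆ (G ⊔ closure (Xs ∩ T β) : BooleanSubalgebra A) := by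
  classical
  have hreg := Λ.lam_regular μ hμS
  have hunc := aleph0_lt_lam hμS hμ
  have hne : Nonempty (Iio (Λ.lam μ).ord) := ⟨⟨0, hreg.ord_pos⟩⟩
  have h1 : ∀ a, ∃ F : Finset A, (F : Set A) ⊆ Xs ∧ (a ∈ N → a ∈ G ⊔ closure (F : Set A)) := by
    intro a
    by_cases ha : a ∈ N
    · rw [← hXs] at ha
      obtain ⟨F, hF, hF'⟩ := exists_finset_mem_closure ha
      exact ⟨F, hF, fun _ => hF'⟩
    · exact ⟨∅, by simp, fun h => absurd h ha⟩
  have h2 : ∀ a, ∃ (F : Finset A) (γ : Iio (Λ.lam μ).ord), (F : Set A) ⊆ Ys ∧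
      (a ∈ N → a ∈ G ⊔ sub e (Λ.region μ γ) ⊔ closure (F : Set A)) := by
    intro a
    by_cases ha : a ∈ N
    · rw [← hYs] at ha
      obtain ⟨F, hF, hF'⟩ := exists_finset_mem_closure ha
      have hmono : Monotone fun γ : Iio (Λ.lam μ).ord =>
          G ⊔ sub e (Λ.region μ γ) ⊔ closure (F : Set A) := fun γ δ h =>
        sup_le_sup_right (sup_le_sup_left (sub_mono (region_mono h)) _) _
      have hle : G ⊔ sub e (Λ.lexLT μ ∪ Λ.above μ) ⊔ closure (F : Set A) ≤
          ⨆ γ : Iio (Λ.lam μ).ord, G ⊔ sub e (Λ.region μ γ) ⊔ closure (F : Set A) := by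
        have hb := le_iSup (fun γ : Iio (Λ.lam μ).ord =>
          G ⊔ sub e (Λ.region μ γ) ⊔ closure (F : Set A))
        refine sup_le (sup_le ?_ ?_) ?_
        · exact (le_sup_left.trans le_sup_left).trans (hb hne.some)
        · rw [union_above_eq hμS hμ]
          refine sub_le fun η hη b => ?_
          obtain ⟨γ, hγ⟩ := Set.mem_iUnion.1 hη
          exact ((le_sup_right.trans le_sup_left).trans (hb γ)) (emb_mem_sub hγ b)
        · exact le_sup_right.trans (hb hne.some)
      obtain ⟨γ, hγ⟩ := mem_of_mem_iSup hmono (hle hF')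
      exact ⟨F, γ, hF, fun _ => hγ⟩
    · exact ⟨∅, hne.some, by simp, fun h => absurd h ha⟩
  choose fX hfX hfX' using h1
  choose fY rk hfY hfY' using h2
  let f : A → Finset A := fun a => fX a ∪ fY a
  have hXN : Xs ⊆ N := fun a ha => by
    rw [← hXs]; exact le_sup_right (a := G) (subset_closure ha)
  have hYN : Ys ⊆ N := fun a ha => by
    rw [← hYs]; exact le_sup_right (b := closure Ys) (subset_closure ha)
  -- Each element of N has a finite support in `Xs` and one in `Ys`. Closing the base elements of γ
  -- under supports keeps the size below the cardinal at μ, so on a club the ranks `rk` of elements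
  -- met before β are below β.
  let R : Iio (Λ.lam μ).ord → Set A := fun γ => ⋃ b ∈ stageBase Λ D.h x e μ γ, reach f b
  have hR : ∀ γ, Cardinal.lift.{u} #(R γ) < Cardinal.lift.{v} (Λ.lam μ) := fun γ =>
    lift_mk_biUnion_lt hreg (hA.lift_mk_stageBase_lt hμS hμ) fun b _ => by
      have := (countable_reach f b).to_subtype
      exact lift_lt_of_countable hunc
  obtain ⟨C, hC, hCβ⟩ := exists_club_closedUnder hreg hunc hR fun γ t => rk t.1
  let T : Iio (Λ.lam μ).ord → Set A := fun β => ⋃ γ ∈ Iio β, R γ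
  have hT : ∀ β, ∀ a ∈ T β, ∀ c ∈ f a, c ∈ T β := by
    intro β a ha c hc
    obtain ⟨γ, hγ, ha⟩ := Set.mem_iUnion₂.1 ha
    obtain ⟨b, hb, ha⟩ := Set.mem_iUnion₂.1 ha
    exact Set.mem_biUnion hγ (Set.mem_biUnion hb (Relation.ReflTransGen.tail ha hc))
  have hTX : ∀ β, ∀ a ∈ T β, a ∈ N → a ∈ G ⊔ closure (Xs ∩ T β) := by
    intro β a ha haN
    refine sup_le_sup_left (BooleanSubalgebra.closure_mono fun c hc => ?_) G (hfX' a haN)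
    exact ⟨hfX a hc, hT β a ha c (Finset.mem_union_left _ hc)⟩
  have hPN : sub e (Λ.lexLT μ ∪ Λ.above μ) ≤ N := by
    rw [← hYs]; exact le_sup_right.trans le_sup_left
  have hstage : ∀ β γ : Iio (Λ.lam μ).ord, γ < β →
      stageBase Λ D.h x e μ γ ⊆ (G ⊔ closure (Xs ∩ T β) : BooleanSubalgebra A) := by
    intro β γ hγ a ha
    refine hTX β a ?_ (hPN (stageBase_subset D.h ha))
    exact Set.mem_biUnion hγ (Set.mem_biUnion ha Relation.ReflTransGen.refl)
  refine ⟨C, hC, T, fun β β' h => Set.biUnion_subset_biUnion_left (Set.Iio_subset_Iio h),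
    fun β hβ => ⟨?_, hstage β⟩⟩
  apply le_antisymm
  · refine sup_le (le_sup_left.trans le_sup_left) (closure_le.2 ?_)
    rintro a ⟨haX, haT⟩
    obtain ⟨γ, hγ, haR⟩ := Set.mem_iUnion₂.1 haT
    have hrk : rk a < β := (hCβ β hβ).2.2 γ hγ ⟨a, haR⟩
    refine sup_le_sup (sup_le_sup_left (sub_mono (region_mono hrk.le)) _)
      (BooleanSubalgebra.closure_mono fun c hc => ?_) (hfY' a (hXN haX))
    exact ⟨hfY a hc, hT β a haT c (Finset.mem_union_right _ hc)⟩
  · refine sup_le (sup_le le_sup_left (sub_le ?_)) (closure_le.2 ?_)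
    · rintro η (hη | ⟨γ, hγ, hη⟩) b
      · exact le_sup_left (a := G) (hG (emb_mem_sub hη b))
      · exact hstage β ⟨γ, hγ.trans β.2⟩ hγ (Or.inl (Set.mem_biUnion hη ⟨b, rfl⟩))
    · rintro a ⟨haY, haT⟩
      exact hTX β a haT (hYN haY)

/-- Induction from the final nodes. Assuming freeness of N over G, truncating its basis at suitable
β < β' gives a free extension G' ≤ N', and G', N' satisfy all hypotheses at μ⌢(β), contradicting the
induction hypothesis. -/
theorem IsGluing.not_freeOver (hA : IsGluing D.h x e) (hs : ∀ η, range (x η) = s η)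
    (hp : ∀ η k, x η '' D.block k = p η k) (hr : Λ.StrongReshuffling s p)
    (hbased : ∀ η, s η ⊆ Λ.Bbar η.1) :
    ∀ μ ∈ Λ.S, ∀ G N : BooleanSubalgebra A, sub e (Λ.lexLT μ) ≤ G →
      FreeOver (G ⊔ sub e (Λ.lexLT μ ∪ Λ.above μ)) N →
      Amalgam (sub e (Λ.lexLT μ)) G (sub e (Λ.lexLT μ ∪ Λ.above μ)) →
      (∀ η ∈ Λ.above μ, ∀ m, x η m ∈ Λ.Bbar μ → e η (D.h m) ∈ G) → ¬ FreeOver G N := by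
  refine tree_induction fun μ hμS ih G N hG hN ham hB => ?_
  by_cases hμ : IsFinalNode Λ.S μ
  · exact hA.not_freeOver_of_final (fun η => (hs η).le.trans (hbased η)) ⟨μ, hμ⟩
      (le_sup_right.trans hN.1) ham (hB ⟨μ, hμ⟩ List.prefix_rfl)
  intro hfree
  have hreg := Λ.lam_regular μ hμS
  have hunc := aleph0_lt_lam hμS hμ
  have hlim := isSuccLimit_ord hreg.aleph0_le
  obtain ⟨Xs, hXi, hXs⟩ := freeOver_iff.1 hfree
  obtain ⟨Ys, hYi, hYs⟩ := freeOver_iff.1 hN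
  obtain ⟨C, hC, T, hT, hCT⟩ := hA.exists_club_stages hμS hμ hG hXs hYs
  have hstat := Λ.stationary μ hμS hμ
  choose g hgE hg using fun γ => hstat.exists_gt hreg hunc γ
  -- Closure under g, which picks larger members of E_μ, makes β a limit point of E_μ, so that the
  -- sets B are continuous at β.
  obtain ⟨β, hβE, hβC, hβg⟩ := hstat (hC.inter (cof_Iio_ne_aleph0 hreg hunc)
    (isClub_closedUnder hreg hunc g))
  obtain ⟨β', hβ'C, hβ'⟩ := hC.isCofinal ⟨Order.succ β.1, hlim.succ_lt β.2⟩
  have hββ' : β < β' := (Order.lt_succ β.1).trans_le hβ'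
  have hR : ∀ δ : Ordinal.{u}, δ < (Λ.lam μ).ord →
      sub e (Λ.region μ δ) ≤ sub e (Λ.lexLT μ ∪ Λ.above μ) := fun δ hδ => sub_mono (by
    rw [union_above_eq hμS hμ]
    exact Set.subset_iUnion (fun β : Iio (Λ.lam μ).ord => Λ.region μ β) ⟨δ, hδ⟩)
  have hlex : ∀ δ, sub e (Λ.lexLT μ) ≤ sub e (Λ.region μ δ) := fun δ =>
    sub_mono Set.subset_union_left
  have hsucc : Order.succ β.1 < (Λ.lam μ).ord := hlim.succ_lt β.2
  have hYsub : ∀ δ, Ys ∩ T δ ⊆ Ys := fun _ => Set.inter_subset_left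
  have hunion : Λ.lexLT (μ ++ [β.1]) ∪ Λ.above (μ ++ [β.1]) = Λ.region μ (Order.succ β.1) := by
    rw [lexLT_append hμ, region_succ]
  have hle : sub e (Λ.region μ β) ≤ sub e (Λ.region μ (Order.succ β.1)) :=
    sub_mono (region_mono (Order.le_succ _))
  refine ih β hβE (G ⊔ closure (Xs ∩ T β)) (G ⊔ closure (Xs ∩ T β')) ?_ ?_ ?_ ?_
    (FreeOver.sup_closure_subset (hXi.mono Set.inter_subset_left)
      (Set.inter_subset_inter_right _ (hT hββ'.le)))
  · rw [lexLT_append hμ, (hCT β hβC).1]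
    exact le_sup_right.trans le_sup_left
  · rw [hunion, (hCT β hβC).1, (hCT β' hβ'C).1]
    -- Reshuffling gives this without G; amalgamation adds G to both sides. The truncated bases `Ys
    -- ∩ T` are then adjoined by `FreeOver.sup_closure`.
    have h1 : FreeOver (G ⊔ sub e (Λ.region μ (Order.succ β.1))) (G ⊔ sub e (Λ.region μ β')) := by
      have h2 := (hA.freeOver_region hs hp hr hμS hμ hββ' β'.2).amalgam
        ((ham.sup_base (hlex _) (hR _ hsucc)).mono_right (hR _ β'.2)) le_sup_right
      have h3 : sub e (Λ.region μ (Order.succ β.1)) ≤ sub e (Λ.region μ β') :=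
        sub_mono (region_mono hβ')
      rwa [sup_assoc, sup_eq_right.2 h3] at h2
    have h4 := h1.sup_closure (sup_le_sup_left (hR _ β'.2) G) (hYi.mono (hYsub β'))
      (Set.inter_subset_inter_right Ys (hT hββ'.le))
    have h5 : G ⊔ sub e (Λ.region μ β) ⊔ closure (Ys ∩ T β) ⊔
        sub e (Λ.region μ (Order.succ β.1)) =
        G ⊔ sub e (Λ.region μ (Order.succ β.1)) ⊔ closure (Ys ∩ T β) := by
      rw [sup_right_comm, sup_assoc G, sup_eq_right.2 hle]
    rwa [h5]
  -- Written with `Ys`, the new G' is G with part of the tree and a set independent over everything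
  -- above μ, so it still amalgamates freely with the next slice.
  · rw [hunion, lexLT_append hμ, (hCT β hβC).1]
    refine (Amalgam.sup_closure (ham.sup_base (hlex _) (hR _ β.2)) ?_).mono_right (hR _ hsucc)
    refine (hYi.mono (hYsub β)).mono_left (sup_le (sup_le_sup_left (hR _ β.2) _) le_sup_right)
  · intro η hη m hm
    have hημ : η ∈ Λ.above μ := (List.prefix_append _ _).trans hη
    obtain ⟨ν, hν, hmν⟩ := Set.mem_iUnion₂.1 hm
    rcases List.prefix_concat_iff.1 hν with rfl | hν
    -- By continuity an index in the new set B already lies in one for some δ < β, and its generator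
    -- was absorbed through `stageBase`.
    · have hlimE : IsLimitPoint {δ | μ ++ [δ] ∈ Λ.S} β.1 := by
        obtain ⟨δ, hδ⟩ := hβg.1
        refine ⟨fun h0 => ?_, fun γ hγ => ?_⟩
        · have : δ.1 < β.1 := hδ
          rw [h0] at this
          exact not_lt_bot this
        · exact ⟨(g ⟨γ, hγ.trans β.2⟩).1, hgE _, hg ⟨γ, hγ.trans β.2⟩, hβg.2 _ hγ⟩
      rw [Λ.B_continuous μ hμS β hβE hlimE] at hmν
      obtain ⟨δ, ⟨hδS, hδ⟩, hmδ⟩ := Set.mem_iUnion₂.1 hmν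
      refine (hCT β hβC).2 ⟨δ, hδ.trans β.2⟩ hδ (Or.inr ?_)
      exact Set.mem_biUnion (x := x η m) ⟨hδS, hmδ⟩ ⟨η, hημ, m, rfl, rfl⟩
    · exact le_sup_left (a := G) (hB η hημ m (Set.mem_biUnion hν hmν))

end NonFree

end OpenGen

/-! ### Filtrations and the invariant Γ -/

namespace OpenGen

open BooleanSubalgebra LambdaSystem

section Filtrations

variable {A : Type v} [BooleanAlgebra A] {κ : Cardinal.{u}}

/-- Two filtrations of an algebra agree on a club of limit points. -/
theorem IsKappaFiltration.exists_club_eq (hκ : κ.IsRegular) (hunc : ℵ₀ < κ)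
    {F F' : Iio κ.ord → BooleanSubalgebra A} (hF : IsKappaFiltration κ F)
    (hF' : IsKappaFiltration κ F') :
    ∃ C : Set (Iio κ.ord), IsClub C ∧ ∀ β ∈ C, F β = F' β := by
  choose r hr using hF.union
  -- On a club of limit points, every element entering one filtration before β has rank below β in
  -- the other.
  choose r' hr' using hF'.union
  obtain ⟨C, hC, h⟩ := exists_club_closedUnder hκ hunc hF.card_lt fun _ a => r' a.1
  obtain ⟨C', hC', h'⟩ := exists_club_closedUnder hκ hunc hF'.card_lt fun _ a => r a.1
  refine ⟨C ∩ C', hC.inter (cof_Iio_ne_aleph0 hκ hunc) hC', fun β hβ => ?_⟩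
  have hlim : Order.IsSuccLimit β := by
    obtain ⟨⟨γ, hγ⟩, hδ, -⟩ := h β hβ.1
    refine ⟨not_isMin_of_lt hγ, fun γ hγ => ?_⟩
    obtain ⟨δ, h1, h2⟩ := hδ γ hγ.lt
    exact hγ.2 h1 h2
  apply le_antisymm
  · intro a ha
    obtain ⟨γ, hγ, ha⟩ := hF.continuous β hlim a ha
    exact hF'.mono ((h β hβ.1).2.2 γ hγ ⟨a, ha⟩).le (hr' a)
  · intro a ha
    obtain ⟨γ, hγ, ha⟩ := hF'.continuous β hlim a ha
    exact hF.mono ((h' β hβ.2).2.2 γ hγ ⟨a, ha⟩).le (hr a)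

/-- If `nonFreeSet F` agrees with `E` modulo clubs for all filtrations `F`, then `Γ(A)` is the
class of `E`. -/
theorem gamma_eq_clubClass (hκ : κ.IsRegular) (hunc : ℵ₀ < κ)
    {F : Iio κ.ord → BooleanSubalgebra A} (hF : IsKappaFiltration κ F) {E : Set (Iio κ.ord)}
    (hE : ∀ F : Iio κ.ord → BooleanSubalgebra A, IsKappaFiltration κ F →
      ∃ C : Set (Iio κ.ord), IsClub C ∧ nonFreeSet F ∩ C = E ∩ C) :
    Gamma A κ = clubClass E := by
  have key : ∀ {Y Z W : Set (Iio κ.ord)}, (∃ C : Set (Iio κ.ord), IsClub C ∧ Y ∩ C = Z ∩ C) →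
      (∃ C : Set (Iio κ.ord), IsClub C ∧ Z ∩ C = W ∩ C) →
      ∃ C : Set (Iio κ.ord), IsClub C ∧ Y ∩ C = W ∩ C := by
    rintro Y Z W ⟨C, hC, h⟩ ⟨C', hC', h'⟩
    refine ⟨C ∩ C', hC.inter (cof_Iio_ne_aleph0 hκ hunc) hC', ?_⟩
    rw [← Set.inter_assoc, h, Set.inter_right_comm, h', Set.inter_right_comm, Set.inter_assoc]
  ext Y
  constructor
  · rintro ⟨F, hF, hY⟩
    exact key hY (hE F hF)
  · intro hY
    obtain ⟨C, hC, h⟩ := hE F hF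
    exact ⟨F, hF, key hY ⟨C, hC, h.symm⟩⟩

end Filtrations

/-! ### The canonical filtration: size, freeness and Γ -/

section Root

variable {κ : Cardinal.{u}} {X : Type u} {Λ : LambdaSystem κ X} {n : ℕ} {L : Type w}
  [BooleanAlgebra L] {D : CPPlus n L} {x : Λ.FinalNode → ℕ → X} {A : Type v} [BooleanAlgebra A]
  {e : Λ.FinalNode → BoundedLatticeHom L A} {s : Λ.FinalNode → Set X}
  {p : Λ.FinalNode → Fin n → Set X}

namespace LambdaSystem

theorem above_nil : Λ.above [] = Set.univ := Set.eq_univ_of_forall fun _ => List.nil_prefix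

theorem isRegular (Λ : LambdaSystem κ X) : κ.IsRegular := Λ.lam_root ▸ Λ.lam_regular [] Λ.root_mem

theorem aleph0_lt (hroot : ¬ IsFinalNode Λ.S []) : ℵ₀ < κ :=
  Λ.lam_root ▸ aleph0_lt_lam Λ.root_mem hroot

theorem isStationary_rootSet (hroot : ¬ IsFinalNode Λ.S []) : IsStationary Λ.rootSet := by
  have key : ∀ θ : Cardinal.{u}, θ = κ → IsStationary {β : Iio θ.ord | [β.1] ∈ Λ.S} →
      IsStationary {β : Iio κ.ord | [β.1] ∈ Λ.S} := by
    rintro _ rfl h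
    exact h
  exact key _ Λ.lam_root (Λ.stationary [] Λ.root_mem hroot)

theorem region_nil (β : Ordinal.{u}) : Λ.region [] β = Λ.slice [] β := by
  rw [region, lexLT_nil, Set.empty_union]

end LambdaSystem

/-- The canonical filtration of an algebra glued along a `λ`-system. -/
def stage (e : Λ.FinalNode → BoundedLatticeHom L A) (α : Iio κ.ord) : BooleanSubalgebra A :=
  sub e (Λ.region [] α)

theorem exists_mem_stage (hA : IsGluing D.h x e) (hroot : ¬ IsFinalNode Λ.S []) (a : A) :
    ∃ α, a ∈ stage e α := by
  have hne : Nonempty (Iio (Λ.lam []).ord) := ⟨⟨0, (Λ.lam_regular [] Λ.root_mem).ord_pos⟩⟩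
  have ha : a ∈ sub e (⋃ β : Iio (Λ.lam []).ord, Λ.region [] β) := by
    rw [← union_above_eq Λ.root_mem hroot, above_nil, Set.union_univ, hA.sub_univ]
    exact mem_top
  obtain ⟨β, hβ⟩ := exists_mem_sub_of_directed
    (U := fun β : Iio (Λ.lam []).ord => Λ.region [] β) (fun _ _ h => region_mono h) ha
  have hβκ : β.1 < κ.ord := lt_of_lt_of_eq (Set.mem_Iio.1 β.2) (congrArg ord Λ.lam_root)
  exact ⟨⟨β.1, hβκ⟩, hβ⟩

theorem isKappaFiltration_stage (hA : IsGluing D.h x e) (hroot : ¬ IsFinalNode Λ.S []) :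
    IsKappaFiltration κ (stage e) where
  union := exists_mem_stage hA hroot
  mono _ _ h := sub_mono (region_mono h)
  continuous β hβ a ha := by
    have hne : Nonempty (Iio β) := by
      obtain ⟨γ, hγ⟩ := not_isMin_iff.1 hβ.1
      exact ⟨⟨γ, hγ⟩⟩
    have hsub : Λ.region [] β ⊆ ⋃ γ : Iio β, Λ.region [] γ.1.1 := by
      rintro η hη
      rw [region_nil] at hη
      obtain ⟨γ, hγ, hη⟩ := hη
      have hγβ : (⟨γ, hγ.trans β.2⟩ : Iio κ.ord) < β := hγ
      obtain ⟨δ, h1, h2⟩ : ∃ δ, (⟨γ, hγ.trans β.2⟩ : Iio κ.ord) < δ ∧ δ < β := by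
        by_contra! h
        exact hβ.2 _ ⟨hγβ, fun c h1 h2 => (h c h1).not_gt h2⟩
      exact Set.mem_iUnion.2 ⟨⟨δ, h2⟩, Or.inr ⟨γ, h1, hη⟩⟩
    obtain ⟨γ, hγ⟩ := exists_mem_sub_of_directed (U := fun γ : Iio β => Λ.region [] γ.1.1)
      (fun _ _ h => region_mono h) (sub_mono hsub ha)
    exact ⟨γ.1, γ.2, hγ⟩
  card_lt α := by
    have hunc := aleph0_lt hroot
    have := D.countable
    refine (Cardinal.lift_le.2 (mk_closure_le _)).trans_lt ?_
    rw [Cardinal.lift_max]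
    refine max_lt (lift_mk_biUnion_lt Λ.isRegular ?_ fun η _ => ?_) (by simpa using hunc)
    · rw [Cardinal.lift_id'.{u, u + 1}, region_nil]
      have := mk_slice_lt Λ.root_mem (β := α.1) (by rw [Λ.lam_root]; exact α.2)
      rwa [Λ.lam_root] at this
    · have := (Set.countable_range (e η)).to_subtype
      exact lift_lt_of_countable hunc

theorem isFree_stage (hA : IsGluing D.h x e) (hs : ∀ η, range (x η) = s η)
    (hp : ∀ η k, x η '' D.block k = p η k) (hr : Λ.StrongReshuffling s p)
    (hroot : ¬ IsFinalNode Λ.S []) (α : Iio κ.ord) : IsFree (stage e α) := by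
  obtain ⟨η, -⟩ := above_nonempty [] Λ.root_mem
  have : Nonempty Λ.FinalNode := ⟨η⟩
  have := hA.nontrivial
  have h := hA.freeOver_lexLT hs hp hr Λ.root_mem hroot (I := Λ.slice [] α) slice_subset_above
    (mk_slice_lt Λ.root_mem (by rw [Λ.lam_root]; exact α.2))
  have hbot : sub e (Λ.lexLT []) = ⊥ := by rw [lexLT_nil, sub_empty]
  rw [hbot] at h
  exact h.isFree

theorem freeOver_stage (hA : IsGluing D.h x e) (hs : ∀ η, range (x η) = s η)
    (hp : ∀ η k, x η '' D.block k = p η k) (hr : Λ.StrongReshuffling s p)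
    (hroot : ¬ IsFinalNode Λ.S []) {α β : Iio κ.ord} (h : α < β) :
    FreeOver (sub e (Λ.region [] (Order.succ α.1))) (stage e β) :=
  hA.freeOver_region hs hp hr Λ.root_mem hroot h (by rw [Λ.lam_root]; exact β.2)

theorem CPPlus.exists_notMem_closure (D : CPPlus n L) : ∃ b, b ∉ closure (range D.h) := by
  by_contra! h
  exact D.not_isRelComplete fun b => ⟨b, ⟨h b, le_rfl⟩, fun c hc => hc.2⟩

/-- Otherwise interpolation between the image of b and itself would place b in H. Thus a fixed
element outside H recognises the copies generating a subalgebra. -/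
theorem IsGluing.mem_of_emb_mem_sub (hA : IsGluing D.h x e) {b : L}
    (hb : b ∉ closure (range D.h)) {J : Set Λ.FinalNode} {η : Λ.FinalNode}
    (h : e η b ∈ sub e J) : η ∈ J := by
  by_contra hη
  obtain ⟨_, ⟨c, hc, rfl⟩, h1, h2⟩ :=
    (hA.amalgam_singleton hη).interpolant h (emb_mem_sub_self η b) le_rfl
  refine hb ?_
  rw [hA.emb_injective η (h1.antisymm h2)]
  exact BooleanSubalgebra.closure_mono (Set.image_subset_range _ _) hc

theorem IsGluing.lift_mk_eq (hA : IsGluing D.h x e) (hroot : ¬ IsFinalNode Λ.S []) :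
    Cardinal.lift.{u} #A = Cardinal.lift.{v} κ := by
  have hunc := aleph0_lt hroot
  have := D.countable
  apply le_antisymm
  · have hX : ⋃ η, range (e η) = range fun q : Λ.FinalNode × L => e q.1 q.2 := by
      ext a; simp
    have h1 : #A ≤ max #(range fun q : Λ.FinalNode × L => e q.1 q.2) ℵ₀ := by
      rw [← hX]
      refine le_trans ?_ (mk_closure_le (⋃ η, range (e η)))
      rw [hA.generates]
      exact (Cardinal.mk_univ (α := A)).ge
    have h2 : #Λ.FinalNode ≤ Cardinal.lift.{u + 1} κ := by
      have := mk_above_le (Λ := Λ) [] Λ.root_mem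
      rwa [above_nil, Cardinal.mk_univ, Λ.lam_root] at this
    have h3 : Cardinal.lift.{max (u + 1) w} #(range fun q : Λ.FinalNode × L => e q.1 q.2) ≤
        Cardinal.lift.{v} (Cardinal.lift.{max (u + 1) w} κ) := by
      refine mk_range_le_lift.trans (Cardinal.lift_le.2 ?_)
      rw [Cardinal.mk_prod]
      calc _ ≤ Cardinal.lift.{max (u + 1) w} κ * Cardinal.lift.{max (u + 1) w} κ := by
            refine mul_le_mul' ?_ ?_
            · have := Cardinal.lift_le.{w}.2 h2
              simpa using this
            · have : Cardinal.lift.{u + 1} #L ≤ ℵ₀ := by simp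
              exact this.trans (by simpa using hunc.le)
        _ = _ := mul_eq_self (by simpa using hunc.le)
    have h4 : Cardinal.lift.{max (u + 1) w} #A ≤
        Cardinal.lift.{v} (Cardinal.lift.{max (u + 1) w} κ) := by
      refine (Cardinal.lift_le.2 h1).trans ?_
      rw [Cardinal.lift_max]
      exact max_le h3 (by simpa using hunc.le)
    rw [← Cardinal.lift_le.{max (u + 1) w}]
    simpa using h4
  · by_contra! hlt
    obtain ⟨b, hb⟩ := D.exists_notMem_closure
    -- Copies of one element b outside H at final nodes above different β are distinct, so a small
    -- algebra would force E_∅ to be bounded.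
    choose η hη using fun β : Λ.rootSet => above_nonempty (Λ := Λ) [β.1.1] β.2
    have hinj : Function.Injective fun β => e (η β) b := by
      intro β γ (h : e (η β) b = e (η γ) b)
      have hmem : e (η β) b ∈ sub e {η γ} := h ▸ emb_mem_sub_self (η γ) b
      have heq : η β = η γ := hA.mem_of_emb_mem_sub (J := {η γ}) hb hmem
      have h1 : [β.1.1] <+: (η γ).1 := heq ▸ hη β
      have h2 : [β.1.1] = [γ.1.1] :=
        (List.prefix_of_prefix_length_le h1 (hη γ) le_rfl).eq_of_length rfl
      exact Subtype.ext (Subtype.ext (List.singleton_injective h2))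
    have hE := lift_mk_lt_of_injective _ hinj hlt
    obtain ⟨c, hc⟩ := exists_bound Λ.isRegular hE Subtype.val
    obtain ⟨β, hβ, hcβ⟩ := (isStationary_rootSet hroot).exists_gt Λ.isRegular hunc c
    exact (hc ⟨β, hβ⟩).not_gt hcβ

theorem exists_club_glued_mem (hA : IsGluing D.h x e) (hroot : ¬ IsFinalNode Λ.S []) :
    ∃ C : Set (Iio κ.ord), IsClub C ∧ ∀ α ∈ C, ∀ γ < α, [γ.1] ∈ Λ.S → ∀ η m,
      x η m ∈ Λ.B [γ.1] → e η (D.h m) ∈ stage e α := by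
  have hunc := aleph0_lt hroot
  have h : ∀ z, ∃ α : Iio κ.ord, ∀ η m, x η m = z → e η (D.h m) ∈ stage e α := by
    intro z
    by_cases hz : ∃ ν l, x ν l = z
    · obtain ⟨ν, l, rfl⟩ := hz
      obtain ⟨α, hα⟩ := exists_mem_stage hA hroot (e ν (D.h l))
      exact ⟨α, fun η m hm => hA.glue hm ▸ hα⟩
    · exact ⟨⟨0, Λ.isRegular.ord_pos⟩, fun η m hm => absurd ⟨η, m, hm⟩ hz⟩
  choose rk hrk using h
  have hcard : ∀ γ : Iio κ.ord, Cardinal.lift.{u} #{z | [γ.1] ∈ Λ.S ∧ z ∈ Λ.B [γ.1]} <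
      Cardinal.lift.{u} κ := by
    intro γ
    rw [Cardinal.lift_lt]
    by_cases h : [γ.1] ∈ Λ.S
    · have := (Λ.B_card [] Λ.root_mem γ.1 h).2
      rw [Λ.lam_root] at this
      exact (mk_le_mk_of_subset fun z hz => hz.2).trans_lt this
    · simpa [h] using Λ.isRegular.pos
  obtain ⟨C, hC, h⟩ := exists_club_closedUnder Λ.isRegular hunc hcard fun _ z => rk z.1
  exact ⟨C, hC, fun α hα γ hγ hγS η m hm =>
    sub_mono (region_mono ((h α hα).2.2 γ hγ ⟨_, hγS, hm⟩).le) (hrk _ η m rfl)⟩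

/-- On a club F agrees with the canonical filtration. Outside E_∅, stages α and α+1 coincide, so
later stages on the club are free over stage α. At α in E_∅, `not_freeOver` with G equal to stage α
applies to every later stage; the other two clubs provide the generators with index in B_(α). -/
theorem nonFreeSet_inter (hA : IsGluing D.h x e) (hs : ∀ η, range (x η) = s η)
    (hp : ∀ η k, x η '' D.block k = p η k) (hr : Λ.StrongReshuffling s p)
    (hbased : ∀ η, s η ⊆ Λ.Bbar η.1) (hroot : ¬ IsFinalNode Λ.S [])
    {F : Iio κ.ord → BooleanSubalgebra A} (hF : IsKappaFiltration κ F) :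
    ∃ C : Set (Iio κ.ord), IsClub C ∧ nonFreeSet F ∩ C = Λ.rootSet ∩ C := by
  have hreg := Λ.isRegular
  have hunc := aleph0_lt hroot
  have hcof := cof_Iio_ne_aleph0 hreg hunc
  have hstat := isStationary_rootSet hroot
  choose g hgE hg using fun γ => hstat.exists_gt hreg hunc γ
  obtain ⟨C₁, hC₁, h₁⟩ := hF.exists_club_eq hreg hunc (isKappaFiltration_stage hA hroot)
  obtain ⟨C₂, hC₂, h₂⟩ := exists_club_glued_mem hA hroot
  have hC₃ := isClub_closedUnder hreg hunc g
  have hgt : ∀ (t : Set (Iio κ.ord)), IsClub t → ∀ α, ∃ β ∈ t, α < β := by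
    intro t ht α
    have hlim := isSuccLimit_ord hreg.aleph0_le
    obtain ⟨β, hβ, h⟩ := ht.isCofinal ⟨Order.succ α.1, hlim.succ_lt α.2⟩
    exact ⟨β, hβ, (Order.lt_succ α.1).trans_le h⟩
  refine ⟨_, hC₁.inter hcof (hC₂.inter hcof hC₃), Set.ext fun α => and_congr_left ?_⟩
  rintro ⟨hα₁, hα₂, hα₃⟩
  constructor
  · intro hα
    by_contra hαE
    obtain ⟨β, ⟨hαβ, hβ⟩, hβC⟩ := hα hC₁
    rw [h₁ α hα₁, h₁ β hβC] at hβ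
    refine hβ ?_
    have h := freeOver_stage hA hs hp hr hroot hαβ
    rwa [region_succ_of_notMem hαE] at h
  · intro hαE t ht
    obtain ⟨β, ⟨hβt, hβC⟩, hαβ⟩ := hgt _ (ht.inter hcof hC₁) α
    refine ⟨β, ⟨hαβ, ?_⟩, hβt⟩
    rw [h₁ α hα₁, h₁ β hβC]
    have hG : sub e (Λ.lexLT [α.1]) = stage e α := by
      rw [← List.nil_append [α.1], lexLT_append hroot]; rfl
    have hN : sub e (Λ.lexLT [α.1] ∪ Λ.above [α.1]) = sub e (Λ.region [] (Order.succ α.1)) := by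
      rw [region_succ, ← lexLT_append hroot]; rfl
    refine hA.not_freeOver hs hp hr hbased [α.1] hαE (stage e α) (stage e β) hG.le ?_ ?_ ?_
    · have hle : stage e α ≤ sub e (Λ.region [] (Order.succ α.1)) :=
        sub_mono (region_mono (Order.le_succ _))
      rw [hN, sup_eq_right.2 hle]
      exact freeOver_stage hA hs hp hr hroot hαβ
    · rw [← hG]
      exact amalgam_self _
    · intro η _ m hm
      obtain ⟨ν, hν, hmν⟩ := Set.mem_iUnion₂.1 hm
      rw [Set.mem_ofPred_eq, ← List.nil_append [α.1], List.prefix_concat_iff] at hν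
      rcases hν with rfl | hν
      · have hlimE : IsLimitPoint {δ | [] ++ [δ] ∈ Λ.S} α.1 := by
          obtain ⟨δ, hδ⟩ := hα₃.1
          refine ⟨fun h0 => ?_, fun γ hγ => ?_⟩
          · have : δ.1 < α.1 := hδ
            rw [h0] at this
            exact not_lt_bot this
          · exact ⟨(g ⟨γ, hγ.trans α.2⟩).1, hgE _, hg ⟨γ, hγ.trans α.2⟩, hα₃.2 _ hγ⟩
        rw [Λ.B_continuous [] Λ.root_mem α hαE hlimE] at hmν
        obtain ⟨δ, ⟨hδS, hδ⟩, hmδ⟩ := Set.mem_iUnion₂.1 hmν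
        exact h₂ α hα₂ ⟨δ, hδ.trans α.2⟩ hδ hδS η m hmδ
      · rw [List.prefix_nil.1 hν, Λ.B_root] at hmν
        exact absurd hmν (Set.notMem_empty _)

end Root

end OpenGen

/-! ### Open generation -/

namespace OpenGen

open BooleanSubalgebra LambdaSystem

theorem isGreatest_of_isGreatest {A : Type*} [BooleanAlgebra A] {B C : BooleanSubalgebra A}
    (hBC : B ≤ C) {a b c : A} (hb : IsGreatest {d | d ∈ C ∧ d ≤ a} b)
    (hc : IsGreatest {d | d ∈ B ∧ d ≤ b} c) : IsGreatest {d | d ∈ B ∧ d ≤ a} c :=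
  ⟨⟨hc.1.1, hc.1.2.trans hb.1.2⟩, fun _ hd => hc.2 ⟨hd.1, hb.2 ⟨hBC hd.1, hd.2⟩⟩⟩

theorem exists_countable_closed {I : Type*} {d : I → I → Set I} (hd : ∀ i j, (d i j).Countable)
    {J : Set I} (hJ : J.Countable) :
    ∃ K, J ⊆ K ∧ K.Countable ∧ ∀ i ∈ K, ∀ j ∈ K, d i j ⊆ K := by
  let S : ℕ → Set I := fun n => Nat.rec J (fun _ T => T ∪ ⋃ i ∈ T, ⋃ j ∈ T, d i j) n
  have hS : ∀ n, (S n).Countable := by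
    intro n
    induction n with
    | zero => exact hJ
    | succ n ih => exact ih.union (ih.biUnion fun i _ => ih.biUnion fun j _ => hd i j)
  have hmono : Monotone S := monotone_nat_of_le_succ fun n => Set.subset_union_left
  refine ⟨⋃ n, S n, Set.subset_iUnion S 0, Set.countable_iUnion hS, fun i hi j hj => ?_⟩
  obtain ⟨k, hk⟩ := Set.mem_iUnion.1 hi
  obtain ⟨l, hl⟩ := Set.mem_iUnion.1 hj
  refine subset_trans (fun y hy => ?_) (Set.subset_iUnion S (max k l + 1))
  exact Or.inr (Set.mem_biUnion (hmono (le_max_left _ _) hk)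
    (Set.mem_biUnion (hmono (le_max_right _ _) hl) hy))

/-- A well-order of `K` can be changed so that a given subset becomes an initial segment. -/
theorem exists_isWellOrder_initial {K : Type*} (r : K → K → Prop) [IsWellOrder K r] (J : Set K) :
    ∃ r' : K → K → Prop, IsWellOrder K r' ∧ (∀ a b, r' a b → b ∈ J → a ∈ J) ∧
      ∀ a b, r' a b → r a b ∨ b ∉ J ∧ a ∈ J := by
  classical
  -- Members of J receive `false` and hence come first in the lexicographic order.
  let f : K → Bool × K := fun a => (decide (a ∉ J), a)
  have hf : Function.Injective f := fun a b hab => (Prod.ext_iff.1 hab).2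
  let E : (f ⁻¹'o Prod.Lex (· < ·) r) ↪r Prod.Lex ((· < ·) : Bool → Bool → Prop) r :=
    RelEmbedding.preimage ⟨f, hf⟩ _
  refine ⟨f ⁻¹'o Prod.Lex (· < ·) r, E.isWellOrder, fun a b hab hb => ?_, fun a b hab => ?_⟩
  · rcases Prod.lex_def.1 hab with h | ⟨h, -⟩
    · simp [f, hb, Bool.lt_iff] at h
    · simpa [f, hb] using h
  · rcases Prod.lex_def.1 hab with h | ⟨-, h⟩
    · have : a ∈ J ∧ b ∉ J := by simpa [f, Bool.lt_iff] using h
      exact Or.inr this.symm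
    · exact Or.inl h

section Open

variable {κ : Cardinal.{u}} {X : Type u} {Λ : LambdaSystem κ X} {n : ℕ} {L : Type w}
  [BooleanAlgebra L] {D : CPPlus n L} {x : Λ.FinalNode → ℕ → X} {A : Type v} [BooleanAlgebra A]
  {e : Λ.FinalNode → BoundedLatticeHom L A} {s : Λ.FinalNode → Set X}
  {p : Λ.FinalNode → Fin n → Set X}

theorem LambdaSystem.StrongReshuffling.exists_isWellOrder (hr : Λ.StrongReshuffling s p)
    {W : Set Λ.FinalNode} (hW : #W < Cardinal.lift.{u + 1} κ) :
    ∃ r : W → W → Prop, IsWellOrder W r ∧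
      ∀ η : W, ∃ k, (p η k ∩ ⋃ ν ∈ {ν : W | r ν η}, s ν).Finite := by
  rcases isEmpty_or_nonempty W with h | ⟨⟨η⟩⟩
  · exact ⟨fun _ _ => False, inferInstance, fun η => h.elim η⟩
  · obtain ⟨r, hwo, -, h⟩ := hr.one W η hW
    exact ⟨r, hwo, h⟩

/-- Moving J to the front gives a node outside J new predecessors only from J, and `hcl` says that
these contribute nothing to s_η beyond its old predecessors. Finiteness is therefore preserved. -/
theorem IsGluing.freeOver_of_wellOrder_of_subset (hA : IsGluing D.h x e)
    (hs : ∀ η, range (x η) = s η) (hp : ∀ η k, x η '' D.block k = p η k)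
    {J W : Set Λ.FinalNode} (hJW : J ⊆ W) (r : W → W → Prop) [IsWellOrder W r]
    (hfin : ∀ η : W, ∃ k, (p η k ∩ ⋃ ν ∈ {ν : W | r ν η}, s ν).Finite)
    (hcl : ∀ η : W, η.1 ∉ J → ∀ ν ∈ J, s η ∩ s ν ⊆ ⋃ ν ∈ {ν : W | r ν η}, s ν) :
    FreeOver (sub e J) (sub e W) := by
  obtain ⟨r', hwo, hinit, hr'⟩ := exists_isWellOrder_initial r (Subtype.val ⁻¹' J)
  refine hA.freeOver_of_wellOrder hs hp hJW r' hinit fun η => ?_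
  obtain ⟨k, hk⟩ := hfin η
  refine ⟨k, hk.subset ?_⟩
  rintro z ⟨hz, hz'⟩
  obtain ⟨ν, hν, hzν⟩ := Set.mem_iUnion₂.1 hz'
  refine ⟨hz, ?_⟩
  rcases hr' ν η hν with h | ⟨h1, h2⟩
  · exact Set.mem_biUnion (show ν ∈ {ν : W | r ν η} from h) hzν
  · refine hcl η h1 ν h2 ⟨?_, hzν⟩
    rw [← hs, ← Set.image_univ]
    rw [← hp] at hz
    exact Set.image_mono (Set.subset_univ _) hz

/-- The members of `W` containing `z` which are minimal with respect to `r`. -/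
def minimalAt (s : Λ.FinalNode → Set X) {W : Set Λ.FinalNode} (r : W → W → Prop) (z : X) :
    Set Λ.FinalNode :=
  {ν | ∃ hν : ν ∈ W, z ∈ s ν ∧ ∀ ν' : W, z ∈ s ν' → ¬ r ν' ⟨ν, hν⟩}

theorem minimalAt_subsingleton {W : Set Λ.FinalNode} (r : W → W → Prop) [IsWellOrder W r] (z : X) :
    (minimalAt s r z).Subsingleton := by
  rintro ν ⟨hν, hz, h⟩ ν' ⟨hν', hz', h'⟩
  rcases trichotomous_of r ⟨ν, hν⟩ ⟨ν', hν'⟩ with h1 | h1 | h1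
  · exact absurd h1 (h' _ hz)
  · exact congrArg Subtype.val h1
  · exact absurd h1 (h _ hz')

theorem minimalAt_nonempty {W : Set Λ.FinalNode} (r : W → W → Prop) [IsWellOrder W r] {z : X}
    {η : W} (hz : z ∈ s η) : (minimalAt s r z).Nonempty := by
  have hwf : WellFounded r := IsWellFounded.wf
  have hne : {ν : W | z ∈ s ν}.Nonempty := ⟨η, hz⟩
  exact ⟨(hwf.min _ hne).1, (hwf.min _ hne).2, hwf.min_mem _ hne,
    fun ν' hν' => hwf.not_lt_min _ hν'⟩

/-- An index shared by a node of I and a node of W also occurs at its r-minimal carrier in W, which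
lies in I. Hence `sub e I` and `sub e W` amalgamate over `sub e (I ∩ W)`. A carrier also precedes
every node of W outside I containing that index, so I ∩ W may be moved to the front. -/
theorem IsGluing.freeOver_union_of_minimalAt_subset (hA : IsGluing D.h x e)
    (hs : ∀ η, range (x η) = s η) (hp : ∀ η k, x η '' D.block k = p η k)
    {I W : Set Λ.FinalNode} (r : W → W → Prop) [IsWellOrder W r]
    (hfin : ∀ η : W, ∃ k, (p η k ∩ ⋃ ν ∈ {ν : W | r ν η}, s ν).Finite)
    (hcl : ∀ ν ∈ I, ∀ z ∈ s ν, minimalAt s r z ⊆ I) :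
    FreeOver (sub e I) (sub e I ⊔ sub e W) := by
  have hIW : sub e (I ∩ W) ≤ sub e I := sub_mono Set.inter_subset_left
  refine FreeOver.amalgam (C := sub e (I ∩ W)) ?_ ?_ hIW
  · refine hA.freeOver_of_wellOrder_of_subset hs hp Set.inter_subset_right r hfin ?_
    rintro η hη ν ⟨hνI, hνW⟩ z ⟨hz, hzν⟩
    obtain ⟨ν', hν'⟩ := minimalAt_nonempty r hz
    have hν'I := hcl ν hνI z hzν hν'
    obtain ⟨hν'W, hzν', hmin⟩ := hν'
    have hlt : r ⟨ν', hν'W⟩ η := by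
      rcases trichotomous_of r ⟨ν', hν'W⟩ η with h | h | h
      · exact h
      · exact absurd (h ▸ (⟨hν'I, hν'W⟩ : ν' ∈ I ∩ W)) hη
      · exact absurd h (hmin η hz)
    exact Set.mem_biUnion (show (⟨ν', hν'W⟩ : W) ∈ {ν : W | r ν η} from hlt) hzν'
  · refine hA.amalgam_sub le_rfl fun i hi j hj m l hml => ?_
    have hzi : x i m ∈ s i := hs i ▸ ⟨m, rfl⟩
    have hzj : x i m ∈ s (⟨j, hj⟩ : W) := hs j ▸ ⟨l, hml.symm⟩
    obtain ⟨ν, hν⟩ := minimalAt_nonempty r hzj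
    have hνI := hcl i hi _ hzi hν
    obtain ⟨hνW, hzν, -⟩ := hν
    rw [← hs] at hzν
    obtain ⟨l', hl'⟩ := hzν
    have hνIW : ν ∈ I ∩ W := ⟨hνI, hνW⟩
    rw [hA.glue hl'.symm]
    exact emb_mem_sub hνIW _

/-- The extension of the `δ`-th stage of the canonical filtration is relatively complete. -/
theorem IsGluing.exists_isGreatest_stage (hA : IsGluing D.h x e) (hs : ∀ η, range (x η) = s η)
    (hp : ∀ η k, x η '' D.block k = p η k) (hr : Λ.StrongReshuffling s p)
    (hroot : ¬ IsFinalNode Λ.S []) (hchild : ∀ β, ¬ IsFinalNode Λ.S [β]) (δ : Iio κ.ord) (b : A) :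
    ∃ a, IsGreatest {c | c ∈ stage e δ ∧ c ≤ b} a := by
  have hreg := Λ.isRegular
  obtain ⟨β, hβ⟩ := exists_mem_stage hA hroot b
  have hδ : Order.succ δ.1 < κ.ord := (isSuccLimit_ord hreg.aleph0_le).succ_lt δ.2
  let δ' : Iio κ.ord := ⟨Order.succ δ.1, hδ⟩
  have hδδ' : δ < δ' := Order.lt_succ δ.1
  have hb : b ∈ stage e (max β δ') := (isKappaFiltration_stage hA hroot).mono (le_max_left _ _) hβ
  obtain ⟨b', hb'⟩ := (freeOver_stage hA hs hp hr hroot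
    (hδδ'.trans_le (le_max_right β δ'))).exists_isGreatest hb
  have hmono : stage e δ ≤ sub e (Λ.region [] (Order.succ δ.1)) :=
    sub_mono (region_mono (Order.le_succ _))
  have hlex : Λ.lexLT [δ.1] = Λ.region [] δ := by
    rw [← List.nil_append [δ.1], lexLT_append hroot]
  by_cases hδS : [δ.1] ∈ Λ.S
  -- The stage at δ+1 need not be free over the stage at δ, but each of its elements uses only
  -- finitely many copies above (δ). As (δ) is not final, reshuffling there makes this finite part
  -- free over stage δ.
  · obtain ⟨F, hF, hFsub, hbF⟩ := exists_finset_mem_sub hb'.1.1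
    rw [region_succ] at hFsub
    have hbF' : b' ∈ sub e (Λ.lexLT [δ.1] ∪ F ∩ Λ.above [δ.1]) := by
      refine sub_mono (fun η hη => ?_) hbF
      rcases hFsub hη with h | h
      · exact Or.inl (hlex ▸ h)
      · exact Or.inr ⟨hη, h⟩
    have hcard : #(F ∩ Λ.above [δ.1] : Set Λ.FinalNode) < Cardinal.lift.{u + 1} (Λ.lam [δ.1]) := by
      have hlt := Cardinal.lt_aleph0_iff_set_finite.2 (hF.inter_of_left (Λ.above [δ.1]))
      exact hlt.trans_le (by simpa using (Λ.lam_regular _ hδS).aleph0_le)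
    have hfree := hA.freeOver_lexLT hs hp hr hδS (hchild δ.1) Set.inter_subset_right hcard
    obtain ⟨a, ha⟩ := hfree.exists_isGreatest hbF'
    rw [hlex] at ha
    exact ⟨a, isGreatest_of_isGreatest hmono hb' ha⟩
  · rw [region_succ_of_notMem hδS] at hb'
    exact ⟨b', hb'⟩

/-- For each α a reshuffling order of the nodes with first entry at most α is fixed. Two nodes η, ν
in I call for the minimal carriers of the indices in s_ν, in the order belonging to the first entry
of η; these are countably many. -/
theorem IsGluing.exists_closing (hA : IsGluing D.h x e) (hs : ∀ η, range (x η) = s η)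
    (hp : ∀ η k, x η '' D.block k = p η k) (hr : Λ.StrongReshuffling s p)
    (hroot : ¬ IsFinalNode Λ.S []) (hchild : ∀ β, ¬ IsFinalNode Λ.S [β]) :
    ∃ d : Λ.FinalNode → Λ.FinalNode → Set Λ.FinalNode, (∀ η ν, (d η ν).Countable) ∧
      ∀ I : Set Λ.FinalNode, I.Countable → I.Nonempty → (∀ η ∈ I, ∀ ν ∈ I, d η ν ⊆ I) →
        IsRelComplete (sub e I) := by
  have hreg := Λ.isRegular
  have hunc := aleph0_lt hroot
  have hsucc : ∀ α : Iio κ.ord, Order.succ α.1 < (Λ.lam []).ord := fun α => by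
    rw [Λ.lam_root]; exact (isSuccLimit_ord hreg.aleph0_le).succ_lt α.2
  have hW : ∀ α : Iio κ.ord, #(Λ.slice [] (Order.succ α.1)) < Cardinal.lift.{u + 1} κ := fun α => by
    have := mk_slice_lt Λ.root_mem (hsucc α)
    rwa [Λ.lam_root] at this
  choose r hwo hfin using fun α => hr.exists_isWellOrder (hW α)
  have hfirst : ∀ η : Λ.FinalNode, ∃ α : Iio κ.ord, [α.1] <+: η.1 := by
    intro η
    obtain ⟨γ, -, hγ, h⟩ := exists_append_prefix hroot (η := η) List.nil_prefix
    exact ⟨⟨γ, lt_of_lt_of_eq hγ (congrArg ord Λ.lam_root)⟩, h⟩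
  choose first hfirst using hfirst
  refine ⟨fun η ν => ⋃ z ∈ s ν, minimalAt s (r (first η)) z, fun η ν => ?_, ?_⟩
  · refine Set.Countable.biUnion ?_ fun z _ => (minimalAt_subsingleton (r (first η)) z).countable
    rw [← hs]
    exact Set.countable_range _
  intro I hIc hIne hI b
  obtain ⟨c, hc⟩ : ∃ c : Iio κ.ord, ∀ η : I, first η < c := by
    have := hIc.to_subtype
    exact exists_bound hreg (lift_lt_of_countable hunc) fun η : I => first η
  have hwf : WellFounded ((· < ·) : Iio κ.ord → Iio κ.ord → Prop) := wellFounded_lt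
  -- As a least strict bound, δ makes stage δ the union of the slices belonging to first entries of
  -- I, for which closure was arranged.
  obtain ⟨δ, hδ, hmin⟩ := hwf.has_min {c | ∀ η : I, first η < c} ⟨c, hc⟩
  obtain ⟨b', hb'⟩ := hA.exists_isGreatest_stage hs hp hr hroot hchild δ b
  have hIδ : sub e I ≤ stage e δ :=
    sub_mono fun η hη => Or.inr ⟨(first η).1, hδ ⟨η, hη⟩, hfirst η⟩
  have hne : Nonempty (first '' I) := (hIne.image first).to_subtype
  have hcover : Λ.region [] δ ⊆ ⋃ α : first '' I, Λ.slice [] (Order.succ α.1.1) := by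
    rw [region_nil]
    rintro ν ⟨γ, hγ, hν⟩
    have hγκ : γ < κ.ord := hγ.trans δ.2
    obtain ⟨η, hη⟩ : ∃ η : I, (⟨γ, hγκ⟩ : Iio κ.ord) ≤ first η := by
      by_contra! h
      exact hmin ⟨γ, hγκ⟩ h hγ
    refine Set.mem_iUnion.2 ⟨⟨first η, ⟨η, η.2, rfl⟩⟩, γ, ?_, hν⟩
    exact Order.lt_succ_iff.2 hη
  obtain ⟨⟨_, η, hη, rfl⟩, hα⟩ := exists_mem_sub_of_directed
    (U := fun α : first '' I => Λ.slice [] (Order.succ α.1.1))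
    (fun _ _ h => slice_mono (Order.succ_le_succ h)) (sub_mono hcover hb'.1.1)
  have hfree := hA.freeOver_union_of_minimalAt_subset hs hp (I := I) (r (first η)) (hfin (first η))
    fun ν hν z hz => (Set.subset_biUnion_of_mem
      (u := fun z => minimalAt s (r (first η)) z) hz).trans (hI η hη ν hν)
  obtain ⟨a, ha⟩ := hfree.exists_isGreatest (le_sup_right (a := sub e I) hα)
  exact ⟨a, isGreatest_of_isGreatest hIδ hb' ha⟩

theorem IsGluing.openlyGenerated (hA : IsGluing D.h x e) (hs : ∀ η, range (x η) = s η)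
    (hp : ∀ η k, x η '' D.block k = p η k) (hr : Λ.StrongReshuffling s p)
    (hroot : ¬ IsFinalNode Λ.S []) (hchild : ∀ β, ¬ IsFinalNode Λ.S [β]) :
    OpenlyGenerated A := by
  obtain ⟨d, hd, hrc⟩ := hA.exists_closing hs hp hr hroot hchild
  obtain ⟨b, hb⟩ := D.exists_notMem_closure
  have := D.countable
  refine ⟨{c | ∃ I : Set Λ.FinalNode, I.Countable ∧ I.Nonempty ∧
    (∀ η ∈ I, ∀ ν ∈ I, d η ν ⊆ I) ∧ c = sub e I}, ⟨?_, ?_, ?_⟩, ?_⟩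
  · rintro _ ⟨I, hI, -, -, rfl⟩
    exact countable_closure (hI.biUnion fun η _ => Set.countable_range (e η))
  · intro a ha
    have hex : ∀ y : A, ∃ F : Set Λ.FinalNode, F.Finite ∧ y ∈ sub e F := fun y => by
      have hy : y ∈ sub e Set.univ := by rw [hA.sub_univ]; exact mem_top
      obtain ⟨F, hF, -, h⟩ := exists_finset_mem_sub hy
      exact ⟨F, hF, h⟩
    choose F hF hyF using hex
    obtain ⟨η, -⟩ := above_nonempty [] Λ.root_mem
    obtain ⟨K, hK, hKc, hKd⟩ := exists_countable_closed hd
      ((Set.countable_singleton η).union (ha.biUnion fun y _ => (hF y).countable))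
    refine ⟨_, ⟨K, hKc, ⟨η, hK (Or.inl rfl)⟩, hKd, rfl⟩, fun y hy => ?_⟩
    refine sub_mono (fun ν hν => hK (Or.inr ?_)) (hyF y)
    exact Set.mem_biUnion hy hν
  · intro c hc hmem
    choose I hIc hIne hId hcI using hmem
    -- The index sets can be recovered from the algebras, so an increasing chain of algebras comes
    -- from an increasing chain of closed index sets.
    have hI : Monotone I := fun i j hij η hη => by
      refine hA.mem_of_emb_mem_sub hb ?_
      have h := hc hij
      rw [hcI, hcI] at h
      exact h (emb_mem_sub hη b)
    refine ⟨⋃ i, I i, Set.countable_iUnion hIc,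
      (hIne 0).mono (Set.subset_iUnion I 0), fun η hη ν hν => ?_, ?_⟩
    · obtain ⟨i, hi⟩ := Set.mem_iUnion.1 hη
      obtain ⟨j, hj⟩ := Set.mem_iUnion.1 hν
      exact (hId (max i j) η (hI (le_max_left _ _) hi) ν (hI (le_max_right _ _) hj)).trans
        (Set.subset_iUnion I _)
    · refine subset_antisymm (Set.iUnion_subset fun i => ?_) fun a ha => ?_
      · rw [hcI]
        exact sub_mono (Set.subset_iUnion I i)
      · obtain ⟨i, hi⟩ := exists_mem_sub_of_directed hI ha
        refine Set.mem_iUnion.2 ⟨i, ?_⟩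
        rw [hcI]
        exact hi
  · rintro _ ⟨I, hIc, hIne, hId, rfl⟩
    exact ⟨sub e I, rfl, hrc I hIc hIne hId⟩

end Open

end OpenGen

/-! ### The main result -/

theorem lemma4p12 {κ : Cardinal.{u}} {X : Type u} (Λ : LambdaSystem κ X)
    (n : ℕ) (hn : 1 < n) (hheight : Λ.HasHeight n)
    -- the family `𝒮 = (s_η)` and the division of each `s_η` into `n` infinite parts `s_η^k`
    (s : Λ.FinalNode → Set X) (hs : Λ.IsBasedOn s)
    (p : Λ.FinalNode → Fin n → Set X)
    (hp_infinite : ∀ η k, (p η k).Infinite)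
    (hp_disjoint : ∀ η, Pairwise fun k l => Disjoint (p η k) (p η l))
    (hp_union : ∀ η, ⋃ k, p η k = s η)
    (hreshuffle : Λ.StrongReshuffling s p)
    -- the objects from (CP+) and the enumerations of the sets `s_η`
    {L : Type w} [BooleanAlgebra L] (D : CPPlus n L)
    (x : Λ.FinalNode → ℕ → X) (hx_injective : ∀ η, Function.Injective (x η))
    (hx_block : ∀ η k, x η '' D.block k = p η k) :
    AlmostFree (AlgebraOf D.h x) κ ∧
      OpenlyGenerated (AlgebraOf D.h x) ∧
      Gamma (AlgebraOf D.h x) κ = clubClass Λ.rootSet := by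
  have hrange : ∀ η, range (x η) = s η := fun η => by
    simp only [← Set.image_univ, ← D.block_cover, Set.image_iUnion, hx_block, hp_union]
  have hbased : ∀ η, s η ⊆ Λ.Bbar η.1 := fun η => (hs η).2.2
  have hroot : ¬ IsFinalNode Λ.S [] := fun h => by
    have := hheight _ h
    simp at this
    omega
  have hchild : ∀ β, ¬ IsFinalNode Λ.S [β] := fun β h => by
    have := hheight _ h
    simp at this
    omega
  have hA := isGluing_algebraOf D.h_independent D.h_injective hx_injective
  have hF := isKappaFiltration_stage hA hroot
  refine ⟨⟨hA.lift_mk_eq hroot, _, hF, isFree_stage hA hrange hx_block hreshuffle hroot⟩,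
    hA.openlyGenerated hrange hx_block hreshuffle hroot hchild,
    gamma_eq_clubClass Λ.isRegular (LambdaSystem.aleph0_lt hroot) hF fun F hF' =>
      nonFreeSet_inter hA hrange hx_block hreshuffle hbased hroot hF'⟩
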